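/- A (finite) hypergraph $H=(V,\mathcal E)$ consists of a finite vertex set $V$ and a finite family $\mathcal E$ of non-empty subsets of $V$, called hyperedges; distinct members of the family may contain the same vertices. Its incidence graph is the bipartite graph on $V\cup\mathcal E$ in which $v\in V$ and $E\in\mathcal E$ are adjacent if $v\in E$; all hypergraphs considered have a connected incidence graph. Put $N=\sum_{E\in\mathcal E}|E|$. A join tree of $H$ is a tree $T$ whose nodes are the hyperedges of $H$ such that, for each $v\in V$, the hyperedges containing $v$ induce a subtree of $T$; $H$ is ($\alpha$-)acyclic if it has a join tree. The union join graph $G$ of an acyclic hypergraph $H$ is the graph with vertex set $\mathcal E$ in which two hyperedges are adjacent if they are adjacent in some join tree of $H$; $|G|$ denotes its number of vertices plus its number of edges. **Theorem.** There is an algorithm that, given an acyclic hypergraph $H$ by its incidence graph, computes the union join graph $G$ of $H$ in $$\mathcal O\bigl(N^2/\log N+|G|\bigr)$$ time. More precisely, there are a single program for a unit-cost word RAM and constants $c,C$ such that, for every such $H$, every listing of the edges of its incidence graph as input, and every word length $w$ with $2^w\ge (N+2)^c$, the program halts having written a list that contains each edge of $G$ exactly once, after at most $C\,\bigl(N^2/\log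 N+|G|\bigr)$ steps (for $N=1$: after at most $C$ steps). -/

import Mathlib

/-! ### Hypergraphs, join trees, union join graphs -/

/-- A hypergraph on the vertex type `V` whose hyperedges are indexed by `ι`. Distinct indices are
distinct hyperedges, even if they contain the same vertices; every hyperedge is non-empty. -/
structure FamHypergraph (V ι : Type*) where
  edge : ι → Finset V
  edge_nonempty : ∀ e, (edge e).Nonempty

namespace FamHypergraph

variable {V ι : Type*}

/-- The bipartite incidence graph. -/
def incidenceGraph (H : FamHypergraph V ι) : SimpleGraph (V ⊕ ι) where
  Adj x y := (∃ v e, v ∈ H.edge e ∧ x = Sum.inl v ∧ y = Sum.inr e) ∨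
    (∃ v e, v ∈ H.edge e ∧ x = Sum.inr e ∧ y = Sum.inl v)
  symm := ⟨by
    rintro x y (⟨v, e, h, hx, hy⟩ | ⟨v, e, h, hx, hy⟩)
    · exact Or.inr ⟨v, e, h, hy, hx⟩
    · exact Or.inl ⟨v, e, h, hy, hx⟩⟩
  loopless := ⟨by
    rintro x (⟨v, e, h, hx, hy⟩ | ⟨v, e, h, hx, hy⟩) <;> simp [hx] at hy⟩

/-- `T` is a join tree of `H`: a tree whose nodes are the hyperedges, such that for each vertex
the hyperedges containing it induce a subtree. -/
def IsJoinTree (H : FamHypergraph V ι) (T : SimpleGraph ι) : Prop :=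
  T.IsTree ∧ ∀ v : V, (T.induce {e | v ∈ H.edge e}).Preconnected

/-- `H` is (α-)acyclic: it admits a join tree. -/
def IsAcyclic (H : FamHypergraph V ι) : Prop :=
  ∃ T : SimpleGraph ι, H.IsJoinTree T

/-- The union join graph: the union of all join trees. -/
def unionJoinGraph (H : FamHypergraph V ι) : SimpleGraph ι :=
  sSup {T | H.IsJoinTree T}

/-- `N`, the sum of the cardinalities of the hyperedges. -/
def totalSize [Fintype ι] (H : FamHypergraph V ι) : ℕ :=
  ∑ e, (H.edge e).card

/-- The list `L` enumerates the edges of the incidence graph, each exactly once, in any order. -/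
def IsIncidenceList (H : FamHypergraph V ι) (L : List (V × ι)) : Prop :=
  L.Nodup ∧ ∀ v e, (v, e) ∈ L ↔ v ∈ H.edge e

end FamHypergraph

/-- The size of a finite graph: number of vertices plus number of edges. -/
noncomputable def SimpleGraph.graphSize {ι : Type*} [Fintype ι] (G : SimpleGraph ι) : ℕ :=
  Fintype.card ι + G.edgeSet.ncard

/-- The list `L` enumerates the edges of `G`, each exactly once, in any order and with either
orientation. -/
def SimpleGraph.IsEdgeList {ι : Type*} (G : SimpleGraph ι) (L : List (ι × ι)) : Prop :=
  (L.map (fun p => s(p.1, p.2))).Nodup ∧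
    ∀ z : Sym2 ι, z ∈ L.map (fun p => s(p.1, p.2)) ↔ z ∈ G.edgeSet

/-! ### A unit-cost word RAM

Words are the natural numbers below `2 ^ w`. A machine has registers and constantly many
word-addressed arrays of words (only those named in the program are ever touched). A program is
a finite structured text; each elementary instruction and each evaluated test costs one step. -/

namespace WordRAM

/-- Arithmetic instructions. -/
inductive ArithOp
  | add | sub | mul | div | mod

/-- Arithmetic on words of `w` bits. Results are reduced modulo `2 ^ w`; subtraction is
truncated at `0`, division and remainder are those of `ℕ`. -/
def ArithOp.eval (w : ℕ) : ArithOp → ℕ → ℕ → ℕ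
  | .add, a, b => (a + b) % 2 ^ w
  | .sub, a, b => (a - b) % 2 ^ w
  | .mul, a, b => (a * b) % 2 ^ w
  | .div, a, b => (a / b) % 2 ^ w
  | .mod, a, b => (a % b) % 2 ^ w

/-- Comparisons of the contents of two registers. -/
inductive Test
  | lt (x y : ℕ)
  | le (x y : ℕ)
  | eq (x y : ℕ)
  | ne (x y : ℕ)

/-- Contents of the registers and of the arrays. -/
structure State where
  reg : ℕ → ℕ
  arr : ℕ → ℕ → ℕ

def Test.Holds (s : State) : Test → Prop
  | .lt x y => s.reg x < s.reg y
  | .le x y => s.reg x ≤ s.reg y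
  | .eq x y => s.reg x = s.reg y
  | .ne x y => s.reg x ≠ s.reg y

/-- Programs. Register and array names and literals are fixed in the program text. -/
inductive Prog
  | skip
  /-- register `x` becomes the literal `k` -/
  | const (x k : ℕ)
  /-- register `x` becomes register `y` -/
  | move (x y : ℕ)
  /-- register `x` becomes the result of `o` on registers `y`, `z` -/
  | arith (o : ArithOp) (x y z : ℕ)
  /-- register `x` becomes the cell of array `a` addressed by register `y` -/
  | load (x a y : ℕ)
  /-- the cell of array `a` addressed by register `x` becomes register `y` -/
  | store (a x y : ℕ)
  | seq (p q : Prog)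
  | ite (t : Test) (p q : Prog)
  | loop (t : Test) (p : Prog)

def State.setReg (s : State) (x v : ℕ) : State :=
  { s with reg := Function.update s.reg x v }

def State.setArr (s : State) (a i v : ℕ) : State :=
  { s with arr := Function.update s.arr a (Function.update (s.arr a) i v) }

/-- `Exec w p s t s'`: on words of `w` bits, program `p` started in state `s` halts in state `s'`
after exactly `t` steps. -/
inductive Exec (w : ℕ) : Prog → State → ℕ → State → Prop
  | skip (s : State) : Exec w .skip s 1 s
  | const (s : State) (x k : ℕ) : Exec w (.const x k) s 1 (s.setReg x (k % 2 ^ w))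
  | move (s : State) (x y : ℕ) : Exec w (.move x y) s 1 (s.setReg x (s.reg y))
  | arith (s : State) (o : ArithOp) (x y z : ℕ) :
      Exec w (.arith o x y z) s 1 (s.setReg x (o.eval w (s.reg y) (s.reg z)))
  | load (s : State) (x a y : ℕ) : Exec w (.load x a y) s 1 (s.setReg x (s.arr a (s.reg y)))
  | store (s : State) (a x y : ℕ) :
      Exec w (.store a x y) s 1 (s.setArr a (s.reg x) (s.reg y))
  | seq {p q : Prog} {s s₁ s₂ : State} {t₁ t₂ : ℕ} :
      Exec w p s t₁ s₁ → Exec w q s₁ t₂ s₂ → Exec w (.seq p q) s (t₁ + t₂) s₂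
  | iteTrue {c : Test} {p q : Prog} {s s₁ : State} {t : ℕ} :
      c.Holds s → Exec w p s t s₁ → Exec w (.ite c p q) s (t + 1) s₁
  | iteFalse {c : Test} {p q : Prog} {s s₁ : State} {t : ℕ} :
      ¬ c.Holds s → Exec w q s t s₁ → Exec w (.ite c p q) s (t + 1) s₁
  | loopTrue {c : Test} {p : Prog} {s s₁ s₂ : State} {t₁ t₂ : ℕ} :
      c.Holds s → Exec w p s t₁ s₁ → Exec w (.loop c p) s₁ t₂ s₂ →
      Exec w (.loop c p) s (t₁ + t₂ + 1) s₂
  | loopFalse {c : Test} {p : Prog} {s : State} :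
      ¬ c.Holds s → Exec w (.loop c p) s 1 s

/-- The start state: `input` stands in array `0` from cell `0` on; everything else is `0`. -/
def initState (input : List ℕ) : State where
  reg _ := 0
  arr a i := if a = 0 then input.getD i 0 else 0

/-- In state `s`, the list `output` stands in array `1` from cell `0` on. -/
def HasOutput (s : State) (output : List ℕ) : Prop :=
  ∀ i, ∀ h : i < output.length, s.arr 1 i = output[i]

/-- The two endpoints of each pair, one pair after the other. -/
def pairWords {a b : ℕ} (L : List (Fin a × Fin b)) : List ℕ :=
  L.flatMap fun p => [(p.1 : ℕ), (p.2 : ℕ)]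

/-- An incidence graph as a list of words: the number `n` of vertices, the number `m` of
hyperedges, the number of incidences, and then the incidences. -/
def encodeIncidence {n m : ℕ} (L : List (Fin n × Fin m)) : List ℕ :=
  n :: m :: L.length :: pairWords L

/-- A graph as a list of words: the number of vertices, the number of edges, then the edges. -/
def encodeGraph {m : ℕ} (L : List (Fin m × Fin m)) : List ℕ :=
  m :: L.length :: pairWords L

end WordRAM

/-! Fix a join tree T; the separator of an edge gh of T is g ∩ h. If e and f lie on different sides
of gh and both contain its separator, then replacing gh by ef gives another join tree
(`IsJoinTree.exchange`). Conversely, let ef be an edge of some join tree T'. If no edge on the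
T-path from e to f had its separator inside e ∩ f, then each step of this path could be replaced by
a walk in T' avoiding ef, although ef is a bridge of T'. So e and f are adjacent in G exactly if
some edge of T separates them and has its separator contained in both
(`IsJoinTree.unionJoinGraph_adj_iff`). That separator is then e ∩ f itself, so the edges of G are
partitioned by the set S = e ∩ f, which runs over the separators of T.

For one separator S, the hyperedges containing S form a subtree of T all of whose separators include
S. Cutting the edges whose separator equals S splits it into classes, and the edges of G that belong
to S are the pairs from different classes (`unionJoinGraph_adj_iff_splits`). A class is named by its
topmost node, `sepRoot`.

The join tree comes from maximum cardinality search on the hyperedges. On an acyclic hypergraph, the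
part of each hyperedge that is covered by its predecessors lies in a single predecessor
(`IsAcyclic.exists_parent`); this part is the separator, and a suitable predecessor is found from
the moment at which the separator becomes covered (`isParentMap_of_coverTime`).

All this takes time linear in N. The costly task is to find, for each distinct S, the hyperedges
containing S. The positions of the hyperedges are cut into blocks of k positions, k being about half
the binary logarithm of N, and each vertex has one word per block that tells which hyperedges
contain it. A conjunction of two such words is a lookup in a table of 4^k ≤ N + 4 entries. One
separator thus costs about |S| · m / k, and since the separators have total size at most N, all of
them cost O(N² / log N).

Sorting the hyperedges found into classes is linear in their number. Since S is the separator of an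
edge, there are at least two classes, and so the pairs from different classes number at least half
as many as these hyperedges (`length_flat_le`). This work is therefore paid by the output, and no
edge is written twice because S is determined by the pair.

The program is written in a small language of expressions and loops compiled to the machine; `Tr` is
a total-correctness judgement with running time. Arrays start as zero, so sparsely used tables of
quadratic extent need no initialization. -/

namespace SimpleGraph

/-! ### Join trees: exchanging edges, and adjacency in the union join graph. -/

variable {α : Type*} {T : SimpleGraph α}

/-- A walk can be followed until it is about to use the deleted edge; at that moment it is at one of
its ends. -/
theorem Reachable.deleteEdges_or {g h x : α} (hx : T.Reachable x g) :
    (T.deleteEdges {s(g, h)}).Reachable x g ∨ (T.deleteEdges {s(g, h)}).Reachable x h := by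
  obtain ⟨p⟩ := hx
  induction p with
  | nil => exact Or.inl .rfl
  | @cons a b c hab p ih =>
    by_cases hs : s(a, b) = s(c, h)
    · rcases Sym2.eq_iff.1 hs with ⟨rfl, rfl⟩ | ⟨rfl, rfl⟩
      · exact Or.inl .rfl
      · exact Or.inr .rfl
    · have : (T.deleteEdges {s(c, h)}).Adj a b := by simp [hab, hs]
      exact ih.imp this.reachable.trans this.reachable.trans

theorem IsAcyclic.not_reachable_deleteEdges (hT : T.IsAcyclic) {g h : α} (hgh : T.Adj g h) :
    ¬ (T.deleteEdges {s(g, h)}).Reachable g h :=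
  isBridge_iff.1 (isAcyclic_iff_forall_adj_isBridge.1 hT hgh)

end SimpleGraph

namespace FamHypergraph

variable {V ι : Type*} {H : FamHypergraph V ι} {T T' : SimpleGraph ι}

/-- A vertex common to two hyperedges separated by a join tree edge lies on both its ends. -/
theorem IsJoinTree.mem_of_not_reachable (hT : H.IsJoinTree T) {g h e f : ι} {v : V}
    (hef : ¬ (T.deleteEdges {s(g, h)}).Reachable e f) (he : v ∈ H.edge e) (hf : v ∈ H.edge f) :
    v ∈ H.edge g ∧ v ∈ H.edge h := by
  by_contra hgh
  refine hef ?_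
  -- If v misses an end of gh, the subtree of v does not use gh and survives its deletion.
  let φ : T.induce {e | v ∈ H.edge e} →g T.deleteEdges {s(g, h)} :=
    { toFun := Subtype.val
      map_rel' := by
        rintro ⟨a, ha⟩ ⟨b, hb⟩ hab
        simp only [SimpleGraph.deleteEdges_adj, Set.mem_singleton_iff]
        refine ⟨hab, fun hs => hgh ?_⟩
        rcases Sym2.eq_iff.1 hs with ⟨rfl, rfl⟩ | ⟨rfl, rfl⟩
        exacts [⟨ha, hb⟩, ⟨hb, ha⟩] }
  exact (hT.2 v ⟨e, he⟩ ⟨f, hf⟩).map φ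

/-- Exchanging a join tree edge `gh` for `ef` gives another join tree, if `ef` joins the two sides
of `gh` and `e`, `f` contain the separator of `gh`. -/
theorem IsJoinTree.exchange (hT : H.IsJoinTree T) {g h e f : ι} (hgh : T.Adj g h)
    (he : (T.deleteEdges {s(g, h)}).Reachable e g) (hf : (T.deleteEdges {s(g, h)}).Reachable f h)
    (hsub : ∀ v, v ∈ H.edge g → v ∈ H.edge h → v ∈ H.edge e ∧ v ∈ H.edge f) :
    H.IsJoinTree (T.deleteEdges {s(g, h)} ⊔ SimpleGraph.edge e f) := by
  have hnr := hT.1.isAcyclic.not_reachable_deleteEdges hgh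
  have hnef : ¬ (T.deleteEdges {s(g, h)}).Reachable e f :=
    fun h' => hnr (he.symm.trans (h'.trans hf))
  have hne : e ≠ f := fun h' => hnef (h' ▸ .rfl)
  have hadj : (T.deleteEdges {s(g, h)} ⊔ SimpleGraph.edge e f).Adj e f := by
    simp [SimpleGraph.edge_adj, hne]
  refine ⟨⟨?_, ?_⟩, fun v => ?_⟩
  · have key : ∀ x, (T.deleteEdges {s(g, h)} ⊔ SimpleGraph.edge e f).Reachable x e := by
      intro x
      rcases (hT.1.connected x g).deleteEdges_or (h := h) with hx | hx
      · exact (hx.trans he.symm).mono le_sup_left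
      · exact ((hx.trans hf.symm).mono le_sup_left).trans hadj.symm.reachable
    have := hT.1.connected.nonempty
    exact ⟨fun x y => (key x).trans (key y).symm⟩
  · exact (hT.1.isAcyclic.anti (SimpleGraph.deleteEdges_le _)).sup_edge_of_not_reachable hnef
  · set A : Set ι := {e | v ∈ H.edge e}
    -- If v lies in the separator, its subtree falls into two halves when gh is deleted, and these
    -- are rejoined by ef, both of whose ends contain v. Otherwise its subtree never used gh.
    by_cases hv : v ∈ H.edge g ∧ v ∈ H.edge h
    · obtain ⟨hve, hvf⟩ := hsub v hv.1 hv.2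
      set F := T.induce A
      have hle : F.deleteEdges {s(⟨g, hv.1⟩, ⟨h, hv.2⟩)} ≤
          (T.deleteEdges {s(g, h)} ⊔ SimpleGraph.edge e f).induce A := by
        rintro ⟨a, ha⟩ ⟨b, hb⟩ hab
        simp only [SimpleGraph.deleteEdges_adj, Set.mem_singleton_iff, SimpleGraph.comap_adj,
          SimpleGraph.sup_adj] at hab ⊢
        refine Or.inl ⟨hab.1, fun hs => hab.2 ?_⟩
        rcases Sym2.eq_iff.1 hs with ⟨h1, h2⟩ | ⟨h1, h2⟩
        · simp only [Function.Embedding.subtype_apply] at h1 h2; subst h1 h2; rfl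
        · simp only [Function.Embedding.subtype_apply] at h1 h2; subst h1 h2; exact Sym2.eq_swap
      let φ : F.deleteEdges {s(⟨g, hv.1⟩, ⟨h, hv.2⟩)} →g T.deleteEdges {s(g, h)} :=
        { toFun := Subtype.val
          map_rel' := by
            rintro ⟨a, ha⟩ ⟨b, hb⟩ hab
            simp only [SimpleGraph.deleteEdges_adj, Set.mem_singleton_iff] at hab ⊢
            refine ⟨hab.1, fun hs => hab.2 ?_⟩
            rcases Sym2.eq_iff.1 hs with ⟨h1, h2⟩ | ⟨h1, h2⟩
            · subst h1 h2; rfl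
            · subst h1 h2; exact Sym2.eq_swap }
      have hor : ∀ x : A, (F.deleteEdges {s(⟨g, hv.1⟩, ⟨h, hv.2⟩)}).Reachable x ⟨g, hv.1⟩ ∨
          (F.deleteEdges {s(⟨g, hv.1⟩, ⟨h, hv.2⟩)}).Reachable x ⟨h, hv.2⟩ :=
        fun x => (hT.2 v x ⟨g, hv.1⟩).deleteEdges_or
      -- Since e is on the side of g in the whole tree, it cannot reach h within the subtree of v
      -- either.
      have heg := (hor ⟨e, hve⟩).resolve_right fun h' =>
        hnr (he.symm.trans (h'.map φ))
      have hfh := (hor ⟨f, hvf⟩).resolve_left fun h' =>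
        hnr ((h'.map φ).symm.trans hf)
      have hadj' : ((T.deleteEdges {s(g, h)} ⊔ SimpleGraph.edge e f).induce A).Adj
          ⟨e, hve⟩ ⟨f, hvf⟩ := hadj
      have key : ∀ x : A, ((T.deleteEdges {s(g, h)} ⊔ SimpleGraph.edge e f).induce A).Reachable
          x ⟨e, hve⟩ := by
        intro x
        rcases hor x with hx | hx
        · exact (hx.trans heg.symm).mono hle
        · exact ((hx.trans hfh.symm).mono hle).trans hadj'.symm.reachable
      exact fun x y => (key x).trans (key y).symm
    · refine (hT.2 v).mono ?_
      rintro ⟨a, ha⟩ ⟨b, hb⟩ hab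
      simp only [SimpleGraph.comap_adj, SimpleGraph.sup_adj, SimpleGraph.deleteEdges_adj,
        Set.mem_singleton_iff] at hab ⊢
      refine Or.inl ⟨hab, fun hs => hv ?_⟩
      rcases Sym2.eq_iff.1 hs with ⟨h1, h2⟩ | ⟨h1, h2⟩
      · simp only [Function.Embedding.subtype_apply] at h1 h2; subst h1 h2; exact ⟨ha, hb⟩
      · simp only [Function.Embedding.subtype_apply] at h1 h2; subst h1 h2; exact ⟨hb, ha⟩

/-- Two hyperedges are adjacent in the union join graph iff some edge of a given join tree
separates them and has its separator contained in both. -/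
theorem IsJoinTree.unionJoinGraph_adj_iff (hT : H.IsJoinTree T) (e f : ι) :
    H.unionJoinGraph.Adj e f ↔ ∃ g h, T.Adj g h ∧ ¬ (T.deleteEdges {s(g, h)}).Reachable e f ∧
      ∀ v, v ∈ H.edge g → v ∈ H.edge h → v ∈ H.edge e ∧ v ∈ H.edge f := by
  have hadj : H.unionJoinGraph.Adj e f ↔ ∃ T', H.IsJoinTree T' ∧ T'.Adj e f := by
    simp [unionJoinGraph, SimpleGraph.sSup_adj]
  rw [hadj]
  constructor
  · rintro ⟨T', hT', hef⟩
    have hnr := hT'.1.isAcyclic.not_reachable_deleteEdges hef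
    -- If no edge of T qualifies, the T-path from e to f can be imitated in T' without ef, which
    -- contradicts that ef is a bridge of T'.
    by_contra hcon
    push Not at hcon
    refine hnr ?_
    obtain ⟨p⟩ := hT.1.connected e f
    have key : ∀ (x y : ι) (p : T.Walk x y), y = f → (T'.deleteEdges {s(e, f)}).Reachable e x →
        (∀ y z, s(y, z) ∈ p.edges → ¬ (T.deleteEdges {s(y, z)}).Reachable e f) →
        (T'.deleteEdges {s(e, f)}).Reachable e f := by
      intro x y p
      induction p with
      | nil => rintro rfl h _; exact h
      | @cons a b c hab p ih =>
        intro hc hr hsep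
        have hab' := hsep a b (by simp)
        obtain ⟨v, hva, hvb, hv⟩ := hcon a b hab hab'
        -- Were a and b on different sides of ef in T', their common vertex v would lie in both e
        -- and f, against its choice.
        have hrab : (T'.deleteEdges {s(e, f)}).Reachable a b := by
          by_contra hn
          exact (hv (hT'.mem_of_not_reachable hn hva hvb).1)
            (hT'.mem_of_not_reachable hn hva hvb).2
        exact ih hc (hr.trans hrab) fun y z hyz => hsep y z (by simp [hyz])
    classical
    obtain ⟨q, hq⟩ : ∃ q : T.Walk e f, q.IsPath := ⟨_, p.bypass_isPath⟩
    -- Each edge of the path separates its ends in T: a walk avoiding it would shorten to a second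
    -- path between them.
    refine key e f q rfl .rfl fun y z hyz hr => ?_
    obtain ⟨r, hr⟩ := SimpleGraph.reachable_deleteEdges_iff_exists_walk.1 hr
    have hrb : r.bypass = q := congrArg Subtype.val
      ((hT.1.isAcyclic.subsingleton_path e f).elim ⟨r.bypass, r.bypass_isPath⟩ ⟨q, hq⟩)
    exact hr (r.edges_bypass_subset_edges (hrb ▸ hyz))
  · rintro ⟨g, h, hgh, hnr, hsub⟩
    have he := (hT.1.connected e g).deleteEdges_or (h := h)
    have hf := (hT.1.connected f g).deleteEdges_or (h := h)
    rcases he with he | he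
    · have hf' := hf.resolve_left fun h' => hnr (he.trans h'.symm)
      refine ⟨_, hT.exchange hgh he hf' hsub, ?_⟩
      simp only [SimpleGraph.sup_adj, SimpleGraph.edge_adj]
      exact Or.inr ⟨by simp, fun h' => hnr (h' ▸ .rfl)⟩
    · have hf' := hf.resolve_right fun h' => hnr (he.trans h'.symm)
      refine ⟨_, hT.exchange (e := f) (f := e) hgh hf' he fun v h1 h2 => (hsub v h1 h2).symm, ?_⟩
      simp only [SimpleGraph.sup_adj, SimpleGraph.edge_adj]
      exact Or.inr ⟨by simp, fun h' => hnr (h' ▸ .rfl)⟩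

end FamHypergraph

/-! ### Sequences of sets: separators, parents and roots. -/

open Finset in
/-- The union of the first `i` members of a sequence of finite sets. -/
def prefixUnion {V : Type*} [DecidableEq V] (P : ℕ → Finset V) (i : ℕ) : Finset V :=
  (range i).biUnion P

/-- The part of the `i`-th set that is covered by its predecessors. -/
def sepSet {V : Type*} [DecidableEq V] (P : ℕ → Finset V) (i : ℕ) : Finset V :=
  P i ∩ prefixUnion P i

section Sequences

variable {V : Type*} [DecidableEq V] {P : ℕ → Finset V} {par : ℕ → ℕ} {m : ℕ}

theorem mem_prefixUnion {i : ℕ} {v : V} : v ∈ prefixUnion P i ↔ ∃ j < i, v ∈ P j := by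
  simp [prefixUnion]

theorem prefixUnion_succ (i : ℕ) : prefixUnion P (i + 1) = prefixUnion P i ∪ P i := by
  ext v; simp only [mem_prefixUnion, Finset.mem_union]
  constructor
  · rintro ⟨j, hj, hv⟩
    rcases Nat.lt_succ_iff_lt_or_eq.1 hj with h | rfl
    exacts [Or.inl ⟨j, h, hv⟩, Or.inr hv]
  · rintro (⟨j, hj, hv⟩ | hv)
    exacts [⟨j, by omega, hv⟩, ⟨i, by omega, hv⟩]

theorem mem_sepSet {i : ℕ} {v : V} : v ∈ sepSet P i ↔ v ∈ P i ∧ ∃ j < i, v ∈ P j := by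
  simp [sepSet, mem_prefixUnion]

theorem sepSet_subset (i : ℕ) : sepSet P i ⊆ P i := Finset.inter_subset_left

theorem sepSet_zero : sepSet P 0 = ∅ := by
  ext v; simp [mem_sepSet]

theorem one_le_of_ssubset_sepSet {S : Finset V} {x : ℕ} (h : S ⊂ sepSet P x) : 1 ≤ x := by
  by_contra h0
  obtain rfl : x = 0 := by omega
  simp [sepSet_zero] at h

/-- The running intersection property with explicit parents. -/
def IsParentMap (P : ℕ → Finset V) (par : ℕ → ℕ) (m : ℕ) : Prop :=
  ∀ i, 1 ≤ i → i < m → par i < i ∧ sepSet P i ⊆ P (par i)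

/-- Follow parents as long as the crossed separator properly contains `S`. -/
def sepRoot (P : ℕ → Finset V) (par : ℕ → ℕ) (S : Finset V) (x : ℕ) : ℕ :=
  if _h : S ⊂ sepSet P x ∧ par x < x then sepRoot P par S (par x) else x
termination_by x
decreasing_by exact _h.2

/-- `a` and `b` contain `S` and lie in different classes once the separators equal to `S` are cut. -/
def Splits (P : ℕ → Finset V) (par : ℕ → ℕ) (S : Finset V) (a b : ℕ) : Prop :=
  S ⊆ P a ∧ S ⊆ P b ∧ sepRoot P par S a ≠ sepRoot P par S b

theorem Splits.symm {S : Finset V} {a b : ℕ} (h : Splits P par S a b) : Splits P par S b a :=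
  ⟨h.2.1, h.1, h.2.2.symm⟩

/-- The guard `par x < x` in `sepRoot` is there for termination; a parent map satisfies it
automatically, because position 0 has an empty separator. -/
theorem sepRoot_of_ssubset (hpar : IsParentMap P par m) {S : Finset V} {x : ℕ} (hx : x < m)
    (h : S ⊂ sepSet P x) : sepRoot P par S x = sepRoot P par S (par x) := by
  have h1 := one_le_of_ssubset_sepSet h
  rw [sepRoot, dif_pos ⟨h, (hpar x h1 hx).1⟩]

theorem sepRoot_of_not_ssubset {S : Finset V} {x : ℕ}
    (h : ¬ S ⊂ sepSet P x) : sepRoot P par S x = x := by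
  rw [sepRoot, dif_neg fun h' => h h'.1]

/-- Iterated parents. -/
inductive ParentDesc (par : ℕ → ℕ) (m i : ℕ) : ℕ → Prop
  | refl : ParentDesc par m i i
  | step (x : ℕ) : 1 ≤ x → x < m → ParentDesc par m i (par x) → ParentDesc par m i x

theorem ParentDesc.le (hpar : IsParentMap P par m) {i x : ℕ} (h : ParentDesc par m i x) :
    i ≤ x := by
  induction h with
  | refl => exact le_rfl
  | step x h1 h2 _ ih => have := (hpar x h1 h2).1; omega

theorem ParentDesc.iff_parent {i x : ℕ} (h1 : 1 ≤ x) (h2 : x < m) (hx : x ≠ i) :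
    ParentDesc par m i x ↔ ParentDesc par m i (par x) := by
  refine ⟨fun h => ?_, .step x h1 h2⟩
  cases h with
  | refl => exact absurd rfl hx
  | step _ _ _ h => exact h

theorem parentDesc_sepRoot (hpar : IsParentMap P par m) {S : Finset V} {x : ℕ} (hx : x < m) :
    ParentDesc par m (sepRoot P par S x) x := by
  induction x using Nat.strong_induction_on with
  | _ x ih =>
    by_cases h : S ⊂ sepSet P x
    · have h1 := one_le_of_ssubset_sepSet h
      have h2 := (hpar x h1 hx).1
      rw [sepRoot_of_ssubset hpar hx h]
      exact .step x h1 hx (ih _ h2 (h2.trans hx))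
    · rw [sepRoot_of_not_ssubset h]; exact .refl

/-- The climb never leaves the sets containing S, because a separator that is crossed lies in the
parent as well. -/
theorem subset_sepRoot (hpar : IsParentMap P par m) {S : Finset V} {x : ℕ} (hx : x < m)
    (hS : S ⊆ P x) : sepRoot P par S x ≤ x ∧ S ⊆ P (sepRoot P par S x) ∧
      ¬ S ⊂ sepSet P (sepRoot P par S x) := by
  induction x using Nat.strong_induction_on with
  | _ x ih =>
    by_cases h : S ⊂ sepSet P x
    · have h1 := one_le_of_ssubset_sepSet h
      have h2 := hpar x h1 hx
      rw [sepRoot_of_ssubset hpar hx h]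
      have := ih _ h2.1 (h2.1.trans hx) (h.1.trans h2.2)
      exact ⟨this.1.trans h2.1.le, this.2⟩
    · rw [sepRoot_of_not_ssubset h]; exact ⟨le_rfl, hS, h⟩

/-- A descendant of an exact occurrence of `S` as separator has its root among these. -/
theorem le_sepRoot_of_parentDesc (hpar : IsParentMap P par m) {S : Finset V} {i x : ℕ} (hx : x < m)
    (hi : ¬ S ⊂ sepSet P i) (h : ParentDesc par m i x) : i ≤ sepRoot P par S x := by
  induction h with
  | refl => rw [sepRoot_of_not_ssubset hi]
  | step x h1 h2 hd ih =>
    by_cases hS : S ⊂ sepSet P x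
    · rw [sepRoot_of_ssubset hpar hx hS]
      exact ih ((hpar x h1 h2).1.trans hx)
    · rw [sepRoot_of_not_ssubset hS]
      exact (ParentDesc.step x h1 h2 hd).le hpar

/-- If two sets containing `S` have different roots, some occurrence of `S` as a separator has
exactly one of them among its descendants. -/
theorem Splits.exists_separator (hpar : IsParentMap P par m) {S : Finset V} {a b : ℕ} (ha : a < m)
    (hb : b < m) (h : Splits P par S a b) :
    ∃ i, 1 ≤ i ∧ i < m ∧ sepSet P i = S ∧ ¬ (ParentDesc par m i a ↔ ParentDesc par m i b) := by
  -- The larger root is the occurrence sought. S also lies in the set at the smaller root, hence is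
  -- covered earlier, and the climb stopped, so the separator there is S. If the other position
  -- descended from it too, its own root could not be smaller.
  wlog hlt : sepRoot P par S b < sepRoot P par S a generalizing a b
  · obtain ⟨i, h1, h2, h3, h4⟩ := this hb ha h.symm (lt_of_le_of_ne (not_lt.1 hlt) h.2.2)
    exact ⟨i, h1, h2, h3, fun h' => h4 h'.symm⟩
  obtain ⟨ha1, ha2, ha3⟩ := subset_sepRoot hpar ha h.1
  obtain ⟨hb1, hb2, hb3⟩ := subset_sepRoot hpar hb h.2.1
  refine ⟨sepRoot P par S a, by omega, by omega, ?_, fun hiff => ?_⟩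
  · have hsub : S ⊆ sepSet P (sepRoot P par S a) := fun v hv =>
      mem_sepSet.2 ⟨ha2 hv, _, hlt, hb2 hv⟩
    by_contra hne
    exact ha3 (Finset.ssubset_iff_subset_ne.2 ⟨hsub, fun h => hne h.symm⟩)
  · have := le_sepRoot_of_parentDesc hpar hb ha3 (hiff.1 (parentDesc_sepRoot hpar ha))
    omega

end Sequences

/-! ### Maximum cardinality search, the parent tree, and the edges in terms of roots. -/

namespace FamHypergraph

variable {V ι : Type*} [DecidableEq V] {H : FamHypergraph V ι} {o : ℕ → ι} {m : ℕ} {par : ℕ → ℕ}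

/-- `o 0, …, o (m - 1)` lists all indices without repetition. -/
structure IsListing (o : ℕ → ι) (m : ℕ) : Prop where
  inj : ∀ i < m, ∀ j < m, o i = o j → i = j
  surj : ∀ e, ∃ i < m, o i = e

/-- Each hyperedge has the most vertices in common with its predecessors, among all that remain. -/
def IsMaxCardinality (P : ℕ → Finset V) (m : ℕ) : Prop :=
  ∀ i < m, ∀ j < m, i ≤ j → (P j ∩ prefixUnion P i).card ≤ (P i ∩ prefixUnion P i).card

/-- Maximum cardinality search on an acyclic hypergraph has the running intersection property. -/
theorem IsAcyclic.exists_parent (hH : H.IsAcyclic) (ho : IsListing o m)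
    (hmax : IsMaxCardinality (fun i => H.edge (o i)) m) (i : ℕ) (hi : 1 ≤ i) (him : i < m) :
    ∃ j < i, sepSet (fun i => H.edge (o i)) i ⊆ H.edge (o j) := by
  set P : ℕ → Finset V := fun i => H.edge (o i) with hP
  -- The join tree changes during the induction: before step i there is one in which each of the
  -- first i hyperedges, except the initial one, has an earlier neighbour.
  have step : ∀ i, 1 ≤ i → i < m → (∃ T, H.IsJoinTree T ∧
      ∀ j, 1 ≤ j → j < i → ∃ j' < j, T.Adj (o j) (o j')) →
      (∃ j < i, sepSet P i ⊆ P j) ∧ (∃ T, H.IsJoinTree T ∧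
      ∀ j, 1 ≤ j → j < i + 1 → ∃ j' < j, T.Adj (o j) (o j')) := by
    rintro i hi him ⟨T, hT, hTo⟩
    -- an edge by which a walk from `o i` enters the earlier part
    obtain ⟨x, y, hy, hix, hxy, hr⟩ : ∃ x y, y < i ∧ (∀ j < i, x ≠ o j) ∧ T.Adj x (o y) ∧
        (T.deleteEdges {s(x, o y)}).Reachable (o i) x := by
      obtain ⟨p⟩ := hT.1.connected (o i) (o 0)
      classical
      have key : ∀ (a b : ι) (p : T.Walk a b), p.IsPath → b = o 0 → (∀ j < i, a ≠ o j) →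
          ∃ x y, y < i ∧ (∀ j < i, x ≠ o j) ∧ T.Adj x (o y) ∧
            ∃ q : T.Walk a x, (∀ z ∈ q.support, ∀ j < i, z ≠ o j) := by
        intro a b p
        induction p with
        | nil => rintro _ rfl h; exact absurd rfl (h 0 (by omega))
        | @cons a b c hab p ih =>
          intro hp hc ha
          by_cases hb : ∃ y < i, b = o y
          · obtain ⟨y, hy, rfl⟩ := hb
            exact ⟨a, y, hy, ha, hab, .nil, by simpa using ha⟩
          · push Not at hb
            obtain ⟨x, y, hy, hx, hxy, q, hq⟩ := ih hp.of_cons hc hb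
            refine ⟨x, y, hy, hx, hxy, .cons hab q, ?_⟩
            intro z hz j hj
            rcases List.mem_cons.1 (by simpa using hz) with rfl | hz
            exacts [ha j hj, hq z hz j hj]
      obtain ⟨x, y, hy, hx, hxy, q, hq⟩ := key _ _ p.bypass p.bypass_isPath rfl fun j hj h =>
        absurd (ho.inj _ him _ (hj.trans him) h) (by omega)
      refine ⟨x, y, hy, hx, hxy, SimpleGraph.reachable_deleteEdges_iff_exists_walk.2
        ⟨q, fun h => ?_⟩⟩
      exact hq _ (q.snd_mem_support_of_mem_edges h) y hy rfl
    have hnr := hT.1.isAcyclic.not_reachable_deleteEdges hxy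
    -- The first i hyperedges remain connected to each other when the entering edge is deleted,
    -- since that edge leaves them. Hence it separates all of them from `o i`.
    have hR0 : ∀ j < i, (T.deleteEdges {s(x, o y)}).Reachable (o j) (o 0) := by
      intro j
      induction j using Nat.strong_induction_on with
      | _ j ih =>
        intro hj
        rcases Nat.eq_zero_or_pos j with rfl | h0
        · exact .rfl
        · obtain ⟨j', hj', hadj⟩ := hTo j h0 hj
          have : (T.deleteEdges {s(x, o y)}).Adj (o j) (o j') := by
            simp only [SimpleGraph.deleteEdges_adj, Set.mem_singleton_iff]
            refine ⟨hadj, fun h => ?_⟩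
            rcases Sym2.eq_iff.1 h with ⟨h, _⟩ | ⟨_, h⟩
            exacts [hix j hj h.symm, hix j' (hj'.trans hj) h.symm]
          exact this.reachable.trans (ih j' hj' (hj'.trans hj))
    have hR : ∀ j < i, ¬ (T.deleteEdges {s(x, o y)}).Reachable (o i) (o j) := fun j hj h =>
      hnr (hr.symm.trans (h.trans ((hR0 j hj).trans (hR0 y hy).symm)))
    have hsub1 : sepSet P i ⊆ H.edge x ∩ H.edge (o y) := by
      intro v hv
      obtain ⟨hvi, j, hj, hvj⟩ := mem_sepSet.1 hv
      exact Finset.mem_inter.2 (hT.mem_of_not_reachable (hR j hj) hvi hvj)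
    obtain ⟨x', hx'm, rfl⟩ := ho.surj x
    have hx'i : i ≤ x' := by
      by_contra h
      exact hix x' (by omega) rfl
    have hsub2 : H.edge (o x') ∩ H.edge (o y) ⊆ P x' ∩ prefixUnion P i := by
      intro v hv
      obtain ⟨h1, h2⟩ := Finset.mem_inter.1 hv
      exact Finset.mem_inter.2 ⟨h1, mem_prefixUnion.2 ⟨y, hy, h2⟩⟩
    -- The hyperedge x was still available when `o i` was chosen, so maximality bounds the size of
    -- the entering edge's separator and the inclusions become equalities. The entering edge can
    -- thus be exchanged for one from `o i` to `o y`.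
    have heq : sepSet P i = H.edge (o x') ∩ H.edge (o y) := by
      refine Finset.eq_of_subset_of_card_le hsub1 ?_
      exact (Finset.card_le_card hsub2).trans (hmax i him x' hx'm hx'i)
    refine ⟨⟨y, hy, heq ▸ Finset.inter_subset_right⟩, _,
      hT.exchange (e := o i) (f := o y) hxy hr .rfl fun v h1 h2 => ⟨?_, h2⟩, ?_⟩
    · exact sepSet_subset i (heq ▸ Finset.mem_inter.2 ⟨h1, h2⟩)
    · intro j h1 hj
      rcases Nat.lt_succ_iff_lt_or_eq.1 hj with h | rfl
      · obtain ⟨j', hj', hadj⟩ := hTo j h1 h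
        refine ⟨j', hj', Or.inl ?_⟩
        simp only [SimpleGraph.deleteEdges_adj, Set.mem_singleton_iff]
        refine ⟨hadj, fun h => ?_⟩
        rcases Sym2.eq_iff.1 h with ⟨h, _⟩ | ⟨_, h⟩
        exacts [hix j (by omega) h.symm, hix j' (by omega) h.symm]
      · refine ⟨y, hy, Or.inr ?_⟩
        rw [SimpleGraph.edge_adj]
        exact ⟨Or.inl ⟨rfl, rfl⟩, fun h => hR y hy (h ▸ .rfl)⟩
  have hall : ∀ i, 1 ≤ i → i < m → ∃ T, H.IsJoinTree T ∧
      ∀ j, 1 ≤ j → j < i → ∃ j' < j, T.Adj (o j) (o j') := by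
    intro i hi
    induction i, hi using Nat.le_induction with
    | base =>
      intro _
      obtain ⟨T, hT⟩ := hH
      exact ⟨T, hT, fun j h1 h2 => by omega⟩
    | succ i hi ih => intro him; exact (step i hi (by omega) (ih (by omega))).2
  exact (step i hi him (hall i hi him)).1

/-- The tree given by a parent map. -/
def parentTree (o : ℕ → ι) (par : ℕ → ℕ) (m : ℕ) : SimpleGraph ι :=
  SimpleGraph.fromRel fun a b => ∃ i, 1 ≤ i ∧ i < m ∧ a = o i ∧ b = o (par i)

theorem parentTree_adj (ho : IsListing o m) (hpar : ∀ i, 1 ≤ i → i < m → par i < i) {i : ℕ}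
    (h1 : 1 ≤ i) (h2 : i < m) : (parentTree o par m).Adj (o i) (o (par i)) := by
  have := hpar i h1 h2
  refine (SimpleGraph.fromRel_adj _ _ _).2 ⟨fun h => ?_, Or.inl ⟨i, h1, h2, rfl, rfl⟩⟩
  have := ho.inj _ h2 _ (by omega) h
  omega

/-- Every tree edge other than the one above i joins a node to its parent, and these two are both
descendants of i or both not. So the descendants of i are one side of the cut. -/
theorem parentDesc_iff_of_reachable (ho : IsListing o m) (hpar : ∀ i, 1 ≤ i → i < m → par i < i)
    {i a b : ℕ} (ha : a < m) (hb : b < m)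
    (h : ((parentTree o par m).deleteEdges {s(o i, o (par i))}).Reachable (o a) (o b)) :
    ParentDesc par m i a ↔ ParentDesc par m i b := by
  obtain ⟨p⟩ := h
  have key : ∀ (x y : ι) (p : ((parentTree o par m).deleteEdges {s(o i, o (par i))}).Walk x y)
      (a b : ℕ), a < m → b < m → x = o a → y = o b →
      (ParentDesc par m i a ↔ ParentDesc par m i b) := by
    intro x y p
    induction p with
    | nil => rintro a b ha hb rfl h; rw [ho.inj _ ha _ hb h]
    | @cons x z y hxz p ih =>
      rintro a b ha hb rfl rfl
      obtain ⟨c, hc, rfl⟩ := ho.surj z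
      rw [← ih c b hc hb rfl rfl]
      simp only [SimpleGraph.deleteEdges_adj, Set.mem_singleton_iff] at hxz
      rcases ((SimpleGraph.fromRel_adj _ _ _).1 hxz.1).2 with
        ⟨j, h1, h2, ha', hc'⟩ | ⟨j, h1, h2, hc', ha'⟩
      · obtain rfl := ho.inj _ ha _ h2 ha'
        have hlt := hpar a h1 h2
        obtain rfl := ho.inj _ hc _ (hlt.trans h2) hc'
        exact ParentDesc.iff_parent h1 h2 fun h => hxz.2 (by rw [h])
      · obtain rfl := ho.inj _ hc _ h2 hc'
        have hlt := hpar c h1 h2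
        obtain rfl := ho.inj _ ha _ (hlt.trans h2) ha'
        exact (ParentDesc.iff_parent h1 h2 fun h => hxz.2 (by rw [h, Sym2.eq_swap])).symm
  exact key _ _ p a b ha hb rfl rfl

/-- Every edge to a parent is a bridge, since descendants come later in the order. The hyperedges
containing v are connected because each of them except the earliest has v in its separator, hence in
its parent. -/
theorem isJoinTree_parentTree (ho : IsListing o m)
    (hpar : IsParentMap (fun i => H.edge (o i)) par m) : H.IsJoinTree (parentTree o par m) := by
  have hlt : ∀ i, 1 ≤ i → i < m → par i < i := fun i h1 h2 => (hpar i h1 h2).1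
  refine ⟨⟨?_, ?_⟩, fun v => ?_⟩
  · have key : ∀ i < m, (parentTree o par m).Reachable (o i) (o 0) := by
      intro i
      induction i using Nat.strong_induction_on with
      | _ i ih =>
        intro hi
        rcases Nat.eq_zero_or_pos i with rfl | h0
        · exact .rfl
        · exact (parentTree_adj ho hlt h0 hi).reachable.trans
            (ih _ (hlt i h0 hi) ((hlt i h0 hi).trans hi))
    have : Nonempty ι := ⟨o 0⟩
    refine ⟨fun x y => ?_⟩
    obtain ⟨i, hi, rfl⟩ := ho.surj x
    obtain ⟨j, hj, rfl⟩ := ho.surj y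
    exact (key i hi).trans (key j hj).symm
  · have hbr : ∀ i, 1 ≤ i → i < m →
        ¬ ((parentTree o par m).deleteEdges {s(o i, o (par i))}).Reachable (o i) (o (par i)) := by
      intro i h1 h2 hr
      have := (parentDesc_iff_of_reachable ho hlt h2 ((hlt i h1 h2).trans h2) hr).1 .refl
      have := this.le hpar
      have := hlt i h1 h2
      omega
    rw [SimpleGraph.isAcyclic_iff_forall_adj_isBridge]
    intro x y hxy
    rw [SimpleGraph.isBridge_iff]
    rcases ((SimpleGraph.fromRel_adj _ _ _).1 hxy).2 with
      ⟨j, h1, h2, rfl, rfl⟩ | ⟨j, h1, h2, rfl, rfl⟩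
    · exact hbr j h1 h2
    · rw [Sym2.eq_swap, SimpleGraph.reachable_comm]; exact hbr j h1 h2
  · by_cases hv : ∃ i, i < m ∧ v ∈ H.edge (o i)
    · classical
      let f := Nat.find hv
      have hf := Nat.find_spec hv
      have key : ∀ i < m, ∀ hi : v ∈ H.edge (o i),
          ((parentTree o par m).induce {e | v ∈ H.edge e}).Reachable ⟨o i, hi⟩ ⟨o f, hf.2⟩ := by
        intro i
        induction i using Nat.strong_induction_on with
        | _ i ih =>
          intro him hi
          rcases (Nat.find_min' hv ⟨him, hi⟩).eq_or_lt with h | h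
          · have : o i = o f := by rw [← h]
            simp only [this]; exact .rfl
          · have h1 : 1 ≤ i := by omega
            have hs : v ∈ sepSet (fun i => H.edge (o i)) i := mem_sepSet.2 ⟨hi, _, h, hf.2⟩
            have hp := (hpar i h1 him).2 hs
            have hadj : ((parentTree o par m).induce {e | v ∈ H.edge e}).Adj
              ⟨o i, hi⟩ ⟨o (par i), hp⟩ := parentTree_adj ho hlt h1 him
            exact hadj.reachable.trans (ih _ (hlt i h1 him) ((hlt i h1 him).trans him) hp)
      rintro ⟨x, hx⟩ ⟨y, hy⟩
      obtain ⟨i, hi, rfl⟩ := ho.surj x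
      obtain ⟨j, hj, rfl⟩ := ho.surj y
      exact (key i hi hx).trans (key j hj hy).symm
    · rintro ⟨x, hx⟩
      obtain ⟨i, hi, rfl⟩ := ho.surj x
      exact absurd ⟨i, hi, hx⟩ hv

theorem sepSet_eq_inter (hpar : IsParentMap (fun i => H.edge (o i)) par m) {i : ℕ} (h1 : 1 ≤ i)
    (h2 : i < m) : sepSet (fun i => H.edge (o i)) i = H.edge (o i) ∩ H.edge (o (par i)) := by
  refine Finset.Subset.antisymm (Finset.subset_inter (sepSet_subset i) (hpar i h1 h2).2) ?_
  intro v hv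
  obtain ⟨hv1, hv2⟩ := Finset.mem_inter.1 hv
  exact mem_sepSet.2 ⟨hv1, _, (hpar i h1 h2).1, hv2⟩

/-- S can be recovered from the pair. So different separators split different pairs, and no edge is
written twice. -/
theorem Splits.inter_subset (ho : IsListing o m)
    (hpar : IsParentMap (fun i => H.edge (o i)) par m) {S : Finset V} {a b : ℕ} (ha : a < m)
    (hb : b < m) (h : Splits (fun i => H.edge (o i)) par S a b) :
    H.edge (o a) ∩ H.edge (o b) = S := by
  refine Finset.Subset.antisymm (fun v hv => ?_) (Finset.subset_inter h.1 h.2.1)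
  obtain ⟨hva, hvb⟩ := Finset.mem_inter.1 hv
  obtain ⟨i, h1, h2, rfl, h4⟩ := h.exists_separator hpar ha hb
  have hnr := fun hr => h4 (parentDesc_iff_of_reachable ho (fun i h1 h2 => (hpar i h1 h2).1)
    ha hb hr)
  rw [sepSet_eq_inter hpar h1 h2]
  exact Finset.mem_inter.2 ((isJoinTree_parentTree ho hpar).mem_of_not_reachable hnr hva hvb)

/-- The edges of the union join graph, in terms of the order and the parents. -/
theorem unionJoinGraph_adj_iff_splits (ho : IsListing o m)
    (hpar : IsParentMap (fun i => H.edge (o i)) par m) {a b : ℕ} (ha : a < m) (hb : b < m) :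
    H.unionJoinGraph.Adj (o a) (o b) ↔ ∃ i, 1 ≤ i ∧ i < m ∧
      Splits (fun i => H.edge (o i)) par (sepSet (fun i => H.edge (o i)) i) a b := by
  have hT := isJoinTree_parentTree ho hpar
  have hlt : ∀ i, 1 ≤ i → i < m → par i < i := fun i h1 h2 => (hpar i h1 h2).1
  rw [hT.unionJoinGraph_adj_iff]
  constructor
  · rintro ⟨g, h, hgh, hnr, hsub⟩
    obtain ⟨i, h1, h2, hnr, hsub⟩ : ∃ i, 1 ≤ i ∧ i < m ∧
        ¬ ((parentTree o par m).deleteEdges {s(o i, o (par i))}).Reachable (o a) (o b) ∧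
        ∀ v, v ∈ H.edge (o i) → v ∈ H.edge (o (par i)) → v ∈ H.edge (o a) ∧ v ∈ H.edge (o b) := by
      rcases ((SimpleGraph.fromRel_adj _ _ _).1 hgh).2 with
        ⟨j, h1, h2, rfl, rfl⟩ | ⟨j, h1, h2, rfl, rfl⟩
      · exact ⟨j, h1, h2, hnr, hsub⟩
      · exact ⟨j, h1, h2, by rwa [Sym2.eq_swap], fun v h1 h2 => hsub v h2 h1⟩
    have hS := sepSet_eq_inter hpar h1 h2
    have hsub' : ∀ v ∈ sepSet (fun i => H.edge (o i)) i,
        v ∈ H.edge (o a) ∧ v ∈ H.edge (o b) := by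
      intro v hv
      rw [hS] at hv
      exact hsub v (Finset.mem_inter.1 hv).1 (Finset.mem_inter.1 hv).2
    refine ⟨i, h1, h2, fun v hv => (hsub' v hv).1, fun v hv => (hsub' v hv).2, fun heq => hnr ?_⟩
    -- The climb from x to its root crosses only separators strictly larger than S, hence never the
    -- edge above i.
    have key : ∀ x < m, ((parentTree o par m).deleteEdges {s(o i, o (par i))}).Reachable (o x)
        (o (sepRoot (fun i => H.edge (o i)) par (sepSet (fun i => H.edge (o i)) i) x)) := by
      intro x
      induction x using Nat.strong_induction_on with
      | _ x ih =>
        intro hx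
        by_cases hss : sepSet (fun i => H.edge (o i)) i ⊂ sepSet (fun i => H.edge (o i)) x
        · rw [sepRoot_of_ssubset hpar hx hss]
          have h1x := one_le_of_ssubset_sepSet hss
          have hxi : x ≠ i := by rintro rfl; exact hss.2 (Finset.Subset.refl _)
          have hpx := hlt x h1x hx
          refine SimpleGraph.Reachable.trans (SimpleGraph.Adj.reachable ?_) (ih _ hpx (hpx.trans hx))
          simp only [SimpleGraph.deleteEdges_adj, Set.mem_singleton_iff]
          refine ⟨parentTree_adj ho hlt h1x hx, fun h => ?_⟩
          have hpi := hlt i h1 h2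
          rcases Sym2.eq_iff.1 h with ⟨h, _⟩ | ⟨h, h'⟩
          · exact hxi (ho.inj _ hx _ h2 h)
          · have e1 := ho.inj _ hx _ (hpi.trans h2) h
            have e2 := ho.inj _ (hpx.trans hx) _ h2 h'
            omega
        · rw [sepRoot_of_not_ssubset hss]
    exact (key a ha).trans (heq ▸ (key b hb).symm)
  · rintro ⟨i, h1, h2, h⟩
    -- The separating edge may stand at a position j other than i; only the set S is the same.
    obtain ⟨j, h1, h2, hj, h4⟩ := h.exists_separator hpar ha hb
    refine ⟨o j, o (par j), parentTree_adj ho hlt h1 h2, fun hr =>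
      h4 (parentDesc_iff_of_reachable ho hlt ha hb hr), fun v hv1 hv2 => ?_⟩
    have hv : v ∈ sepSet (fun i => H.edge (o i)) i := by
      rw [← hj, sepSet_eq_inter hpar h1 h2]; exact Finset.mem_inter.2 ⟨hv1, hv2⟩
    exact ⟨h.1 hv, h.2.1 hv⟩

end FamHypergraph

/-! ### A structured language compiled to the machine, and its program logic. -/

namespace WordRAM

/-- Words are the numbers below `cap w`. -/
def cap (w : ℕ) : ℕ := 2 ^ w

theorem cap_pos (w : ℕ) : 0 < cap w := by simp [cap]

/-! ### Expressions and structured statements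

Registers from `64` on serve as temporaries for the evaluation of expressions. -/

/-- Expressions over registers, literals and array cells. -/
inductive Expr
  | lit (k : ℕ)
  | reg (r : ℕ)
  | op (o : ArithOp) (a b : Expr)
  | load (a : ℕ) (i : Expr)

instance : Add Expr := ⟨.op .add⟩
instance : Sub Expr := ⟨.op .sub⟩
instance : Mul Expr := ⟨.op .mul⟩
instance : Div Expr := ⟨.op .div⟩
instance : Mod Expr := ⟨.op .mod⟩

/-- Arithmetic without overflow. -/
def ArithOp.natEval : ArithOp → ℕ → ℕ → ℕ
  | .add, a, b => a + b
  | .sub, a, b => a - b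
  | .mul, a, b => a * b
  | .div, a, b => a / b
  | .mod, a, b => a % b

namespace Expr

def eval (σ : State) : Expr → ℕ
  | lit k => k
  | reg r => σ.reg r
  | op o a b => o.natEval (a.eval σ) (b.eval σ)
  | load a i => σ.arr a (i.eval σ)

/-- No temporaries are used, and nothing overflows when words are below `W`. -/
def Ok (W : ℕ) (σ : State) : Expr → Prop
  | lit k => k < W
  | reg r => r < 64
  | op o a b => a.Ok W σ ∧ b.Ok W σ ∧ o.natEval (a.eval σ) (b.eval σ) < W
  | load _ i => i.Ok W σ

def cost : Expr → ℕ
  | lit _ => 1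
  | reg _ => 1
  | op _ a b => a.cost + b.cost + 1
  | load _ i => i.cost + 1

/-- Evaluate an expression into the temporary `64 + d`. -/
def compile : Expr → ℕ → Prog
  | lit k, d => .const (64 + d) k
  | reg r, d => .move (64 + d) r
  | op o a b, d => .seq (a.compile d) (.seq (b.compile (d + 1))
      (.arith o (64 + d) (64 + d) (64 + (d + 1))))
  | load a i, d => .seq (i.compile d) (.load (64 + d) a (64 + d))

@[simp] theorem eval_lit (σ : State) (k : ℕ) : (lit k).eval σ = k := rfl
@[simp] theorem eval_reg (σ : State) (r : ℕ) : (reg r).eval σ = σ.reg r := rfl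
@[simp] theorem eval_load (σ : State) (a : ℕ) (i : Expr) :
    (load a i).eval σ = σ.arr a (i.eval σ) := rfl
@[simp] theorem eval_add (σ : State) (a b : Expr) : (a + b).eval σ = a.eval σ + b.eval σ := rfl
@[simp] theorem eval_sub (σ : State) (a b : Expr) : (a - b).eval σ = a.eval σ - b.eval σ := rfl
@[simp] theorem eval_mul (σ : State) (a b : Expr) : (a * b).eval σ = a.eval σ * b.eval σ := rfl
@[simp] theorem eval_div (σ : State) (a b : Expr) : (a / b).eval σ = a.eval σ / b.eval σ := rfl
@[simp] theorem eval_mod (σ : State) (a b : Expr) : (a % b).eval σ = a.eval σ % b.eval σ := rfl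

@[simp] theorem ok_lit (W : ℕ) (σ : State) (k : ℕ) : (lit k).Ok W σ ↔ k < W := .rfl
@[simp] theorem ok_reg (W : ℕ) (σ : State) (r : ℕ) : (reg r).Ok W σ ↔ r < 64 := .rfl
@[simp] theorem ok_load (W : ℕ) (σ : State) (a : ℕ) (i : Expr) :
    (load a i).Ok W σ ↔ i.Ok W σ := .rfl
@[simp] theorem ok_add (W : ℕ) (σ : State) (a b : Expr) :
    (a + b).Ok W σ ↔ a.Ok W σ ∧ b.Ok W σ ∧ a.eval σ + b.eval σ < W := .rfl
@[simp] theorem ok_sub (W : ℕ) (σ : State) (a b : Expr) :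
    (a - b).Ok W σ ↔ a.Ok W σ ∧ b.Ok W σ ∧ a.eval σ - b.eval σ < W := .rfl
@[simp] theorem ok_mul (W : ℕ) (σ : State) (a b : Expr) :
    (a * b).Ok W σ ↔ a.Ok W σ ∧ b.Ok W σ ∧ a.eval σ * b.eval σ < W := .rfl
@[simp] theorem ok_div (W : ℕ) (σ : State) (a b : Expr) :
    (a / b).Ok W σ ↔ a.Ok W σ ∧ b.Ok W σ ∧ a.eval σ / b.eval σ < W := .rfl
@[simp] theorem ok_mod (W : ℕ) (σ : State) (a b : Expr) :
    (a % b).Ok W σ ↔ a.Ok W σ ∧ b.Ok W σ ∧ a.eval σ % b.eval σ < W := .rfl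

@[simp] theorem cost_lit (k : ℕ) : (lit k).cost = 1 := rfl
@[simp] theorem cost_reg (r : ℕ) : (reg r).cost = 1 := rfl
@[simp] theorem cost_load (a : ℕ) (i : Expr) : (load a i).cost = i.cost + 1 := rfl
@[simp] theorem cost_add (a b : Expr) : (a + b).cost = a.cost + b.cost + 1 := rfl
@[simp] theorem cost_sub (a b : Expr) : (a - b).cost = a.cost + b.cost + 1 := rfl
@[simp] theorem cost_mul (a b : Expr) : (a * b).cost = a.cost + b.cost + 1 := rfl
@[simp] theorem cost_div (a b : Expr) : (a / b).cost = a.cost + b.cost + 1 := rfl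
@[simp] theorem cost_mod (a b : Expr) : (a % b).cost = a.cost + b.cost + 1 := rfl

end Expr

namespace State

@[simp] theorem reg_setReg (σ : State) (x v y : ℕ) :
    (σ.setReg x v).reg y = if y = x then v else σ.reg y := by
  simp [setReg, Function.update_apply]

@[simp] theorem arr_setReg (σ : State) (x v : ℕ) : (σ.setReg x v).arr = σ.arr := rfl

@[simp] theorem reg_setArr (σ : State) (a i v : ℕ) : (σ.setArr a i v).reg = σ.reg := rfl

@[simp] theorem arr_setArr (σ : State) (a i v b : ℕ) :
    (σ.setArr a i v).arr b = if b = a then Function.update (σ.arr a) i v else σ.arr b := by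
  simp [setArr, Function.update_apply]

/-- Equality up to the temporaries. -/
def Sim (s σ : State) : Prop := (∀ r < 64, s.reg r = σ.reg r) ∧ s.arr = σ.arr

theorem Sim.setTemp {s σ : State} (h : s.Sim σ) (d v : ℕ) : (s.setReg (64 + d) v).Sim σ := by
  refine ⟨fun r hr => ?_, h.2⟩
  rw [reg_setReg, if_neg (by omega), h.1 r hr]

theorem Sim.setReg {s σ : State} (h : s.Sim σ) (x v : ℕ) : (s.setReg x v).Sim (σ.setReg x v) :=
  ⟨fun r hr => by simp [h.1 r hr], h.2⟩

theorem Sim.setArr {s σ : State} (h : s.Sim σ) (a i v : ℕ) :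
    (s.setArr a i v).Sim (σ.setArr a i v) :=
  ⟨fun r hr => h.1 r hr, by funext b; simp [h.2]⟩

end State

theorem ArithOp.eval_eq {w : ℕ} {o : ArithOp} {a b : ℕ} (h : o.natEval a b < cap w) :
    o.eval w a b = o.natEval a b := by
  cases o <;> exact Nat.mod_eq_of_lt h

/-- The temporaries form a stack: evaluation at depth d preserves those below d, so the value of a
left operand survives the evaluation of the right one. -/
theorem Expr.exec_compile {w : ℕ} {σ : State} (e : Expr) (he : e.Ok (cap w) σ) :
    ∀ (d : ℕ) (s : State), s.Sim σ → ∃ s', Exec w (e.compile d) s e.cost s' ∧ s'.Sim σ ∧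
      s'.reg (64 + d) = e.eval σ ∧ ∀ d' < d, s'.reg (64 + d') = s.reg (64 + d') := by
  induction e with
  | lit k =>
    intro d s hs
    refine ⟨_, Exec.const s _ _, hs.setTemp _ _, ?_, fun d' hd' => ?_⟩
    · simpa using Nat.mod_eq_of_lt (show k < 2 ^ w from he)
    · rw [State.reg_setReg, if_neg (by omega)]
  | reg r =>
    intro d s hs
    refine ⟨_, Exec.move s _ _, hs.setTemp _ _, ?_, fun d' hd' => ?_⟩
    · simpa using hs.1 r he
    · rw [State.reg_setReg, if_neg (by omega)]
  | op o a b iha ihb =>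
    intro d s hs
    obtain ⟨ha, hb, hab⟩ := he
    obtain ⟨s₁, ex₁, hs₁, hv₁, hk₁⟩ := iha ha d s hs
    obtain ⟨s₂, ex₂, hs₂, hv₂, hk₂⟩ := ihb hb (d + 1) s₁ hs₁
    refine ⟨s₂.setReg (64 + d) (o.eval w (s₂.reg (64 + d)) (s₂.reg (64 + (d + 1)))), ?_,
      hs₂.setTemp d _, ?_, fun d' hd' => ?_⟩
    · have := Exec.seq ex₁ (Exec.seq ex₂ (Exec.arith s₂ o (64 + d) (64 + d) (64 + (d + 1))))
      rwa [← add_assoc] at this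
    · rw [State.reg_setReg, if_pos rfl, hv₂, hk₂ d (by omega), hv₁]
      exact ArithOp.eval_eq hab
    · rw [State.reg_setReg, if_neg (by omega), hk₂ d' (by omega), hk₁ d' hd']
  | load a i ih =>
    intro d s hs
    obtain ⟨s₁, ex₁, hs₁, hv₁, hk₁⟩ := ih he d s hs
    refine ⟨_, Exec.seq ex₁ (Exec.load s₁ _ _ _), hs₁.setTemp d _, ?_, fun d' hd' => ?_⟩
    · rw [State.reg_setReg, if_pos rfl, hv₁, hs₁.2]; rfl
    · rw [State.reg_setReg, if_neg (by omega), hk₁ d' hd']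

/-- Comparisons of expressions. -/
inductive Cond
  | lt (a b : Expr)
  | le (a b : Expr)
  | eq (a b : Expr)
  | ne (a b : Expr)

namespace Cond

def Holds (σ : State) : Cond → Prop
  | lt a b => a.eval σ < b.eval σ
  | le a b => a.eval σ ≤ b.eval σ
  | eq a b => a.eval σ = b.eval σ
  | ne a b => a.eval σ ≠ b.eval σ

def Ok (W : ℕ) (σ : State) : Cond → Prop
  | lt a b | le a b | eq a b | ne a b => a.Ok W σ ∧ b.Ok W σ

def cost : Cond → ℕ
  | lt a b | le a b | eq a b | ne a b => a.cost + b.cost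

def test : Cond → Test
  | lt _ _ => .lt 64 65
  | le _ _ => .le 64 65
  | eq _ _ => .eq 64 65
  | ne _ _ => .ne 64 65

/-- Evaluate both sides into temporaries. -/
def compile : Cond → Prog
  | lt a b | le a b | eq a b | ne a b => .seq (a.compile 0) (b.compile 1)

theorem exec_compile {w : ℕ} {σ s : State} (c : Cond) (hc : c.Ok (cap w) σ) (hs : s.Sim σ) :
    ∃ s', Exec w c.compile s c.cost s' ∧ s'.Sim σ ∧ (c.test.Holds s' ↔ c.Holds σ) := by
  have key : ∀ a b : Expr, a.Ok (cap w) σ → b.Ok (cap w) σ →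
      ∃ s', Exec w (.seq (a.compile 0) (b.compile 1)) s (a.cost + b.cost) s' ∧ s'.Sim σ ∧
        s'.reg 64 = a.eval σ ∧ s'.reg 65 = b.eval σ := by
    intro a b ha hb
    obtain ⟨s₁, ex₁, hs₁, hv₁, hk₁⟩ := a.exec_compile ha 0 s hs
    obtain ⟨s₂, ex₂, hs₂, hv₂, hk₂⟩ := b.exec_compile hb 1 s₁ hs₁
    exact ⟨s₂, ex₁.seq ex₂, hs₂, (hk₂ 0 (by omega)).trans hv₁, hv₂⟩
  cases c with
  | lt a b =>
    obtain ⟨s', h1, h2, h3, h4⟩ := key a b hc.1 hc.2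
    exact ⟨s', h1, h2, by simp [test, Test.Holds, Holds, h3, h4]⟩
  | le a b =>
    obtain ⟨s', h1, h2, h3, h4⟩ := key a b hc.1 hc.2
    exact ⟨s', h1, h2, by simp [test, Test.Holds, Holds, h3, h4]⟩
  | eq a b =>
    obtain ⟨s', h1, h2, h3, h4⟩ := key a b hc.1 hc.2
    exact ⟨s', h1, h2, by simp [test, Test.Holds, Holds, h3, h4]⟩
  | ne a b =>
    obtain ⟨s', h1, h2, h3, h4⟩ := key a b hc.1 hc.2
    exact ⟨s', h1, h2, by simp [test, Test.Holds, Holds, h3, h4]⟩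

@[simp] theorem holds_lt (σ : State) (a b : Expr) : (lt a b).Holds σ ↔ a.eval σ < b.eval σ := .rfl
@[simp] theorem holds_le (σ : State) (a b : Expr) : (le a b).Holds σ ↔ a.eval σ ≤ b.eval σ := .rfl
@[simp] theorem holds_eq (σ : State) (a b : Expr) : (eq a b).Holds σ ↔ a.eval σ = b.eval σ := .rfl
@[simp] theorem holds_ne (σ : State) (a b : Expr) : (ne a b).Holds σ ↔ a.eval σ ≠ b.eval σ := .rfl
@[simp] theorem ok_lt (W : ℕ) (σ : State) (a b : Expr) :
    (lt a b).Ok W σ ↔ a.Ok W σ ∧ b.Ok W σ := .rfl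
@[simp] theorem ok_le (W : ℕ) (σ : State) (a b : Expr) :
    (le a b).Ok W σ ↔ a.Ok W σ ∧ b.Ok W σ := .rfl
@[simp] theorem ok_eq (W : ℕ) (σ : State) (a b : Expr) :
    (eq a b).Ok W σ ↔ a.Ok W σ ∧ b.Ok W σ := .rfl
@[simp] theorem ok_ne (W : ℕ) (σ : State) (a b : Expr) :
    (ne a b).Ok W σ ↔ a.Ok W σ ∧ b.Ok W σ := .rfl
@[simp] theorem cost_lt (a b : Expr) : (lt a b).cost = a.cost + b.cost := rfl
@[simp] theorem cost_le (a b : Expr) : (le a b).cost = a.cost + b.cost := rfl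
@[simp] theorem cost_eq (a b : Expr) : (eq a b).cost = a.cost + b.cost := rfl
@[simp] theorem cost_ne (a b : Expr) : (ne a b).cost = a.cost + b.cost := rfl

end Cond

infixr:60 "⨾" => Prog.seq

/-- Assign an expression to a register. -/
def asg (x : ℕ) (e : Expr) : Prog := e.compile 0 ⨾ .move x 64

/-- Store an expression in an array cell. -/
def sto (a : ℕ) (i e : Expr) : Prog := i.compile 0 ⨾ e.compile 1 ⨾ .store a 64 65

/-- Conditional. -/
def cnd (c : Cond) (p q : Prog) : Prog := c.compile ⨾ .ite c.test p q

/-- While loop. -/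
def whl (c : Cond) (p : Prog) : Prog := c.compile ⨾ .loop c.test (p ⨾ c.compile)

/-- Counting loop: register `i` runs from `0` up to the content of register `bnd`. -/
def forr (i bnd : ℕ) (p : Prog) : Prog :=
  asg i (.lit 0) ⨾ whl (.lt (.reg i) (.reg bnd)) (p ⨾ asg i (.reg i + .lit 1))

/-! ### Frames -/

/-- The program text writes register `r`. -/
def Prog.writesReg (r : ℕ) : Prog → Bool
  | .skip => false
  | .const x _ => x == r
  | .move x _ => x == r
  | .arith _ x _ _ => x == r
  | .load x _ _ => x == r
  | .store _ _ _ => false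
  | .seq p q => p.writesReg r || q.writesReg r
  | .ite _ p q => p.writesReg r || q.writesReg r
  | .loop _ p => p.writesReg r

/-- The program text writes array `a`. -/
def Prog.writesArr (a : ℕ) : Prog → Bool
  | .skip => false
  | .const _ _ => false
  | .move _ _ => false
  | .arith _ _ _ _ => false
  | .load _ _ _ => false
  | .store b _ _ => b == a
  | .seq p q => p.writesArr a || q.writesArr a
  | .ite _ p q => p.writesArr a || q.writesArr a
  | .loop _ p => p.writesArr a

theorem Expr.writesReg_compile {r : ℕ} (hr : r < 64) (e : Expr) :
    ∀ d, (e.compile d).writesReg r = false := by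
  induction e with
  | lit | reg => intro d; simp only [compile, Prog.writesReg, beq_eq_false_iff_ne]; omega
  | op o a b iha ihb =>
    intro d
    simp only [compile, Prog.writesReg, iha, ihb, Bool.false_or, beq_eq_false_iff_ne]; omega
  | load a i ih =>
    intro d; simp only [compile, Prog.writesReg, ih, Bool.false_or, beq_eq_false_iff_ne]; omega

/-- What a program may change is read off its text. As `writesReg` computes, the frame conditions of
concrete programs close by `rfl`. -/
theorem Exec.reg_eq {w : ℕ} {p : Prog} {s s' : State} {t : ℕ} (h : Exec w p s t s') {r : ℕ}
    (hr : p.writesReg r = false) : s'.reg r = s.reg r := by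
  induction h with
  | skip => rfl
  | const | move | arith | load =>
    simp only [Prog.writesReg, beq_eq_false_iff_ne] at hr
    simp [Ne.symm hr]
  | store => rfl
  | seq _ _ ih₁ ih₂ =>
    simp only [Prog.writesReg, Bool.or_eq_false_iff] at hr
    rw [ih₂ hr.2, ih₁ hr.1]
  | iteTrue _ _ ih =>
    simp only [Prog.writesReg, Bool.or_eq_false_iff] at hr
    exact ih hr.1
  | iteFalse _ _ ih =>
    simp only [Prog.writesReg, Bool.or_eq_false_iff] at hr
    exact ih hr.2
  | loopTrue _ _ _ ih₁ ih₂ => rw [ih₂ hr, ih₁ hr]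
  | loopFalse => rfl

theorem Exec.arr_eq {w : ℕ} {p : Prog} {s s' : State} {t : ℕ} (h : Exec w p s t s') {a : ℕ}
    (ha : p.writesArr a = false) : s'.arr a = s.arr a := by
  induction h with
  | skip | const | move | arith | load => rfl
  | store =>
    simp only [Prog.writesArr, beq_eq_false_iff_ne] at ha
    simp [Ne.symm ha]
  | seq _ _ ih₁ ih₂ =>
    simp only [Prog.writesArr, Bool.or_eq_false_iff] at ha
    rw [ih₂ ha.2, ih₁ ha.1]
  | iteTrue _ _ ih =>
    simp only [Prog.writesArr, Bool.or_eq_false_iff] at ha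
    exact ih ha.1
  | iteFalse _ _ ih =>
    simp only [Prog.writesArr, Bool.or_eq_false_iff] at ha
    exact ih ha.2
  | loopTrue _ _ _ ih₁ ih₂ => rw [ih₂ ha, ih₁ ha]
  | loopFalse => rfl

/-- `σ'` differs from `σ` only where `p` writes. -/
structure Frame (p : Prog) (σ σ' : State) : Prop where
  reg : ∀ r < 64, p.writesReg r = false → σ'.reg r = σ.reg r
  arr : ∀ a, p.writesArr a = false → σ'.arr a = σ.arr a

theorem Frame.refl (p : Prog) (σ : State) : Frame p σ σ := ⟨fun _ _ _ => rfl, fun _ _ => rfl⟩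

theorem Frame.trans {p : Prog} {σ σ' σ'' : State} (h : Frame p σ σ') (h' : Frame p σ' σ'') :
    Frame p σ σ'' :=
  ⟨fun r hr hp => (h'.reg r hr hp).trans (h.reg r hr hp),
    fun a ha => (h'.arr a ha).trans (h.arr a ha)⟩

/-! ### Total correctness with running time -/

/-- Started in `σ`, program `p` halts in a state and after a time that satisfy `Q`. -/
def Tr (w : ℕ) (p : Prog) (σ : State) (Q : ℕ → State → Prop) : Prop :=
  ∀ s : State, s.Sim σ → ∃ t s' σ', Exec w p s t s' ∧ s'.Sim σ' ∧ Q t σ'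

namespace Tr

variable {w : ℕ} {p q : Prog} {σ : State} {Q Q' : ℕ → State → Prop}

theorem mono (h : Tr w p σ Q) (hQ : ∀ t s, Q t s → Q' t s) : Tr w p σ Q' := by
  intro s hs
  obtain ⟨t, s', σ', h1, h2, h3⟩ := h s hs
  exact ⟨t, s', σ', h1, h2, hQ _ _ h3⟩

theorem frame (h : Tr w p σ Q) (hQ : ∀ t s, Frame p σ s → Q t s → Q' t s) : Tr w p σ Q' := by
  intro s hs
  obtain ⟨t, s', σ', h1, h2, h3⟩ := h s hs
  refine ⟨t, s', σ', h1, h2, hQ _ _ ⟨fun r hr hp => ?_, fun a ha => ?_⟩ h3⟩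
  · rw [← h2.1 r hr, h1.reg_eq hp, hs.1 r hr]
  · rw [← h2.2, h1.arr_eq ha, hs.2]

theorem seq (h : Tr w p σ fun t₁ s₁ => Tr w q s₁ fun t₂ s₂ => Q (t₁ + t₂) s₂) :
    Tr w (p ⨾ q) σ Q := by
  intro s hs
  obtain ⟨t₁, s₁, σ₁, h1, h2, h3⟩ := h s hs
  obtain ⟨t₂, s₂, σ₂, h4, h5, h6⟩ := h3 s₁ h2
  exact ⟨_, s₂, σ₂, h1.seq h4, h5, h6⟩

/-- Sequential composition, with the frame of the first part. -/
theorem seq_frame {R : ℕ → State → Prop} (hp : Tr w p σ R)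
    (hq : ∀ t₁ s₁, Frame p σ s₁ → R t₁ s₁ → Tr w q s₁ fun t₂ s₂ => Q (t₁ + t₂) s₂) :
    Tr w (p ⨾ q) σ Q :=
  seq (hp.frame hq)

theorem skip (h : Q 1 σ) : Tr w .skip σ Q := fun s hs => ⟨1, s, σ, .skip s, hs, h⟩

theorem asg {x : ℕ} {e : Expr} (he : e.Ok (cap w) σ)
    (h : Q (e.cost + 1) (σ.setReg x (e.eval σ))) : Tr w (asg x e) σ Q := by
  intro s hs
  obtain ⟨s₁, h1, h2, h3, -⟩ := e.exec_compile he 0 s hs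
  refine ⟨_, _, _, h1.seq (.move s₁ x 64), ?_, h⟩
  rw [h3]; exact h2.setReg _ _

theorem sto {a : ℕ} {i e : Expr} (hi : i.Ok (cap w) σ) (he : e.Ok (cap w) σ)
    (h : Q (i.cost + e.cost + 1) (σ.setArr a (i.eval σ) (e.eval σ))) : Tr w (sto a i e) σ Q := by
  intro s hs
  obtain ⟨s₁, h1, h2, h3, -⟩ := i.exec_compile hi 0 s hs
  obtain ⟨s₂, h1', h2', h3', h4'⟩ := e.exec_compile he 1 s₁ h2
  refine ⟨_, _, _, h1.seq (h1'.seq (.store s₂ a 64 65)), ?_, add_assoc i.cost _ _ ▸ h⟩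
  rw [h3', (h4' 0 (by omega)).trans h3]; exact h2'.setArr _ _ _

theorem seq_asg {x : ℕ} {e : Expr} (he : e.Ok (cap w) σ)
    (h : Tr w q (σ.setReg x (e.eval σ)) fun t s => Q (e.cost + 1 + t) s) :
    Tr w (WordRAM.asg x e ⨾ q) σ Q :=
  seq (asg he h)

theorem seq_sto {a : ℕ} {i e : Expr} (hi : i.Ok (cap w) σ) (he : e.Ok (cap w) σ)
    (h : Tr w q (σ.setArr a (i.eval σ) (e.eval σ)) fun t s => Q (i.cost + e.cost + 1 + t) s) :
    Tr w (WordRAM.sto a i e ⨾ q) σ Q :=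
  seq (sto hi he h)

theorem cnd {c : Cond} (hc : c.Ok (cap w) σ)
    (hp : c.Holds σ → Tr w p σ fun t s => Q (c.cost + (t + 1)) s)
    (hq : ¬ c.Holds σ → Tr w q σ fun t s => Q (c.cost + (t + 1)) s) : Tr w (cnd c p q) σ Q := by
  intro s hs
  obtain ⟨s₁, h1, h2, h3⟩ := c.exec_compile hc hs
  by_cases h : c.Holds σ
  · obtain ⟨t, s', σ', h4, h5, h6⟩ := hp h s₁ h2
    exact ⟨_, s', σ', h1.seq (.iteTrue (h3.2 h) h4), h5, h6⟩
  · obtain ⟨t, s', σ', h4, h5, h6⟩ := hq h s₁ h2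
    exact ⟨_, s', σ', h1.seq (.iteFalse (fun h' => h (h3.1 h')) h4), h5, h6⟩

/-- While loops: `I b s` says that `b` further units of time suffice from `s`. -/
theorem whl {c : Cond} (I : ℕ → State → Prop) (b : ℕ) (h0 : I b σ)
    (hc : ∀ b s, Frame p σ s → I b s → c.Ok (cap w) s)
    (hbody : ∀ b s, Frame p σ s → I b s → c.Holds s →
      Tr w p s fun t s' => ∃ b', I b' s' ∧ b' + t + c.cost + 1 ≤ b)
    (hQ : ∀ b' s, Frame p σ s → I b' s → ¬ c.Holds s → ∀ t ≤ b + c.cost + 1, Q t s) :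
    Tr w (whl c p) σ Q := by
  -- Strong induction on the budget, which drops in every round because at least one unit is paid
  -- for the test.
  have key : ∀ b s σ', Frame p σ σ' → I b σ' → s.Sim σ' → (c.test.Holds s ↔ c.Holds σ') →
      ∃ t s' σ'' b'', Exec w (.loop c.test (p ⨾ c.compile)) s t s' ∧ s'.Sim σ'' ∧ t ≤ b + 1 ∧
        Frame p σ σ'' ∧ I b'' σ'' ∧ ¬ c.Holds σ'' := by
    intro b
    induction b using Nat.strong_induction_on with
    | _ b ih =>
      intro s σ' hF hI hs hiff
      by_cases h : c.Holds σ'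
      · obtain ⟨t₁, s₁, σ₁, h1, h2, hF₁, b', h3, h4⟩ :=
          (hbody b σ' hF hI h).frame (Q' := fun t s' => Frame p σ s' ∧
            ∃ b', I b' s' ∧ b' + t + c.cost + 1 ≤ b) (fun t s hF' h => ⟨hF.trans hF', h⟩) s hs
        obtain ⟨s₂, h5, h6, h7⟩ := c.exec_compile (hc b' σ₁ hF₁ h3) h2
        obtain ⟨t₃, s₃, σ₃, b₃, h8, h9, h10, h11⟩ := ih b' (by omega) s₂ σ₁ hF₁ h3 h6 h7
        exact ⟨_, s₃, σ₃, b₃, .loopTrue (hiff.2 h) (h1.seq h5) h8, h9, by omega, h11⟩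
      · exact ⟨1, s, σ', b, .loopFalse fun h' => h (hiff.1 h'), hs, by omega, hF, hI, h⟩
  intro s hs
  obtain ⟨s₁, h1, h2, h3⟩ := c.exec_compile (hc b σ (.refl _ _) h0) hs
  obtain ⟨t, s', σ'', b'', h4, h5, h6, h7, h8, h9⟩ := key b s₁ σ (.refl _ _) h0 h2 h3
  exact ⟨_, s', σ'', h1.seq h4, h5, hQ b'' σ'' h7 h8 h9 _ (by omega)⟩

/-- Counting loops, with the time `τ` spent so far. -/
theorem forr' {i bnd cnt : ℕ} (I : ℕ → ℕ → State → Prop)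
    (hi : i < 64) (hb : bnd < 64) (hib : bnd ≠ i) (hpi : p.writesReg i = false)
    (hpb : p.writesReg bnd = false) (hcnt : σ.reg bnd = cnt) (hw : cnt < cap w)
    (h0 : I 0 0 (σ.setReg i 0))
    (hstep : ∀ j τ s, j < cnt → Frame (WordRAM.forr i bnd p) σ s → s.reg i = j → I j τ s →
      Tr w p s fun t s' => I (j + 1) (τ + t + 7) (s'.setReg i (j + 1)))
    (hQ : ∀ τ s, Frame (WordRAM.forr i bnd p) σ s → s.reg i = cnt → I cnt τ s → Q (τ + 5) s) :
    Tr w (WordRAM.forr i bnd p) σ Q := by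
  have hfs : ∀ {σ₁ σ₂ : State}, Frame p σ₁ σ₂ → Frame (WordRAM.forr i bnd p) σ₁ σ₂ := by
    intro σ₁ σ₂ h
    refine ⟨fun r hr h' => h.reg r hr ?_, fun a h' => h.arr a ?_⟩
    · simp only [WordRAM.forr, WordRAM.whl, Prog.writesReg, Bool.or_eq_false_iff] at h'
      tauto
    · simp only [WordRAM.forr, WordRAM.whl, Prog.writesArr, Bool.or_eq_false_iff] at h'
      tauto
  have hfi : ∀ (σ₁ : State) (v : ℕ), Frame (WordRAM.forr i bnd p) σ₁ (σ₁.setReg i v) := by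
    intro σ₁ v
    refine ⟨fun r hr h' => ?_, fun a h' => rfl⟩
    simp only [WordRAM.forr, WordRAM.asg, Prog.writesReg, Bool.or_eq_false_iff,
      beq_eq_false_iff_ne] at h'
    rw [State.reg_setReg, if_neg (Ne.symm h'.1.2)]
  have hpow : 1 < cap w ∨ cnt = 0 := by
    rcases Nat.eq_zero_or_pos cnt with h | h
    exacts [Or.inr h, Or.inl (by omega)]
  have key : ∀ k j τ s σ', j + k = cnt → Frame (WordRAM.forr i bnd p) σ σ' → σ'.reg i = j →
      I j τ σ' → s.Sim σ' → (s.reg 64 < s.reg 65 ↔ j < cnt) →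
      ∃ t s' σ'' τ', Exec w (.loop (.lt 64 65) ((p ⨾ WordRAM.asg i (.reg i + .lit 1)) ⨾
        (Cond.lt (.reg i) (.reg bnd)).compile)) s t s' ∧ s'.Sim σ'' ∧ τ + t = τ' + 1 ∧
        Frame (WordRAM.forr i bnd p) σ σ'' ∧ σ''.reg i = cnt ∧ I cnt τ' σ'' := by
    intro k
    induction k with
    | zero =>
      intro j τ s σ' hj hF hij hI hs hiff
      obtain rfl : j = cnt := by omega
      exact ⟨1, s, σ', τ, .loopFalse fun h => absurd (hiff.1 h) (by omega), hs, rfl, hF, hij, hI⟩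
    | succ k ih =>
      intro j τ s σ' hj hF hij hI hs hiff
      obtain ⟨t₁, s₁, σ₁, h1, h2, hF₁, h3⟩ := (hstep j τ σ' (by omega) hF hij hI).frame
        (Q' := fun t s' => Frame p σ' s' ∧ I (j + 1) (τ + t + 7) (s'.setReg i (j + 1)))
        (fun t s hF' h => ⟨hF', h⟩) s hs
      have hσi : σ₁.reg i = j := by rw [hF₁.reg i hi hpi, hij]
      have hσb : σ₁.reg bnd = cnt := by
        have hbb : (WordRAM.forr i bnd p).writesReg bnd = false := by
          simp [WordRAM.forr, WordRAM.asg, WordRAM.whl, Prog.writesReg, Cond.compile, hpb,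
            Expr.writesReg_compile hb, Ne.symm hib]
        rw [hF₁.reg bnd hb hpb, hF.reg bnd hb hbb, hcnt]
      have hok : (Expr.reg i + Expr.lit 1).Ok (cap w) σ₁ := by
        simp only [Expr.ok_add, Expr.ok_reg, Expr.ok_lit, Expr.eval_reg, Expr.eval_lit, hσi]
        omega
      obtain ⟨s₂, h4, h5, h6, -⟩ := Expr.exec_compile _ hok 0 s₁ h2
      have h7 := h4.seq (.move s₂ i 64)
      rw [show s₂.reg 64 = j + 1 by simpa [hσi] using h6] at h7
      have h8 : (s₂.setReg i (j + 1)).Sim (σ₁.setReg i (j + 1)) := h5.setReg _ _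
      obtain ⟨s₃, h9, h10, h11⟩ := Cond.exec_compile (w := w) (.lt (.reg i) (.reg bnd))
        (by simp [hi, hb]) h8
      have h12 : s₃.reg 64 < s₃.reg 65 ↔ j + 1 < cnt := by
        refine h11.trans ?_
        simp [hib, hσb]
      obtain ⟨t₄, s₄, σ₄, τ₄, h13, h14, h15, h16⟩ := ih (j + 1) _ s₃ (σ₁.setReg i (j + 1))
        (by omega) ((hF.trans (hfs hF₁)).trans (hfi _ _)) (by simp) h3 h10 h12
      refine ⟨_, s₄, σ₄, τ₄, .loopTrue (hiff.2 (by omega)) ((h1.seq h7).seq h9) h13, h14, ?_, h16⟩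
      -- The 7 per round: 4 for the increment, 2 for evaluating the sides of the test, 1 for the
      -- loop itself.
      simp only [Expr.cost_add, Expr.cost_reg, Expr.cost_lit, Cond.cost_lt] at h15 ⊢
      omega
  intro s hs
  obtain ⟨s₁, h1, h2, h3, -⟩ := (Expr.lit 0).exec_compile (w := w) (σ := σ)
    (by simpa using cap_pos w) 0 s hs
  have h4 := h1.seq (.move s₁ i 64)
  rw [show s₁.reg 64 = 0 by simpa using h3] at h4
  have h5 : (s₁.setReg i 0).Sim (σ.setReg i 0) := h2.setReg _ _
  obtain ⟨s₂, h6, h7, h8⟩ := Cond.exec_compile (w := w) (.lt (.reg i) (.reg bnd))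
    (by simp [hi, hb]) h5
  have h9 : s₂.reg 64 < s₂.reg 65 ↔ 0 < cnt := by
    refine h8.trans ?_
    simp [hib, hcnt]
  obtain ⟨t, s', σ', τ', h10, h11, h12, h13, h14, h15⟩ := key cnt 0 0 s₂ (σ.setReg i 0)
    (by omega) (hfi _ _) (by simp) h0 h7 h9
  refine ⟨_, s', σ', h4.seq (h6.seq h10), h11, ?_⟩
  have := hQ τ' σ' h13 h14 h15
  simp only [Expr.cost_lit, Expr.cost_reg, Cond.cost_lt]
  -- The final 5: 2 for resetting the counter, 2 for evaluating the test at the start, 1 for the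
  -- failing test.
  rwa [show 1 + 1 + (1 + 1 + t) = τ' + 5 by omega]

/-- Counting loops whose body takes time at most `T`. -/
theorem forr {i bnd cnt : ℕ} (T : ℕ) (I : ℕ → State → Prop)
    (hi : i < 64) (hb : bnd < 64) (hib : bnd ≠ i) (hpi : p.writesReg i = false)
    (hpb : p.writesReg bnd = false) (hcnt : σ.reg bnd = cnt) (hw : cnt < cap w)
    (h0 : I 0 (σ.setReg i 0))
    (hstep : ∀ j s, j < cnt → Frame (WordRAM.forr i bnd p) σ s → s.reg i = j → I j s →
      Tr w p s fun t s' => t ≤ T ∧ I (j + 1) (s'.setReg i (j + 1)))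
    (hQ : ∀ s, Frame (WordRAM.forr i bnd p) σ s → s.reg i = cnt → I cnt s →
      ∀ t ≤ cnt * (T + 7) + 5, Q t s) :
    Tr w (WordRAM.forr i bnd p) σ Q := by
  refine forr' (fun j τ s => τ ≤ j * (T + 7) ∧ I j s) hi hb hib hpi hpb hcnt hw ⟨by simp, h0⟩ ?_ ?_
  · rintro j τ s hj hF hij ⟨hτ, hI⟩
    refine (hstep j s hj hF hij hI).mono fun t s' h => ⟨?_, h.2⟩
    have := h.1
    rw [Nat.succ_mul]; omega
  · rintro τ s hF hij ⟨hτ, hI⟩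
    exact hQ s hF hij hI _ (by omega)

end Tr

end WordRAM

namespace WordRAM

/-! ### Rows of a two-dimensional array -/

theorem row_index_inj {D r r' c c' : ℕ} (hc : c < D) (hc' : c' < D)
    (h : r * D + c = r' * D + c') : r = r' ∧ c = c' := by
  have hD : 0 < D := by omega
  have h1 : (r * D + c) / D = (r' * D + c') / D := by rw [h]
  have h2 : (r * D + c) % D = (r' * D + c') % D := by rw [h]
  rw [mul_comm r, mul_comm r', Nat.mul_add_div hD, Nat.mul_add_div hD, Nat.div_eq_of_lt hc,
    Nat.div_eq_of_lt hc'] at h1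
  rw [mul_comm r, mul_comm r', Nat.mul_add_mod, Nat.mul_add_mod, Nat.mod_eq_of_lt hc,
    Nat.mod_eq_of_lt hc'] at h2
  exact ⟨by simpa using h1, h2⟩

/-- Row `r` of `A`, of width `D`, starts with the list `l r`, whose length stands in `len r`. -/
structure Rows (D : ℕ) (A len : ℕ → ℕ) (l : ℕ → List ℕ) : Prop where
  len_eq : ∀ r, len r = (l r).length
  le : ∀ r, (l r).length ≤ D
  get : ∀ r j (h : j < (l r).length), A (r * D + j) = (l r)[j]

namespace Rows

variable {D : ℕ} {A len : ℕ → ℕ} {l : ℕ → List ℕ}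

theorem empty (D : ℕ) (A : ℕ → ℕ) : Rows D A (fun _ => 0) fun _ => [] :=
  ⟨fun _ => rfl, fun _ => Nat.zero_le _, fun _ _ h => absurd h (by simp)⟩

theorem push (h : Rows D A len l) {r x : ℕ} (hr : (l r).length < D) :
    Rows D (Function.update A (r * D + len r) x) (Function.update len r (len r + 1))
      (Function.update l r (l r ++ [x])) := by
  refine ⟨fun r' => ?_, fun r' => ?_, fun r' j hj => ?_⟩
  · by_cases hrr : r' = r
    · subst hrr; simp [h.len_eq]
    · simp [hrr, h.len_eq]
  · by_cases hrr : r' = r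
    · subst hrr; simpa using hr
    · simpa [hrr] using h.le r'
  · by_cases hrr : r' = r
    · subst hrr
      simp only [Function.update_self] at hj ⊢
      rw [h.len_eq]
      by_cases hjl : j = (l r').length
      · subst hjl; simp
      · have hj' : j < (l r').length := by simp at hj; omega
        rw [Function.update_of_ne (by omega), h.get r' j hj', List.getElem_append_left hj']
    · simp only [Function.update_of_ne hrr] at hj ⊢
      rw [Function.update_of_ne, h.get r' j hj]
      intro heq
      rw [h.len_eq] at heq
      exact hrr (row_index_inj (lt_of_lt_of_le hj (h.le r')) hr heq).1

theorem set_len (h : Rows D A len l) {r k : ℕ} (hk : k ≤ len r) :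
    Rows D A (Function.update len r k) (Function.update l r ((l r).take k)) := by
  rw [h.len_eq] at hk
  refine ⟨fun r' => ?_, fun r' => ?_, fun r' j hj => ?_⟩
  · by_cases hrr : r' = r
    · subst hrr; simp [hk]
    · simp [hrr, h.len_eq]
  · by_cases hrr : r' = r
    · subst hrr; have := h.le r'; simp; omega
    · simpa [hrr] using h.le r'
  · by_cases hrr : r' = r
    · subst hrr
      simp only [Function.update_self, List.getElem_take] at hj ⊢
      exact h.get r' j _
    · simp only [Function.update_of_ne hrr] at hj ⊢
      exact h.get r' j hj

end Rows

/-- `A` starts with the list `l`. -/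
def Starts (A : ℕ → ℕ) (l : List ℕ) : Prop := ∀ j (h : j < l.length), A j = l[j]

theorem Starts.nil (A : ℕ → ℕ) : Starts A [] := fun _ h => absurd h (by simp)

theorem Starts.push {A : ℕ → ℕ} {l : List ℕ} (h : Starts A l) (x : ℕ) :
    Starts (Function.update A l.length x) (l ++ [x]) := by
  intro j hj
  by_cases hjl : j = l.length
  · subst hjl; simp
  · have hj' : j < l.length := by simp at hj; omega
    rw [Function.update_of_ne hjl, h j hj', List.getElem_append_left hj']

/-- The one hypothesis `16 * (N + 3) ^ 2 < cap w` serves every overflow check: addresses in rows of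
width N + 1, all linear quantities (`linear_lt`), and output addresses up to about 2N². -/
theorem row_index_lt {w N r c : ℕ} (hW : 16 * (N + 3) ^ 2 < cap w) (hr : r ≤ N) (hc : c ≤ N) :
    r * (N + 1) + c < cap w := by
  have : r * (N + 1) ≤ N * (N + 1) := Nat.mul_le_mul_right _ hr
  nlinarith

theorem row_mul_lt {w N r : ℕ} (hW : 16 * (N + 3) ^ 2 < cap w) (hr : r ≤ N) :
    r * (N + 1) < cap w := row_index_lt (c := 0) hW hr (Nat.zero_le _)

theorem linear_lt {w N x : ℕ} (hW : 16 * (N + 3) ^ 2 < cap w) (hx : x ≤ 96 * N + 144) :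
    x < cap w := by nlinarith

/-! ### Reading the input, the block size -/

/-- Registers: `0` number of vertices, `1` number of hyperedges, `2` number of incidences,
`3` row width. -/
def readInput : Prog :=
  asg 0 (.load 0 (.lit 0)) ⨾ asg 1 (.load 0 (.lit 1)) ⨾ asg 2 (.load 0 (.lit 2)) ⨾
    asg 3 (.reg 2 + .lit 1)

theorem tr_readInput {w n m N : ℕ} {σ : State} (hW : 16 * (N + 3) ^ 2 < cap w)
    (h0 : σ.arr 0 0 = n) (h1 : σ.arr 0 1 = m) (h2 : σ.arr 0 2 = N) :
    Tr w readInput σ fun t s => t ≤ 13 ∧ s.reg 0 = n ∧ s.reg 1 = m ∧ s.reg 2 = N ∧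
      s.reg 3 = N + 1 := by
  have hl : ∀ x ≤ 96 * N + 144, x < cap w := fun x hx => linear_lt hW hx
  refine Tr.seq_asg (by simpa using hl 0 (by omega)) (Tr.seq_asg (by simpa using hl 1 (by omega))
    (Tr.seq_asg (by simpa using hl 2 (by omega)) (Tr.asg ?_ ?_)))
  · simpa [h2] using ⟨hl 1 (by omega), hl (N + 1) (by omega)⟩
  · simp [h0, h1, h2]

/-- Register `4` becomes about half the binary logarithm of the number of incidences, and
register `5` the corresponding power of two. -/
def blockSize : Prog :=
  asg 4 (.lit 1) ⨾ asg 5 (.lit 2) ⨾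
    whl (.le (.lit 4 * (.reg 5 * .reg 5)) (.reg 2)) (asg 5 (.reg 5 * .lit 2) ⨾
      asg 4 (.reg 4 + .lit 1))

/-- The upper bound keeps the conjunction table linear in N, with the summand 4 for k = 1 and small
N; the lower bound makes k proportional to log N. -/
theorem tr_blockSize {w N : ℕ} {σ : State} (hW : 16 * (N + 3) ^ 2 < cap w) (h2 : σ.reg 2 = N) :
    Tr w blockSize σ fun t s => t ≤ 20 * N + 120 ∧ ∃ k, 1 ≤ k ∧ s.reg 4 = k ∧ s.reg 5 = 2 ^ k ∧
      2 ^ k * 2 ^ k ≤ N + 4 ∧ N < 4 * (2 ^ k * 2 ^ k) := by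
  have hl : ∀ x ≤ 96 * N + 144, x < cap w := fun x hx => linear_lt hW hx
  refine Tr.seq_asg (by simpa using hl 1 (by omega)) (Tr.seq_asg (by simpa using hl 2 (by omega))
    ?_)
  refine Tr.whl (fun b s => ∃ k, 1 ≤ k ∧ s.reg 4 = k ∧ s.reg 5 = 2 ^ k ∧
      2 ^ k * 2 ^ k ≤ N + 4 ∧ 20 * (N + 5 - k) ≤ b) (20 * (N + 4)) ⟨1, ?_⟩ ?_ ?_ ?_
  · simp
  · rintro b s hF ⟨k, hk, h4, h5, hle, hb⟩
    have := hl (2 ^ k * 2 ^ k) (by omega)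
    have := hl (4 * (2 ^ k * 2 ^ k)) (by omega)
    have := hl 4 (by omega)
    simp_all
  · rintro b s hF ⟨k, hk, h4, h5, hle, hb⟩ hc
    have hr2 : s.reg 2 = N := by simpa [h2] using hF.reg 2 (by omega) rfl
    simp only [Cond.holds_le, Expr.eval_mul, Expr.eval_lit, Expr.eval_reg, h5, hr2] at hc
    have hk2 : k < 2 ^ k := Nat.lt_two_pow_self
    have hkk : 2 ^ k ≤ 2 ^ k * 2 ^ k := Nat.le_mul_of_pos_left _ (by positivity)
    have := hl 2 (by omega)
    have := hl 1 (by omega)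
    have := hl (2 ^ k * 2) (by omega)
    have := hl (k + 1) (by omega)
    refine Tr.seq_asg (by simp_all) (Tr.asg (by simp_all) ⟨20 * (N + 5 - (k + 1)),
      ⟨k + 1, by omega, by simp [h4], by simp [h5, pow_succ], ?_, le_rfl⟩, ?_⟩)
    · have : 2 ^ (k + 1) * 2 ^ (k + 1) = 4 * (2 ^ k * 2 ^ k) := by ring
      omega
    · simp; omega
  · rintro b s hF ⟨k, hk, h4, h5, hle, hb⟩ hc t ht
    have hr2 : s.reg 2 = N := by simpa [h2] using hF.reg 2 (by omega) rfl
    simp only [Cond.holds_le, Expr.eval_mul, Expr.eval_lit, Expr.eval_reg, h5, hr2] at hc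
    simp only [Cond.cost_le, Expr.cost_mul, Expr.cost_lit, Expr.cost_reg] at ht ⊢
    exact ⟨by omega, k, hk, h4, h5, hle, by omega⟩

/-! ### Lookup tables for words of one block -/

/-- The machine has no bitwise instruction. This recursion lets conjunctions be tabulated by
arithmetic alone. -/
theorem Nat.land_eq_two_mul (x y : ℕ) :
    x &&& y = 2 * ((x / 2) &&& (y / 2)) + (x % 2) * (y % 2) := by
  have h1 : (x &&& y) / 2 = (x / 2) &&& (y / 2) := Nat.and_div_two
  have h2 : (x &&& y) % 2 = (x % 2) * (y % 2) := by
    rcases Nat.mod_two_eq_zero_or_one x with hx | hx <;>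
      rcases Nat.mod_two_eq_zero_or_one y with hy | hy <;>
      simp [hx, hy, Nat.and_mod_two_pow (n := 1) |> fun h => by simpa using h]
  omega

/-- Array `6` becomes the table of bitwise conjunctions. -/
def andTable : Prog :=
  forr 6 5 (forr 7 5 (sto 6 (.reg 6 * .reg 5 + .reg 7)
    (.lit 2 * .load 6 ((.reg 6 / .lit 2) * .reg 5 + .reg 7 / .lit 2) +
      (.reg 6 % .lit 2) * (.reg 7 % .lit 2))))

theorem tr_andTable {w K : ℕ} {σ : State} (hW : 4 * (K * K) < cap w) (h5 : σ.reg 5 = K)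
    (hK : 1 ≤ K) (h6 : σ.arr 6 = fun _ => 0) :
    Tr w andTable σ fun t s => t ≤ 50 * (K * K) + 5 ∧
      ∀ x < K, ∀ y < K, s.arr 6 (x * K + y) = x &&& y := by
  have hKK : K ≤ K * K := Nat.le_mul_of_pos_left _ hK
  -- The disjunct `x = 0` records that row 0 of a fresh array is correct before it is written; it is
  -- needed because row 0 is computed from itself.
  refine Tr.forr (cnt := K) (K * 35 + 5)
    (fun j s => ∀ x < K, ∀ y < K, (x < j ∨ x = 0) → s.arr 6 (x * K + y) = x &&& y)
    (by omega) (by omega) (by omega) rfl rfl h5 (by omega) ?_ ?_ ?_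
  · intro x _ y _ hx
    obtain rfl : x = 0 := by omega
    simp [h6]
  · intro j s hj hF h6j hI
    have h5s : s.reg 5 = K := by rw [hF.reg 5 (by omega) rfl, h5]
    refine Tr.forr (cnt := K) 28
      (fun i s => ∀ x < K, ∀ y < K, (x < j ∨ x = 0 ∨ (x = j ∧ y < i)) →
        s.arr 6 (x * K + y) = x &&& y)
      (by omega) (by omega) (by omega) rfl rfl h5s (by omega) ?_ ?_ ?_
    · intro x hx y hy h
      exact hI x hx y hy (by omega)
    · intro i s' hi hF' h7 hI'
      have h5s' : s'.reg 5 = K := by rw [hF'.reg 5 (by omega) rfl, h5s]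
      have h6s' : s'.reg 6 = j := by rw [hF'.reg 6 (by omega) rfl, h6j]
      have hjK : j * K + K ≤ K * K := by
        have : (j + 1) * K ≤ K * K := Nat.mul_le_mul_right _ hj
        rw [Nat.succ_mul] at this; exact this
      have hj2 : j / 2 * K ≤ j * K := Nat.mul_le_mul_right _ (Nat.div_le_self _ _)
      have hval : s'.arr 6 (j / 2 * K + i / 2) = (j / 2) &&& (i / 2) :=
        hI' _ (by omega) _ (by omega) (by omega)
      have hle : (j / 2) &&& (i / 2) ≤ K := (Nat.and_le_left).trans (by omega)
      have hmm : j % 2 * (i % 2) ≤ 1 * 1 := Nat.mul_le_mul (by omega) (by omega)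
      refine Tr.sto ?_ ?_ ⟨by simp, ?_⟩
      · simp [h5s', h6s', h7]; omega
      · have hne : (2 : ℕ) < cap w := by omega
        simp only [Expr.ok_add, Expr.ok_mul, Expr.ok_div, Expr.ok_mod, Expr.ok_lit, Expr.ok_reg,
          Expr.ok_load, Expr.eval_mul, Expr.eval_add, Expr.eval_div, Expr.eval_mod, Expr.eval_lit,
          Expr.eval_reg, Expr.eval_load, h5s', h6s', h7, hval]
        omega
      · intro x hx y hy h
        simp only [State.arr_setReg, State.arr_setArr, if_true, Expr.eval_mul, Expr.eval_add,
          Expr.eval_div, Expr.eval_mod, Expr.eval_lit, Expr.eval_reg, Expr.eval_load, h5s', h6s',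
          h7, hval]
        by_cases hxy : x * K + y = j * K + i
        · obtain ⟨rfl, rfl⟩ := row_index_inj hy hi hxy
          rw [Function.update_self, ← Nat.land_eq_two_mul]
        · rw [Function.update_of_ne hxy]
          refine hI' x hx y hy ?_
          rcases h with h | h | ⟨rfl, h⟩
          · exact Or.inl h
          · exact Or.inr (Or.inl h)
          · have : y ≠ i := fun h' => hxy (by rw [h'])
            exact Or.inr (Or.inr ⟨rfl, by omega⟩)
    · intro s' hF' h7 hI' t ht
      refine ⟨by omega, fun x hx y hy h => ?_⟩
      simp only [State.arr_setReg]
      exact hI' x hx y hy (by omega)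
  · intro s hF h6s hI t ht
    refine ⟨?_, fun x hx y hy => hI x hx y hy (Or.inl hx)⟩
    nlinarith

/-- Arrays `7` and `8` become the tables of the lowest set bit, and of the rest without it. -/
def bitTable : Prog :=
  forr 6 5 (cnd (.eq (.reg 6 % .lit 2) (.lit 0))
    (sto 7 (.reg 6) (.load 7 (.reg 6 / .lit 2) + .lit 1) ⨾
      sto 8 (.reg 6) (.lit 2 * .load 8 (.reg 6 / .lit 2)))
    (sto 7 (.reg 6) (.lit 0) ⨾ sto 8 (.reg 6) (.reg 6 - .lit 1)))

theorem tr_bitTable {w K : ℕ} {σ : State} (hW : 4 * K < cap w) (h5 : σ.reg 5 = K) (hK : 1 ≤ K)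
    (h7 : σ.arr 7 = fun _ => 0) (h8 : σ.arr 8 = fun _ => 0) :
    Tr w bitTable σ fun t s => t ≤ 40 * K + 5 ∧
      ∀ x < K, x ≠ 0 → x.bitIndices = s.arr 7 x :: (s.arr 8 x).bitIndices ∧ s.arr 8 x < x := by
  -- The number 0 has no lowest bit, and its cell in array 7 receives the meaningless value 1. The
  -- first conjunct therefore bounds all cells, to rule out overflow; correctness is claimed for
  -- nonzero x only.
  refine Tr.forr (cnt := K) 30
    (fun j s => (∀ x, s.arr 7 x ≤ x + 1 ∧ (j ≤ x → s.arr 7 x = 0) ∧ s.arr 8 x ≤ x) ∧ ∀ x < K, x ≠ 0 → x < j →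
      x.bitIndices = s.arr 7 x :: (s.arr 8 x).bitIndices ∧ s.arr 8 x < x)
    (by omega) (by omega) (by omega) rfl rfl h5 (by omega) ?_ ?_ ?_
  · simp [h7, h8]
  · rintro j s hj hF h6 ⟨hle, hI⟩
    have h4 : (4 : ℕ) < cap w ∨ K < 2 := by omega
    refine Tr.cnd ?_ (fun hc => ?_) (fun hc => ?_)
    · simp only [Cond.ok_eq, Expr.ok_mod, Expr.ok_lit, Expr.ok_reg, Expr.eval_lit,
        Expr.eval_reg]
      omega
    · simp only [Cond.holds_eq, Expr.eval_mod, Expr.eval_lit, Expr.eval_reg, h6] at hc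
      have hl := hle (j / 2)
      refine Tr.seq_sto (by simp) ?_ (Tr.sto (by simp) ?_ ?_)
      · simp only [Expr.ok_add, Expr.ok_div, Expr.ok_lit, Expr.ok_reg, Expr.ok_load,
          Expr.eval_div, Expr.eval_lit, Expr.eval_reg, Expr.eval_load, h6]
        omega
      · simp [h6]
        omega
      · refine ⟨by simp, fun x => ?_, fun x hx hx0 hxj => ?_⟩
        · by_cases hxj : x = j
          · subst hxj; simp [h6]; omega
          · have := hle x; simp [h6, hxj]; omega
        · by_cases hxj' : x = j
          · subst hxj'
            have hx2 : x = 2 * (x / 2) := by omega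
            obtain ⟨h1, h2⟩ := hI (x / 2) (by omega) (by omega) (by omega)
            simp only [State.arr_setReg, State.arr_setArr, Expr.eval_reg, Expr.eval_add,
              Expr.eval_mul, Expr.eval_div, Expr.eval_load, Expr.eval_lit, State.reg_setArr, h6]
            simp only [show ¬ (7 = 8) by omega, show ¬ (8 = 7) by omega, if_true, if_false,
              Function.update_self]
            refine ⟨?_, by omega⟩
            conv_lhs => rw [hx2, Nat.bitIndices_two_mul, h1]
            simp
          · simpa [h6, hxj'] using hI x hx hx0 (by omega)
    · simp only [Cond.holds_eq, Expr.eval_mod, Expr.eval_lit, Expr.eval_reg, h6] at hc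
      refine Tr.seq_sto (by simp) (by simp [cap_pos]) (Tr.sto (by simp) ?_ ?_)
      · simp [h6]; omega
      · refine ⟨by simp, fun x => ?_, fun x hx hx0 hxj => ?_⟩
        · by_cases hxj : x = j
          · subst hxj; simp [h6]
          · have := hle x; simp [h6, hxj]; omega
        · by_cases hxj' : x = j
          · subst hxj'
            have hx2 : x = 2 * (x / 2) + 1 := by omega
            simp only [State.arr_setReg, State.arr_setArr, Expr.eval_reg, Expr.eval_sub,
              Expr.eval_lit, State.reg_setArr, h6]
            simp only [show ¬ (7 = 8) by omega, show ¬ (8 = 7) by omega, if_true, if_false,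
              Function.update_self]
            refine ⟨?_, by omega⟩
            conv_lhs => rw [hx2, Nat.bitIndices_two_mul_add_one]
            conv_rhs => rw [show x - 1 = 2 * (x / 2) by omega, Nat.bitIndices_two_mul]
          · simpa [h6, hxj'] using hI x hx hx0 (by omega)
  · rintro s hF h6 ⟨hle, hI⟩ t ht
    exact ⟨by omega, fun x hx hx0 => hI x hx hx0 hx⟩

end WordRAM

namespace WordRAM

/-! ### Adjacency lists -/

/-- The vertices of hyperedge `e`, in the order of the incidence list. -/
def edgeRow (L : List (ℕ × ℕ)) (e : ℕ) : List ℕ := (L.filter fun p => p.2 = e).map Prod.fst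

/-- The hyperedges at vertex `v`, in the order of the incidence list. -/
def vertRow (L : List (ℕ × ℕ)) (v : ℕ) : List ℕ := (L.filter fun p => p.1 = v).map Prod.snd

theorem mem_edgeRow {L : List (ℕ × ℕ)} {e v : ℕ} : v ∈ edgeRow L e ↔ (v, e) ∈ L := by
  simp [edgeRow]

theorem mem_vertRow {L : List (ℕ × ℕ)} {e v : ℕ} : e ∈ vertRow L v ↔ (v, e) ∈ L := by
  simp [vertRow]

theorem nodup_edgeRow {L : List (ℕ × ℕ)} (hL : L.Nodup) (e : ℕ) : (edgeRow L e).Nodup := by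
  refine (hL.filter _).map_on ?_
  rintro ⟨a, b⟩ h ⟨a', b'⟩ h' rfl
  simp only [List.mem_filter, decide_eq_true_eq] at h h'
  rw [h.2, h'.2]

theorem nodup_vertRow {L : List (ℕ × ℕ)} (hL : L.Nodup) (v : ℕ) : (vertRow L v).Nodup := by
  refine (hL.filter _).map_on ?_
  rintro ⟨a, b⟩ h ⟨a', b'⟩ h' rfl
  simp only [List.mem_filter, decide_eq_true_eq] at h h'
  rw [h.2, h'.2]

theorem length_edgeRow_le (L : List (ℕ × ℕ)) (e : ℕ) : (edgeRow L e).length ≤ L.length := by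
  simpa [edgeRow] using List.length_filter_le _ L

theorem length_vertRow_le (L : List (ℕ × ℕ)) (v : ℕ) : (vertRow L v).length ≤ L.length := by
  simpa [vertRow] using List.length_filter_le _ L

theorem edgeRow_append_singleton (L : List (ℕ × ℕ)) (p : ℕ × ℕ) :
    edgeRow (L ++ [p]) = Function.update (edgeRow L) p.2 (edgeRow L p.2 ++ [p.1]) := by
  funext e
  by_cases h : e = p.2
  · subst h; simp [edgeRow]
  · simp [edgeRow, h, Ne.symm h]

theorem vertRow_append_singleton (L : List (ℕ × ℕ)) (p : ℕ × ℕ) :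
    vertRow (L ++ [p]) = Function.update (vertRow L) p.1 (vertRow L p.1 ++ [p.2]) := by
  funext e
  by_cases h : e = p.1
  · subst h; simp [vertRow]
  · simp [vertRow, h, Ne.symm h]

/-- Arrays `2`, `3` become the rows of the hyperedges, arrays `4`, `5` those of the vertices. -/
def adjacency : Prog :=
  forr 8 2 (asg 9 (.load 0 (.lit 3 + .lit 2 * .reg 8)) ⨾
    asg 10 (.load 0 (.lit 4 + .lit 2 * .reg 8)) ⨾
    sto 2 (.reg 10 * .reg 3 + .load 3 (.reg 10)) (.reg 9) ⨾
    sto 3 (.reg 10) (.load 3 (.reg 10) + .lit 1) ⨾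
    sto 4 (.reg 9 * .reg 3 + .load 5 (.reg 9)) (.reg 10) ⨾
    sto 5 (.reg 9) (.load 5 (.reg 9) + .lit 1))

theorem tr_adjacency {w N : ℕ} {σ : State} {L : List (ℕ × ℕ)} (hW : 16 * (N + 3) ^ 2 < cap w)
    (hL : L.length = N) (h2 : σ.reg 2 = N) (h3 : σ.reg 3 = N + 1)
    (hv : ∀ p ∈ L, p.1 ≤ N ∧ p.2 ≤ N)
    (hin : ∀ j (h : j < L.length), σ.arr 0 (3 + 2 * j) = L[j].1 ∧ σ.arr 0 (4 + 2 * j) = L[j].2)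
    (ha3 : σ.arr 3 = fun _ => 0) (ha5 : σ.arr 5 = fun _ => 0) :
    Tr w adjacency σ fun t s => t ≤ 60 * N + 5 ∧
      Rows (N + 1) (s.arr 2) (s.arr 3) (edgeRow L) ∧
      Rows (N + 1) (s.arr 4) (s.arr 5) (vertRow L) := by
  have hl : ∀ x ≤ 96 * N + 144, x < cap w := fun x hx => linear_lt hW hx
  refine Tr.forr (cnt := N) 50
    (fun j s => Rows (N + 1) (s.arr 2) (s.arr 3) (edgeRow (L.take j)) ∧
      Rows (N + 1) (s.arr 4) (s.arr 5) (vertRow (L.take j)))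
    (by omega) (by omega) (by omega) rfl rfl h2 (hl _ (by omega)) ?_ ?_ ?_
  · simp only [List.take_zero, State.arr_setReg, ha3, ha5]
    exact ⟨Rows.empty _ _, Rows.empty _ _⟩
  · rintro j s hj hF h8 ⟨hE, hV⟩
    have hj' : j < L.length := by omega
    have h3s : s.reg 3 = N + 1 := by rw [hF.reg 3 (by omega) rfl, h3]
    have hins := hin j hj'
    rw [← hF.arr 0 rfl] at hins
    obtain ⟨⟨v, e⟩, hp⟩ : ∃ p, L[j] = p := ⟨_, rfl⟩
    have hve : v ≤ N ∧ e ≤ N := by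
      have := hv L[j] (List.getElem_mem hj'); rw [hp] at this; exact this
    rw [hp] at hins
    simp only at hins
    have hle : (edgeRow (L.take j) e).length ≤ j := (length_edgeRow_le _ _).trans (by simp)
    have hlv : (vertRow (L.take j) v).length ≤ j := (length_vertRow_le _ _).trans (by simp)
    have hE3 := hE.len_eq e
    have hV5 := hV.len_eq v
    have c1 := hl 1 (by omega)
    have c2 := hl 2 (by omega)
    have c3 := hl 3 (by omega)
    have c4 := hl 4 (by omega)
    have i3 := hl (3 + 2 * j) (by omega)
    have i4 := hl (4 + 2 * j) (by omega)
    have i2 := hl (2 * j) (by omega)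
    have e1 := row_mul_lt hW hve.1
    have e2 := row_mul_lt hW hve.2
    have e3 := row_index_lt (c := (edgeRow (L.take j) e).length) hW hve.2 (by omega)
    have e4 := row_index_lt (c := (vertRow (L.take j) v).length) hW hve.1 (by omega)
    have e5 := hl ((edgeRow (L.take j) e).length + 1) (by omega)
    have e6 := hl ((vertRow (L.take j) v).length + 1) (by omega)
    refine Tr.seq_asg (by simp [*]) (Tr.seq_asg (by simp [*]) (Tr.seq_sto (by simp [*])
      (by simp) (Tr.seq_sto (by simp) (by simp [*]) (Tr.seq_sto (by simp [*]) (by simp)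
      (Tr.sto (by simp) (by simp [*]) ⟨by simp, ?_⟩)))))
    rw [← List.take_concat_get' L j hj', hp, edgeRow_append_singleton, vertRow_append_singleton]
    have r1 := hE.push (r := e) (x := v) (by omega)
    have r2 := hV.push (r := v) (x := e) (by omega)
    simpa [h8, hins, h3s] using ⟨r1, r2⟩
  · rintro s hF h8 ⟨hE, hV⟩ t ht
    rw [List.take_of_length_le hL.le] at hE hV
    exact ⟨by omega, hE, hV⟩

end WordRAM

namespace WordRAM

/-! ### Maximum cardinality search -/

/-- A bucket queue: each hyperedge that is not done stands in the bucket of its count, stale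
entries stand below their counts, and all buckets from `top` on are empty. -/
def Buckets (N m : ℕ) (slot len cnt : ℕ → ℕ) (top : ℕ) (done : ℕ → Prop) : Prop :=
  ∃ bk : ℕ → List ℕ, Rows (N + 1) slot len bk ∧ (∀ c, (bk c).Nodup) ∧
    (∀ c, ∀ e ∈ bk c, e < m ∧ c ≤ cnt e) ∧ (∀ e < m, ¬ done e → e ∈ bk (cnt e)) ∧
    ∀ c, top ≤ c → bk c = []

theorem length_le_of_nodup_of_lt {l : List ℕ} {m : ℕ} (h : l.Nodup) (hm : ∀ e ∈ l, e < m) :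
    l.length ≤ m := by
  rw [← List.toFinset_card_of_nodup h]
  simpa using Finset.card_le_card (t := Finset.range m) fun e he => by
    simpa using hm e (by simpa using he)

theorem Buckets.lt_top {N m : ℕ} {slot len cnt : ℕ → ℕ} {top : ℕ} {done : ℕ → Prop}
    (h : Buckets N m slot len cnt top done) {e : ℕ} (he : e < m) (hd : ¬ done e) : cnt e < top := by
  obtain ⟨bk, h1, h2, h3, h4, h5⟩ := h
  by_contra hlt
  have := h4 e he hd
  rw [h5 _ (not_lt.1 hlt)] at this
  simp at this

/-- The old entry of e stays behind and becomes stale. Members of a bucket have at least its number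
as count, so e was not yet in the next bucket; hence buckets have no repetitions and at most m
entries. -/
theorem Buckets.bump {N m : ℕ} {slot len cnt : ℕ → ℕ} {top : ℕ} {done : ℕ → Prop} (hm : m ≤ N)
    (h : Buckets N m slot len cnt top done) {e : ℕ} (he : e < m) :
    Buckets N m (Function.update slot ((cnt e + 1) * (N + 1) + len (cnt e + 1)) e)
      (Function.update len (cnt e + 1) (len (cnt e + 1) + 1))
      (Function.update cnt e (cnt e + 1)) (max top (cnt e + 2)) done ∧ len (cnt e + 1) ≤ m := by
  obtain ⟨bk, h1, h2, h3, h4, h5⟩ := h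
  have hlen : (bk (cnt e + 1)).length ≤ m :=
    length_le_of_nodup_of_lt (h2 _) fun x hx => (h3 _ x hx).1
  refine ⟨⟨_, h1.push (r := cnt e + 1) (x := e) (by omega), fun c => ?_, fun c x hx => ?_,
    fun x hx hd => ?_, fun c hc => ?_⟩, ?_⟩
  · by_cases hc : c = cnt e + 1
    · subst hc
      rw [Function.update_self, List.nodup_append]
      refine ⟨h2 _, by simp, fun a ha b hb => ?_⟩
      rintro rfl
      rw [List.mem_singleton] at hb
      subst hb
      have := (h3 _ _ ha).2
      omega
    · rw [Function.update_of_ne hc]; exact h2 c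
  · by_cases hc : c = cnt e + 1
    · subst hc
      rw [Function.update_self, List.mem_append, List.mem_singleton] at hx
      rcases hx with hx | rfl
      · refine ⟨(h3 _ x hx).1, ?_⟩
        by_cases hxe : x = e
        · subst hxe; simp
        · rw [Function.update_of_ne hxe]; exact (h3 _ x hx).2
      · exact ⟨he, by simp⟩
    · rw [Function.update_of_ne hc] at hx
      refine ⟨(h3 _ x hx).1, ?_⟩
      have := (h3 _ x hx).2
      by_cases hxe : x = e
      · subst hxe; simp; omega
      · rwa [Function.update_of_ne hxe]
  · by_cases hxe : x = e
    · subst hxe; simp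
    · rw [Function.update_of_ne hxe]
      by_cases hc : cnt x = cnt e + 1
      · rw [hc, Function.update_self, ← hc]; exact List.mem_append_left _ (h4 x hx hd)
      · rw [Function.update_of_ne hc]; exact h4 x hx hd
  · rw [Function.update_of_ne (by omega)]
    exact h5 c (by omega)
  · rw [h1.len_eq]; exact hlen

/-- The amount of work left in a bucket queue. -/
def bucketWork (N : ℕ) (s : State) : ℕ := s.reg 12 + ∑ c ∈ Finset.range (N + 1), s.arr 10 c

theorem sum_update_of_le {N c x : ℕ} (hc : c ≤ N) (f : ℕ → ℕ) :
    ∑ i ∈ Finset.range (N + 1), Function.update f c x i + f c =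
      ∑ i ∈ Finset.range (N + 1), f i + x := by
  have hmem : c ∈ Finset.range (N + 1) := by simp; omega
  rw [Finset.sum_update_of_mem hmem, ← Finset.add_sum_erase _ f hmem,
    Finset.sdiff_singleton_eq_erase]
  omega

/-- Increment the count of a hyperedge. -/
def bump : Prog :=
  asg 21 (.load 4 (.reg 18 * .reg 3 + .reg 20)) ⨾ asg 22 (.load 11 (.reg 21) + .lit 1) ⨾
    sto 11 (.reg 21) (.reg 22) ⨾ sto 9 (.reg 22 * .reg 3 + .load 10 (.reg 22)) (.reg 21) ⨾
    sto 10 (.reg 22) (.load 10 (.reg 22) + .lit 1) ⨾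
    cnd (.le (.reg 12) (.reg 22)) (asg 12 (.reg 22 + .lit 1)) .skip

/-- The two new units of work are the new entry and a rise of the top, which is at most 1 because
the count of e was below the top. -/
theorem tr_bump {w N m v j e : ℕ} {σ : State} {done : ℕ → Prop} (hW : 16 * (N + 3) ^ 2 < cap w)
    (hm : m ≤ N) (h3 : σ.reg 3 = N + 1) (h18 : σ.reg 18 = v) (h20 : σ.reg 20 = j) (hv : v ≤ N)
    (hj : j ≤ N) (h4 : σ.arr 4 (v * (N + 1) + j) = e) (he : e < m)
    (hB : Buckets N m (σ.arr 9) (σ.arr 10) (σ.arr 11) (σ.reg 12) done)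
    (hc : σ.arr 11 e + 1 ≤ N) (htop : σ.arr 11 e < σ.reg 12) :
    Tr w bump σ fun t s => t ≤ 45 ∧
      Buckets N m (s.arr 9) (s.arr 10) (s.arr 11) (s.reg 12) done ∧
      s.arr 11 = Function.update (σ.arr 11) e (σ.arr 11 e + 1) ∧
      s.reg 12 = max (σ.reg 12) (σ.arr 11 e + 2) ∧ bucketWork N s ≤ bucketWork N σ + 2 := by
  have hl : ∀ x ≤ 96 * N + 144, x < cap w := fun x hx => linear_lt hW hx
  obtain ⟨hB', hlen⟩ := hB.bump hm he
  have c1 := hl 1 (by omega)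
  have e1 := row_mul_lt hW hv
  have e2 := row_index_lt hW hv hj
  have e3 := row_mul_lt hW hc
  have e4 := row_index_lt (c := σ.arr 10 (σ.arr 11 e + 1)) hW hc (by omega)
  have e5 := hl (σ.arr 11 e + 1) (by omega)
  have e6 := hl (σ.arr 11 e + 1 + 1) (by omega)
  have e7 := hl (σ.arr 10 (σ.arr 11 e + 1) + 1) (by omega)
  have hsum := sum_update_of_le (x := σ.arr 10 (σ.arr 11 e + 1) + 1) hc (σ.arr 10)
  refine Tr.seq_asg (by simp [*]) (Tr.seq_asg (by simp [*]) (Tr.seq_sto (by simp)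
    (by simp) (Tr.seq_sto (by simp [*]) (by simp) (Tr.seq_sto (by simp) (by simp [*])
    (Tr.cnd (by simp) (fun hle => Tr.asg (by simp [*]) ⟨by simp, ?_⟩)
      (fun hle => Tr.skip ⟨by simp, ?_⟩))))))
  · have hmax : max (σ.reg 12) (σ.arr 11 e + 2) = σ.arr 11 e + 1 + 1 := by
      simp [h3, h18, h20, h4] at hle; omega
    rw [hmax] at hB'
    refine ⟨by simpa [h3, h18, h20, h4] using hB', by simp [h3, h18, h20, h4],
      by simp [h3, h18, h20, h4, hmax], ?_⟩
    simp [bucketWork, h3, h18, h20, h4]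
    omega
  · have hmax : max (σ.reg 12) (σ.arr 11 e + 2) = σ.reg 12 := by
      simp [h3, h18, h20, h4] at hle; omega
    rw [hmax] at hB'
    refine ⟨by simpa [h3, h18, h20, h4] using hB', by simp [h3, h18, h20, h4],
      by simp [hmax], ?_⟩
    simp [bucketWork, h3, h18, h20, h4]
    omega

theorem mem_take_succ_iff {l : List ℕ} {j x : ℕ} (hj : j < l.length) :
    x ∈ l.take (j + 1) ↔ x ∈ l.take j ∨ x = l[j] := by
  rw [← List.take_concat_get' l j hj, List.mem_append, List.mem_singleton]

theorem getElem_notMem_take {l : List ℕ} (h : l.Nodup) {j : ℕ} (hj : j < l.length) :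
    l[j] ∉ l.take j := by
  intro hmem
  obtain ⟨i, hi, hij⟩ := List.mem_take_iff_getElem.1 hmem
  have := (h.getElem_inj_iff).1 hij
  omega

/-- Mark vertex `18` and increment the counts of its hyperedges. -/
def markVertex : Prog := sto 13 (.reg 18) (.lit 1) ⨾ asg 19 (.load 5 (.reg 18)) ⨾ forr 20 19 bump

/-- The predicate `live` differs from the negation of `done`: the hyperedge being selected has
already been popped, hence is done for the queue, yet its count is still raised and must stay below
the top. -/
theorem tr_markVertex {w N m v : ℕ} {σ : State} {done live : ℕ → Prop} {row : ℕ → List ℕ}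
    (hW : 16 * (N + 3) ^ 2 < cap w)
    (hm : m ≤ N) (h3 : σ.reg 3 = N + 1) (h18 : σ.reg 18 = v) (hv : v ≤ N)
    (hrow : Rows (N + 1) (σ.arr 4) (σ.arr 5) row) (hnd : (row v).Nodup) (hlen : (row v).length ≤ N)
    (hB : Buckets N m (σ.arr 9) (σ.arr 10) (σ.arr 11) (σ.reg 12) done)
    (he : ∀ e ∈ row v, e < m ∧ σ.arr 11 e + 1 ≤ N ∧ live e)
    (hlive : ∀ e < m, live e → σ.arr 11 e < σ.reg 12) :
    Tr w markVertex σ fun t s => t ≤ 52 * (row v).length + 15 ∧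
      Buckets N m (s.arr 9) (s.arr 10) (s.arr 11) (s.reg 12) done ∧
      s.arr 11 = (fun e => σ.arr 11 e + if e ∈ row v then 1 else 0) ∧
      s.arr 13 = Function.update (σ.arr 13) v 1 ∧
      (∀ e < m, live e → s.arr 11 e < s.reg 12) ∧
      bucketWork N s ≤ bucketWork N σ + 2 * (row v).length := by
  have hl : ∀ x ≤ 96 * N + 144, x < cap w := fun x hx => linear_lt hW hx
  have hrl := hrow.len_eq v
  refine Tr.seq_sto (by simp) (by simpa using hl 1 (by omega)) (Tr.seq_asg (by simp) ?_)
  refine Tr.forr (cnt := (row v).length) 45 (fun j s =>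
      Buckets N m (s.arr 9) (s.arr 10) (s.arr 11) (s.reg 12) done ∧
      s.arr 11 = (fun e => σ.arr 11 e + if e ∈ (row v).take j then 1 else 0) ∧
      (∀ e < m, live e → s.arr 11 e < s.reg 12) ∧
      bucketWork N s ≤ bucketWork N σ + 2 * j)
    (by omega) (by omega) (by omega) rfl rfl (by simpa [h18] using hrl) (hl _ (by omega)) ?_ ?_ ?_
  · simpa [bucketWork] using ⟨hB, hlive⟩
  · rintro j s hj hF h20 ⟨hB', h11, hlive', hwork⟩
    have h3s : s.reg 3 = N + 1 := by rw [hF.reg 3 (by omega) rfl]; simpa using h3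
    have h18s : s.reg 18 = v := by rw [hF.reg 18 (by omega) rfl]; simpa using h18
    have h4s : s.arr 4 (v * (N + 1) + j) = (row v)[j] := by
      rw [hF.arr 4 rfl]; simpa using hrow.get v j hj
    have hmem := he _ (List.getElem_mem hj)
    have hnot : (row v)[j] ∉ (row v).take j := getElem_notMem_take hnd hj
    have h11j : s.arr 11 (row v)[j] = σ.arr 11 (row v)[j] := by simp [h11, hnot]
    refine (tr_bump (e := (row v)[j]) hW hm h3s h18s h20 hv (by omega) h4s hmem.1 hB'
      (by rw [h11j]; exact hmem.2.1) (hlive' _ hmem.1 hmem.2.2)).mono ?_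
    rintro t s' ⟨ht, hB'', h11', h12', hwork'⟩
    refine ⟨ht, by simpa using hB'', ?_, fun e hem hle => ?_, ?_⟩
    · simp only [State.arr_setReg]
      rw [h11', h11]
      funext e
      by_cases hej : e = (row v)[j]
      · subst hej; simp [hnot, mem_take_succ_iff hj]
      · simp [hej, mem_take_succ_iff hj]
    · have := hlive' e hem hle
      simp only [State.arr_setReg, State.reg_setReg]
      rw [if_neg (by omega), h11', h12']
      by_cases hej : e = (row v)[j]
      · subst hej; simp
      · rw [Function.update_of_ne hej]; omega
    · have : bucketWork N (s'.setReg 20 (j + 1)) = bucketWork N s' := by simp [bucketWork]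
      rw [this]; omega
  · rintro s hF h20 ⟨hB', h11, hlive', hwork⟩ t ht
    refine ⟨by simp; omega, hB', by simpa using h11, ?_, hlive', hwork⟩
    rw [hF.arr 13 rfl]; simp [h18]

end WordRAM

/-! ### Selecting a hyperedge, with its cost charged to incidences. -/

namespace WordRAM

/-- The hyperedge `e` as a set. -/
def edgeSet (L : List (ℕ × ℕ)) (e : ℕ) : Finset ℕ := (edgeRow L e).toFinset

theorem mem_edgeSet {L : List (ℕ × ℕ)} {e v : ℕ} : v ∈ edgeSet L e ↔ (v, e) ∈ L := by
  rw [edgeSet, List.mem_toFinset, mem_edgeRow]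

theorem card_edgeSet_le (L : List (ℕ × ℕ)) (e : ℕ) : (edgeSet L e).card ≤ L.length :=
  (List.toFinset_card_le _).trans (length_edgeRow_le L e)

theorem sum_length_filter_le {α : Type*} (L : List α) (f : α → ℕ) (U : Finset ℕ) :
    ∑ v ∈ U, (L.filter fun p => f p = v).length ≤ L.length := by
  induction L with
  | nil => simp
  | cons a L ih =>
    have h : ∀ v, ((a :: L).filter fun p => f p = v).length =
        (if f a = v then 1 else 0) + (L.filter fun p => f p = v).length := by
      intro v
      by_cases hv : f a = v <;> simp [hv, add_comm]
    simp only [h, Finset.sum_add_distrib, Finset.sum_ite_eq, List.length_cons]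
    split_ifs <;> omega

/-- The number of incidences at the vertices in `U`. -/
def degSum (L : List (ℕ × ℕ)) (U : Finset ℕ) : ℕ := ∑ v ∈ U, (vertRow L v).length

theorem degSum_le (L : List (ℕ × ℕ)) (U : Finset ℕ) : degSum L U ≤ L.length := by
  simpa [degSum, vertRow] using sum_length_filter_le L Prod.fst U

/-- The number of incidences at the hyperedges in `U`. -/
def sizeSum (L : List (ℕ × ℕ)) (U : Finset ℕ) : ℕ := ∑ e ∈ U, (edgeRow L e).length

theorem sizeSum_le (L : List (ℕ × ℕ)) (U : Finset ℕ) : sizeSum L U ≤ L.length := by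
  simpa [sizeSum, edgeRow] using sum_length_filter_le L Prod.snd U

/-- Select hyperedge `15`. -/
def selectEdge : Prog :=
  sto 12 (.reg 15) (.lit 1) ⨾ sto 14 (.reg 13) (.reg 15) ⨾ asg 13 (.reg 13 + .lit 1) ⨾
    asg 16 (.load 3 (.reg 15)) ⨾
    forr 17 16 (asg 18 (.load 2 (.reg 15 * .reg 3 + .reg 17)) ⨾
      cnd (.eq (.load 13 (.reg 18)) (.lit 0)) markVertex .skip)

/-- Marks and counts agree with the set `U` of vertices. -/
structure Marked (L : List (ℕ × ℕ)) (m : ℕ) (U : Finset ℕ) (s : State) : Prop where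
  mark : s.arr 13 = fun v => if v ∈ U then 1 else 0
  cnt : ∀ e < m, s.arr 11 e = (edgeSet L e ∩ U).card

/-- A vertex is marked only once in the whole search. So the scan of its hyperedges is charged to
the growth of `degSum`, which never exceeds N; the rest of the cost is proportional to the size of
e. -/
theorem tr_selectEdge {w N m e : ℕ} {σ : State} {done live : ℕ → Prop} {L : List (ℕ × ℕ)}
    {U : Finset ℕ} (hW : 16 * (N + 3) ^ 2 < cap w) (hm : m ≤ N) (hL : L.length = N)
    (hnd : L.Nodup) (hv : ∀ p ∈ L, p.1 ≤ N ∧ p.2 < m)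
    (h3 : σ.reg 3 = N + 1) (h15 : σ.reg 15 = e) (he : e < m) (h13 : σ.reg 13 ≤ N)
    (hE : Rows (N + 1) (σ.arr 2) (σ.arr 3) (edgeRow L))
    (hV : Rows (N + 1) (σ.arr 4) (σ.arr 5) (vertRow L))
    (hB : Buckets N m (σ.arr 9) (σ.arr 10) (σ.arr 11) (σ.reg 12) done)
    (hM : Marked L m U σ) (hU : ∀ v e, (v, e) ∈ L → v ∉ U → live e)
    (hlive : ∀ e < m, live e → σ.arr 11 e < σ.reg 12) :
    Tr w selectEdge σ fun t s =>
      t + 60 * degSum L U ≤ 60 * degSum L (U ∪ edgeSet L e) + 60 * (edgeRow L e).length + 25 ∧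
      Buckets N m (s.arr 9) (s.arr 10) (s.arr 11) (s.reg 12) done ∧
      Marked L m (U ∪ edgeSet L e) s ∧
      s.arr 12 = Function.update (σ.arr 12) e 1 ∧
      s.arr 14 = Function.update (σ.arr 14) (σ.reg 13) e ∧ s.reg 13 = σ.reg 13 + 1 ∧
      bucketWork N s + 2 * degSum L U ≤ bucketWork N σ + 2 * degSum L (U ∪ edgeSet L e) := by
  have hl : ∀ x ≤ 96 * N + 144, x < cap w := fun x hx => linear_lt hW hx
  have hrl := hE.len_eq e
  have hlen : (edgeRow L e).length ≤ N := hL ▸ length_edgeRow_le L e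
  have c1 := hl 1 (by omega)
  have c2 := hl (σ.reg 13 + 1) (by omega)
  refine Tr.seq_sto (by simp) (by simpa using c1) (Tr.seq_sto (by simp) (by simp)
    (Tr.seq_asg (by simp [*]) (Tr.seq_asg (by simp) ?_)))
  refine Tr.forr' (cnt := (edgeRow L e).length) (fun j τ s =>
      τ + 60 * degSum L U ≤ 60 * degSum L (U ∪ ((edgeRow L e).take j).toFinset) + 60 * j ∧
      Buckets N m (s.arr 9) (s.arr 10) (s.arr 11) (s.reg 12) done ∧
      Marked L m (U ∪ ((edgeRow L e).take j).toFinset) s ∧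
      (∀ e < m, live e → s.arr 11 e < s.reg 12) ∧
      bucketWork N s + 2 * degSum L U ≤
        bucketWork N σ + 2 * degSum L (U ∪ ((edgeRow L e).take j).toFinset))
    (by omega) (by omega) (by omega) rfl rfl (by simpa [h15] using hrl) (hl _ (by omega)) ?_ ?_ ?_
  · refine ⟨by simp, by simpa using hB, ⟨by simpa using hM.mark, by simpa using hM.cnt⟩,
      by simpa using hlive, by simp [bucketWork]⟩
  · rintro j τ s hj hF h17 ⟨hτ, hB', hM', hlive', hwork⟩
    obtain ⟨v, hvj⟩ : ∃ v, (edgeRow L e)[j] = v := ⟨_, rfl⟩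
    have hvL : (v, e) ∈ L := mem_edgeRow.1 (hvj ▸ List.getElem_mem hj)
    have hvN := (hv _ hvL).1
    simp only at hvN
    have h3s : s.reg 3 = N + 1 := by rw [hF.reg 3 (by omega) rfl]; simpa using h3
    have h15s : s.reg 15 = e := by rw [hF.reg 15 (by omega) rfl]; simpa using h15
    have h2s : s.arr 2 (e * (N + 1) + j) = v := by
      rw [hF.arr 2 rfl, ← hvj]; simpa using hE.get e j hj
    have hVs : Rows (N + 1) (s.arr 4) (s.arr 5) (vertRow L) := by
      rw [hF.arr 4 rfl, hF.arr 5 rfl]; simpa using hV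
    set U' := U ∪ ((edgeRow L e).take j).toFinset with hU'
    have hins : U ∪ ((edgeRow L e).take (j + 1)).toFinset = insert v U' := by
      ext x
      simp only [hU', Finset.mem_union, List.mem_toFinset, mem_take_succ_iff hj, hvj,
        Finset.mem_insert]
      tauto
    rw [hins]
    have e1 := row_mul_lt hW (show e ≤ N by omega)
    have e2 := row_index_lt (c := j) hW (show e ≤ N by omega) (by omega)
    refine Tr.seq_asg (by simp [*]) ?_
    simp only [Expr.eval_load, Expr.eval_add, Expr.eval_mul, Expr.eval_reg, h15s, h3s, h17, h2s]
    refine Tr.cnd (by simp [cap_pos]) (fun hc => ?_) (fun hc => ?_)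
    · have hvU : v ∉ U' := by
        intro h; simp [hM'.mark, h] at hc
      have hvU0 : v ∉ U := fun h => hvU (Finset.mem_union_left _ h)
      have hstep : ∀ e' < m, (edgeSet L e' ∩ insert v U').card =
          (edgeSet L e' ∩ U').card + if e' ∈ vertRow L v then 1 else 0 := by
        intro e' _
        by_cases hve : e' ∈ vertRow L v
        · rw [if_pos hve, Finset.inter_insert_of_mem (mem_edgeSet.2 (mem_vertRow.1 hve)),
            Finset.card_insert_of_notMem fun h => hvU (Finset.mem_inter.1 h).2]
        · rw [if_neg hve, Finset.inter_insert_of_notMem fun h =>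
            hve (mem_vertRow.2 (mem_edgeSet.1 h)), add_zero]
      have hdeg : degSum L (insert v U') = (vertRow L v).length + degSum L U' :=
        Finset.sum_insert hvU
      refine (tr_markVertex (live := live) hW hm (by simpa using h3s) (by simp) hvN
        (by simpa using hVs) (nodup_vertRow hnd v) (hL ▸ length_vertRow_le L v) (by simpa using hB')
        ?_ (by simpa using hlive')).mono ?_
      · intro e' he'
        have hmem := mem_vertRow.1 he'
        have hem := (hv _ hmem).2
        refine ⟨hem, ?_, hU v e' hmem hvU0⟩
        have := hstep e' hem
        rw [if_pos he'] at this
        simp only [State.arr_setReg]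
        rw [hM'.cnt e' hem, ← this]
        exact (Finset.card_le_card Finset.inter_subset_left).trans (hL ▸ card_edgeSet_le L e')
      · rintro t s' ⟨ht, hB'', h11, h13', hlive'', hwork'⟩
        refine ⟨?_, by simpa using hB'', ⟨?_, fun e' he' => ?_⟩, by simpa using hlive'', ?_⟩
        · simp; omega
        · simp only [State.arr_setReg, h13', hM'.mark]
          funext x
          by_cases hx : x = v
          · subst hx; simp
          · simp [hx]
        · simp only [State.arr_setReg, h11]
          rw [hstep e' he', hM'.cnt e' he']
        · simp [bucketWork] at hwork' hwork ⊢
          omega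
    · have hvU : v ∈ U' := by
        by_contra h; simp [hM'.mark, h] at hc
      rw [Finset.insert_eq_self.2 hvU]
      refine Tr.skip ⟨?_, by simpa using hB', ⟨by simpa using hM'.mark, by simpa using hM'.cnt⟩,
        by simpa using hlive', by simpa [bucketWork] using hwork⟩
      simp; omega
  · rintro τ s hF h17 ⟨hτ, hB', hM', hlive', hwork⟩
    rw [List.take_length] at hτ hM' hwork
    refine ⟨?_, hB', hM', ?_, ?_, ?_, hwork⟩
    · change τ + 60 * degSum L U ≤ 60 * degSum L (U ∪ edgeSet L e) + _ at hτ
      simp; omega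
    · rw [hF.arr 12 rfl]; simp [h15]
    · rw [hF.arr 14 rfl]; simp [h15]
    · rw [hF.reg 13 (by omega) rfl]; simp

end WordRAM

/-! ### The search loop. -/

namespace WordRAM

theorem Buckets.mono {N m : ℕ} {slot len cnt : ℕ → ℕ} {top : ℕ} {done done' : ℕ → Prop}
    (h : Buckets N m slot len cnt top done) (hd : ∀ e, done e → done' e) :
    Buckets N m slot len cnt top done' := by
  obtain ⟨bk, h1, h2, h3, h4, h5⟩ := h
  exact ⟨bk, h1, h2, h3, fun e he hde => h4 e he fun h => hde (hd e h), h5⟩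

theorem Buckets.lower {N m : ℕ} {slot len cnt : ℕ → ℕ} {top : ℕ} {done : ℕ → Prop}
    (h : Buckets N m slot len cnt top done) (h0 : len (top - 1) = 0) :
    Buckets N m slot len cnt (top - 1) done := by
  obtain ⟨bk, h1, h2, h3, h4, h5⟩ := h
  refine ⟨bk, h1, h2, h3, h4, fun c hc => ?_⟩
  rcases eq_or_ne c (top - 1) with rfl | hne
  · rw [h1.len_eq] at h0; exact List.length_eq_zero_iff.1 h0
  · exact h5 c (by omega)

/-- Popping the last entry of the topmost bucket takes away only the entry of e there, so declaring
e done restores the invariant. -/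
theorem Buckets.pop {N m : ℕ} {slot len cnt : ℕ → ℕ} {top : ℕ} {done : ℕ → Prop} (hm : m ≤ N)
    (h : Buckets N m slot len cnt top done) (h0 : len (top - 1) ≠ 0) {e : ℕ}
    (he : slot ((top - 1) * (N + 1) + (len (top - 1) - 1)) = e) :
    e < m ∧ top - 1 ≤ cnt e ∧ len (top - 1) ≤ N ∧
      Buckets N m slot (Function.update len (top - 1) (len (top - 1) - 1)) cnt top
        fun x => done x ∨ x = e := by
  obtain ⟨bk, h1, h2, h3, h4, h5⟩ := h
  have hlen : (bk (top - 1)).length ≤ m :=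
    length_le_of_nodup_of_lt (h2 _) fun x hx => (h3 _ x hx).1
  have hl := h1.len_eq (top - 1)
  have hlt : len (top - 1) - 1 < (bk (top - 1)).length := by omega
  have hget := h1.get (top - 1) _ hlt
  rw [he] at hget
  have hmem := h3 (top - 1) e (hget ▸ List.getElem_mem hlt)
  refine ⟨hmem.1, hmem.2, by omega, _, h1.set_len (r := top - 1) (Nat.sub_le _ 1), fun c => ?_,
    fun c x hx => ?_, fun x hx hd => ?_, fun c hc => ?_⟩
  · by_cases hc : c = top - 1
    · subst hc; rw [Function.update_self]; exact (h2 _).sublist (List.take_sublist _ _)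
    · rw [Function.update_of_ne hc]; exact h2 c
  · by_cases hc : c = top - 1
    · subst hc; rw [Function.update_self] at hx; exact h3 _ x (List.mem_of_mem_take hx)
    · rw [Function.update_of_ne hc] at hx; exact h3 c x hx
  · have hx' := h4 x hx fun h => hd (Or.inl h)
    by_cases hc : cnt x = top - 1
    · rw [hc] at hx' ⊢
      rw [Function.update_self]
      have hfull : x ∈ (bk (top - 1)).take (len (top - 1) - 1 + 1) := by
        rwa [List.take_of_length_le (by omega)]
      rcases (mem_take_succ_iff hlt).1 hfull with h | h
      · exact h
      · exact absurd (Or.inr (h.trans hget.symm)) hd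
    · rw [Function.update_of_ne hc]; exact hx'
  · by_cases hc' : c = top - 1
    · subst hc'; rw [Function.update_self, h5 _ hc]; simp
    · rw [Function.update_of_ne hc']; exact h5 c hc

/-- All hyperedges enter bucket `0`. -/
def bucketInit : Prog :=
  forr 11 1 (sto 9 (.load 10 (.lit 0)) (.reg 11) ⨾
    sto 10 (.lit 0) (.load 10 (.lit 0) + .lit 1)) ⨾ asg 12 (.lit 1)

theorem tr_bucketInit {w N m : ℕ} {σ : State} (hW : 16 * (N + 3) ^ 2 < cap w) (hm : m ≤ N)
    (h1 : σ.reg 1 = m) (h10 : σ.arr 10 = fun _ => 0) (h11 : σ.arr 11 = fun _ => 0) :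
    Tr w bucketInit σ fun t s => t ≤ 20 * m + 7 ∧
      Buckets N m (s.arr 9) (s.arr 10) (s.arr 11) (s.reg 12) (fun _ => False) ∧
      bucketWork N s ≤ m + 1 := by
  have hl : ∀ x ≤ 96 * N + 144, x < cap w := fun x hx => linear_lt hW hx
  refine Tr.seq_frame (R := fun t s => t ≤ 20 * m + 5 ∧
    (Rows (N + 1) (s.arr 9) (s.arr 10) fun c => if c = 0 then List.range m else [])) ?_ ?_
  · refine Tr.forr (cnt := m) 13 (fun j s =>
      (Rows (N + 1) (s.arr 9) (s.arr 10) fun c => if c = 0 then List.range j else []))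
      (by omega) (by omega) (by omega) rfl rfl h1 (hl _ (by omega)) ?_ ?_ ?_
    · have := Rows.empty (N + 1) (σ.arr 9)
      simpa [h10] using this
    · intro j s hj hF h11j hI
      have hlen : s.arr 10 0 = j := by simpa using hI.len_eq 0
      have c0 := hl 0 (by omega)
      have c1 := hl 1 (by omega)
      have c2 := hl (j + 1) (by omega)
      refine Tr.seq_sto (by simp [*]) (by simp) (Tr.sto (by simp [*]) (by simp [*]) ⟨by simp, ?_⟩)
      have hp := hI.push (r := 0) (x := j) (by simp; omega)
      rw [show (Function.update (fun c => if c = 0 then List.range j else []) 0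
          ((if 0 = 0 then List.range j else []) ++ [j])) =
          fun c => if c = 0 then List.range (j + 1) else [] by
        funext c
        by_cases hc : c = 0
        · subst hc; simp [List.range_succ]
        · simp [hc]] at hp
      simpa [hlen, h11j] using hp
    · intro s hF h11s hI t ht
      exact ⟨by omega, hI⟩
  · rintro t s hF ⟨ht, hR⟩
    have h11s : s.arr 11 = fun _ => 0 := by rw [hF.arr 11 rfl, h11]
    refine Tr.asg (by simpa using hl 1 (by omega)) ⟨by simp; omega, ?_, ?_⟩
    · refine ⟨_, by simpa using hR, fun c => ?_, fun c e he => ?_, fun e he _ => ?_, fun c hc => ?_⟩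
      · by_cases hc : c = 0 <;> simp [hc, List.nodup_range]
      · by_cases hc : c = 0
        · subst hc; simpa using he
        · simp [hc] at he
      · simpa [h11s] using he
      · have : c ≠ 0 := by simp at hc; omega
        simp [this]
    · simp only [bucketWork, State.reg_setReg, State.arr_setReg, hR.len_eq, Expr.eval_lit, if_true]
      rw [Finset.sum_eq_single 0 (by intro c _ hc; simp [hc]) (by simp)]
      simp; omega

/-- One step of maximum cardinality search: inspect the topmost bucket. -/
def searchStep : Prog :=
  cnd (.eq (.load 10 (.reg 12 - .lit 1)) (.lit 0)) (asg 12 (.reg 12 - .lit 1))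
    (asg 14 (.load 10 (.reg 12 - .lit 1) - .lit 1) ⨾ sto 10 (.reg 12 - .lit 1) (.reg 14) ⨾
      asg 15 (.load 9 ((.reg 12 - .lit 1) * .reg 3 + .reg 14)) ⨾
      cnd (.eq (.load 12 (.reg 15)) (.lit 0)) selectEdge .skip)

/-- Maximum cardinality search; array `14` receives the order. -/
def search : Prog := bucketInit ⨾ whl (.ne (.reg 12) (.lit 0)) searchStep

/-- The vertices covered by a list of hyperedges. -/
def covered (L : List (ℕ × ℕ)) (ord : List ℕ) : Finset ℕ := ord.toFinset.biUnion (edgeSet L)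

theorem covered_append_singleton (L : List (ℕ × ℕ)) (ord : List ℕ) (e : ℕ) :
    covered L (ord ++ [e]) = covered L ord ∪ edgeSet L e := by
  ext v; simp only [covered, List.toFinset_append, Finset.mem_biUnion, Finset.mem_union,
    List.mem_toFinset, List.mem_singleton]
  constructor
  · rintro ⟨a, h | rfl, h'⟩
    exacts [Or.inl ⟨a, h, h'⟩, Or.inr h']
  · rintro (⟨a, h, h'⟩ | h)
    exacts [⟨a, Or.inl h, h'⟩, ⟨e, Or.inr rfl, h⟩]

/-- Each member of the list shares the most vertices with its predecessors. -/
def IsSearchOrder (L : List (ℕ × ℕ)) (m : ℕ) (ord : List ℕ) : Prop :=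
  ∀ i (h : i < ord.length), ∀ e < m, e ∉ ord.take i →
    (edgeSet L e ∩ covered L (ord.take i)).card ≤ (edgeSet L ord[i] ∩ covered L (ord.take i)).card

theorem IsSearchOrder.append {L : List (ℕ × ℕ)} {m : ℕ} {ord : List ℕ} (h : IsSearchOrder L m ord)
    {e : ℕ} (he : ∀ e' < m, e' ∉ ord →
      (edgeSet L e' ∩ covered L ord).card ≤ (edgeSet L e ∩ covered L ord).card) :
    IsSearchOrder L m (ord ++ [e]) := by
  intro i hi e' he' hni
  by_cases hil : i = ord.length
  · subst hil
    simp only [List.take_left, List.getElem_concat_length] at hni ⊢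
    exact he e' he' hni
  · have hi' : i < ord.length := by simp at hi; omega
    rw [List.take_append_of_le_length hi'.le] at hni ⊢
    rw [List.getElem_append_left hi']
    exact h i hi' e' he' hni

/-- The invariant of the search. -/
structure SearchInv (L : List (ℕ × ℕ)) (m N : ℕ) (ord : List ℕ) (s : State) : Prop where
  nodup : ord.Nodup
  lt : ∀ e ∈ ord, e < m
  order : IsSearchOrder L m ord
  buckets : Buckets N m (s.arr 9) (s.arr 10) (s.arr 11) (s.reg 12) (· ∈ ord)
  marked : Marked L m (covered L ord) s
  sel : s.arr 12 = fun e => if e ∈ ord then 1 else 0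
  starts : Starts (s.arr 14) ord
  length : s.reg 13 = ord.length

/-- Time that suffices to complete the search. -/
def searchBudget (L : List (ℕ × ℕ)) (N : ℕ) (ord : List ℕ) (s : State) : ℕ :=
  100 * bucketWork N s + 300 * (N - degSum L (covered L ord)) + 100 * (N - sizeSum L ord.toFinset)

/-- `searchBudget` is a potential. Each step removes an entry or lowers the top, which releases 100.
A newly marked vertex releases 300 per incidence, of which 60 pay for marking and 200 for the two
units of queue work created. Selecting e releases 100 per incidence of e. -/
theorem tr_searchStep {w N m : ℕ} {σ : State} {L : List (ℕ × ℕ)} {ord : List ℕ}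
    (hW : 16 * (N + 3) ^ 2 < cap w) (hm : m ≤ N) (hL : L.length = N)
    (hnd : L.Nodup) (hv : ∀ p ∈ L, p.1 ≤ N ∧ p.2 < m)
    (h3 : σ.reg 3 = N + 1) (hE : Rows (N + 1) (σ.arr 2) (σ.arr 3) (edgeRow L))
    (hV : Rows (N + 1) (σ.arr 4) (σ.arr 5) (vertRow L)) (hI : SearchInv L m N ord σ)
    (htop : σ.reg 12 ≤ 10 * N + 10) (h12 : σ.reg 12 ≠ 0) :
    Tr w searchStep σ fun t s => ∃ ord', SearchInv L m N ord' s ∧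
      searchBudget L N ord' s + t + 3 ≤ searchBudget L N ord σ := by
  have hl : ∀ x ≤ 96 * N + 144, x < cap w := fun x hx => linear_lt hW hx
  have c0 := hl 0 (by omega)
  have c1 := hl 1 (by omega)
  have c2 := hl (σ.reg 12 - 1) (by omega)
  refine Tr.cnd (by simp [*]) (fun hc => ?_) (fun hc => ?_)
  · have h0 : σ.arr 10 (σ.reg 12 - 1) = 0 := by simpa using hc
    refine Tr.asg (by simp [*]) ⟨ord, ⟨hI.nodup, hI.lt, hI.order, ?_, ⟨?_, ?_⟩, ?_, ?_, ?_⟩, ?_⟩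
    · simpa using hI.buckets.lower h0
    · simpa using hI.marked.mark
    · simpa using hI.marked.cnt
    · simpa using hI.sel
    · simpa using hI.starts
    · simpa using hI.length
    · simp [searchBudget, bucketWork]; omega
  · have h0 : σ.arr 10 (σ.reg 12 - 1) ≠ 0 := by simpa using hc
    obtain ⟨e, he⟩ : ∃ e, σ.arr 9 ((σ.reg 12 - 1) * (N + 1) +
      (σ.arr 10 (σ.reg 12 - 1) - 1)) = e := ⟨_, rfl⟩
    obtain ⟨hem, htope, hlenN, hB⟩ := hI.buckets.pop hm h0 he
    have hcard : σ.arr 11 e ≤ N := by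
      rw [hI.marked.cnt e hem]
      exact (Finset.card_le_card Finset.inter_subset_left).trans (hL ▸ card_edgeSet_le L e)
    have hr : σ.reg 12 - 1 ≤ N := htope.trans hcard
    have c3 := hl (σ.arr 10 (σ.reg 12 - 1) - 1) (by omega)
    have e1 := row_mul_lt hW hr
    have e2 := row_index_lt (c := σ.arr 10 (σ.reg 12 - 1) - 1) hW hr (by omega)
    have hsum := sum_update_of_le (x := σ.arr 10 (σ.reg 12 - 1) - 1) hr (σ.arr 10)
    refine Tr.seq_asg (by simp [*]) (Tr.seq_sto (by simp [*]) (by simp) (Tr.seq_asg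
      (by simp [*]) ?_))
    set τ := (State.setReg (State.setArr (State.setReg σ 14 _) 10 _ _) 15 _) with hτ
    have t15 : τ.reg 15 = e := by simp [hτ, h3, he]
    have t12 : τ.reg 12 = σ.reg 12 := by simp [hτ]
    have t13 : τ.reg 13 = σ.reg 13 := by simp [hτ]
    have t3 : τ.reg 3 = N + 1 := by simp [hτ, h3]
    have a10 : τ.arr 10 = Function.update (σ.arr 10) (σ.reg 12 - 1)
      (σ.arr 10 (σ.reg 12 - 1) - 1) := by simp [hτ]
    have aoth : ∀ a, a ≠ 10 → τ.arr a = σ.arr a := by intro a ha; simp [hτ, ha]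
    clear_value τ
    have hwork : bucketWork N τ + 1 ≤ bucketWork N σ := by
      simp only [bucketWork, t12, a10]; omega
    have hB' : Buckets N m (τ.arr 9) (τ.arr 10) (τ.arr 11) (τ.reg 12)
        (fun x => x ∈ ord ∨ x = e) := by
      rw [aoth 9 (by omega), aoth 11 (by omega), a10, t12]; exact hB
    have hM' : Marked L m (covered L ord) τ :=
      ⟨by rw [aoth 13 (by omega)]; exact hI.marked.mark,
        by rw [aoth 11 (by omega)]; exact hI.marked.cnt⟩
    have hsel : τ.arr 12 e = if e ∈ ord then 1 else 0 := by rw [aoth 12 (by omega), hI.sel]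
    have hordlen : ord.length ≤ m := length_le_of_nodup_of_lt hI.nodup hI.lt
    refine Tr.cnd (by simp [*]) (fun hc' => ?_) (fun hc' => ?_)
    · have heo : e ∉ ord := by
        intro h; simp [t15, hsel, h] at hc'
      refine (tr_selectEdge (live := (· ∉ ord)) hW hm hL hnd hv t3 t15 hem
        (by rw [t13, hI.length]; omega) (by rwa [aoth 2 (by omega), aoth 3 (by omega)])
        (by rwa [aoth 4 (by omega), aoth 5 (by omega)]) hB' hM' ?_ ?_).mono ?_
      · intro v e' hve hvc he'
        exact hvc (Finset.mem_biUnion.2 ⟨e', by simpa using he', mem_edgeSet.2 hve⟩)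
      · intro e' he' hne
        rw [aoth 11 (by omega), t12]
        exact hI.buckets.lt_top he' hne
      · rintro t s ⟨ht, hBs, hMs, h12s, h14s, h13s, hws⟩
        rw [← covered_append_singleton] at ht hMs hws
        refine ⟨ord ++ [e], ⟨?_, ?_, ?_, ?_, hMs, ?_, ?_, ?_⟩, ?_⟩
        · rw [List.nodup_append]
          refine ⟨hI.nodup, by simp, fun a ha b hb => ?_⟩
          rintro rfl
          exact heo (by simpa [List.mem_singleton.1 hb] using ha)
        · intro x hx
          rcases List.mem_append.1 hx with hx | hx
          · exact hI.lt x hx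
          · rw [List.mem_singleton.1 hx]; exact hem
        -- The entry comes from bucket `top - 1`, so the count of e is at least that, whereas every
        -- unselected count is below the top. In particular, the entry of an unselected e is not
        -- stale.
        · refine hI.order.append fun e' he' hne => ?_
          rw [← hI.marked.cnt e' he', ← hI.marked.cnt e hem]
          have := hI.buckets.lt_top he' hne
          omega
        · exact hBs.mono fun x hx => by simpa using hx
        · rw [h12s, aoth 12 (by omega), hI.sel]
          funext x
          by_cases hx : x = e
          · subst hx; simp
          · simp [hx]
        · rw [h14s, aoth 14 (by omega), t13, hI.length]
          exact hI.starts.push e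
        · rw [h13s, t13, hI.length]; simp
        · have hsz : sizeSum L (ord ++ [e]).toFinset =
              (edgeRow L e).length + sizeSum L ord.toFinset := by
            rw [List.toFinset_append, Finset.union_comm]
            simp only [List.toFinset_cons, List.toFinset_nil, insert_empty_eq,
              Finset.singleton_union]
            exact Finset.sum_insert (by simpa using heo)
          have h1 := degSum_le L (covered L (ord ++ [e]))
          have h2 := sizeSum_le L (ord ++ [e]).toFinset
          have h4 : degSum L (covered L ord) ≤ degSum L (covered L (ord ++ [e])) := by
            rw [covered_append_singleton]
            exact Finset.sum_le_sum_of_subset Finset.subset_union_left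
          rw [hL] at h1 h2
          simp only [searchBudget, hsz] at h2 ⊢
          simp
          omega
    · have heo : e ∈ ord := by
        by_contra h; simp [t15, hsel, h] at hc'
      refine Tr.skip ⟨ord, ⟨hI.nodup, hI.lt, hI.order, ?_, hM', ?_, ?_, ?_⟩, ?_⟩
      · refine hB'.mono fun x hx => ?_
        rcases hx with hx | rfl
        exacts [hx, heo]
      · rw [aoth 12 (by omega), hI.sel]
      · rw [aoth 14 (by omega)]; exact hI.starts
      · rw [t13, hI.length]
      · simp [searchBudget]; omega

theorem tr_search {w N m : ℕ} {σ : State} {L : List (ℕ × ℕ)}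
    (hW : 16 * (N + 3) ^ 2 < cap w) (hm : m ≤ N) (hL : L.length = N)
    (hnd : L.Nodup) (hv : ∀ p ∈ L, p.1 ≤ N ∧ p.2 < m) (h1 : σ.reg 1 = m)
    (h3 : σ.reg 3 = N + 1) (hE : Rows (N + 1) (σ.arr 2) (σ.arr 3) (edgeRow L))
    (hV : Rows (N + 1) (σ.arr 4) (σ.arr 5) (vertRow L)) (h13 : σ.reg 13 = 0)
    (ha10 : σ.arr 10 = fun _ => 0) (ha11 : σ.arr 11 = fun _ => 0)
    (ha12 : σ.arr 12 = fun _ => 0) (ha13 : σ.arr 13 = fun _ => 0) :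
    Tr w search σ fun t s => t ≤ 600 * N + 200 ∧ ∃ ord : List ℕ, ord.Nodup ∧
      (∀ e, e ∈ ord ↔ e < m) ∧ IsSearchOrder L m ord ∧ Starts (s.arr 14) ord := by
  have hl : ∀ x ≤ 96 * N + 144, x < cap w := fun x hx => linear_lt hW hx
  refine Tr.seq_frame (tr_bucketInit hW hm h1 ha10 ha11) ?_
  rintro t₁ s₁ hF₁ ⟨ht₁, hB₁, hw₁⟩
  refine Tr.whl (fun b s => b ≤ 500 * N + 100 ∧ ∃ ord, SearchInv L m N ord s ∧
    searchBudget L N ord s ≤ b) (500 * N + 100) ⟨le_rfl, [], ⟨by simp, by simp, ?_, ?_, ⟨?_, ?_⟩,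
    ?_, Starts.nil _, ?_⟩, ?_⟩ ?_ ?_ ?_
  · intro i hi; simp at hi
  · exact hB₁.mono fun _ h => h.elim
  · rw [hF₁.arr 13 rfl, ha13]; simp [covered]
  · intro e he; rw [hF₁.arr 11 rfl, ha11]; simp [covered]
  · rw [hF₁.arr 12 rfl, ha12]; simp
  · rw [hF₁.reg 13 (by omega) rfl, h13]; simp
  · simp [searchBudget, covered, degSum, sizeSum]; omega
  · intro b s _ _
    simpa using hl 0 (by omega)
  · rintro b s hF ⟨hb, ord, hI, hbud⟩ hc
    -- The time budget also bounds the top of the queue, as needed for the word size.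
    have htop : s.reg 12 ≤ 10 * N + 10 := by
      simp only [searchBudget, bucketWork] at hbud; omega
    refine (tr_searchStep hW hm hL hnd hv ?_ ?_ ?_ hI htop (by simpa using hc)).mono ?_
    · rw [hF.reg 3 (by omega) rfl, hF₁.reg 3 (by omega) rfl, h3]
    · rw [hF.arr 2 rfl, hF.arr 3 rfl, hF₁.arr 2 rfl, hF₁.arr 3 rfl]; exact hE
    · rw [hF.arr 4 rfl, hF.arr 5 rfl, hF₁.arr 4 rfl, hF₁.arr 5 rfl]; exact hV
    · rintro t s' ⟨ord', hI', hbud'⟩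
      exact ⟨_, ⟨by omega, ord', hI', le_rfl⟩, by simp; omega⟩
  · rintro b s hF ⟨hb, ord, hI, hbud⟩ hc t ht
    have h12 : s.reg 12 = 0 := by simpa using hc
    refine ⟨by simp at ht; omega, ord, hI.nodup, fun e => ⟨hI.lt e, fun he => ?_⟩, hI.order,
      hI.starts⟩
    by_contra hne
    have := hI.buckets.lt_top he hne
    omega

end WordRAM

namespace WordRAM

/-! ### Separators and parents -/

/-- The hyperedge at position `i` of the order. -/
def posSet (L : List (ℕ × ℕ)) (ord : List ℕ) (i : ℕ) : Finset ℕ := edgeSet L (ord.getD i 0)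

/-- `p` is the first moment at which `S` is covered. -/
def CoverTime (P : ℕ → Finset ℕ) (S : Finset ℕ) (p : ℕ) : Prop :=
  S ⊆ prefixUnion P p ∧ (p = 0 ∨ ∃ v ∈ S, v ∉ prefixUnion P (p - 1))

theorem prefixUnion_mono {P : ℕ → Finset ℕ} {i j : ℕ} (h : i ≤ j) :
    prefixUnion P i ⊆ prefixUnion P j := fun v hv => by
  obtain ⟨a, ha, hva⟩ := mem_prefixUnion.1 hv
  exact mem_prefixUnion.2 ⟨a, by omega, hva⟩

/-- The cover times of the separators give the parents. -/
theorem isParentMap_of_coverTime {P : ℕ → Finset ℕ} {m : ℕ} {p : ℕ → ℕ}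
    (hrip : ∀ i, 1 ≤ i → i < m → ∃ j < i, sepSet P i ⊆ P j)
    (hp : ∀ i < m, CoverTime P (sepSet P i) (p i)) : IsParentMap P (fun i => p i - 1) m := by
  intro i h1 him
  obtain ⟨hsub, hor⟩ := hp i him
  rcases hor with h0 | ⟨v, hv, hvp⟩
  -- For an empty separator, truncated subtraction makes position 0 the parent, which precedes i
  -- since 1 ≤ i.
  · have hemp : sepSet P i = ∅ := by
      rw [h0] at hsub
      simpa [prefixUnion] using hsub
    rw [hemp]
    exact ⟨by simp only [h0]; omega, by simp⟩
  · classical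
    have hex : ∃ j, j < i ∧ sepSet P i ⊆ P j := hrip i h1 him
    obtain ⟨hji, hjS⟩ := Nat.find_spec hex
    set j := Nat.find hex
    -- Here j is the least position whose set includes the separator. Had the separator been covered
    -- before j, it would lie in the separator at j and hence in a still earlier set. So it becomes
    -- covered exactly when j is added, at time j + 1.
    have hj : ¬ sepSet P i ⊆ prefixUnion P j := by
      intro h
      have hj1 : 1 ≤ j := by
        by_contra h0
        obtain h0 : j = 0 := by omega
        rw [h0] at h
        have := h hv
        simp [prefixUnion] at this
      obtain ⟨j', hj', hsub'⟩ := hrip j hj1 (by omega)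
      refine Nat.find_min hex hj' ⟨by omega, fun x hx => hsub' ?_⟩
      exact Finset.mem_inter.2 ⟨hjS hx, h hx⟩
    obtain ⟨x, hx, hxj⟩ := Finset.not_subset.1 hj
    have hpj : j < p i := by
      by_contra hle
      exact hxj (prefixUnion_mono (by omega) (hsub hx))
    have hjp : p i - 1 ≤ j := by
      by_contra hlt
      exact hvp (mem_prefixUnion.2 ⟨j, by omega, hjS hv⟩)
    have : p i - 1 = j := by omega
    simp only [this]
    exact ⟨hji, hjS⟩

/-- Visit one vertex of the hyperedge at position `23`. -/
def sepVisit : Prog :=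
  asg 27 (.load 2 (.reg 24 * .reg 3 + .reg 26)) ⨾ asg 28 (.load 15 (.reg 27)) ⨾
    cnd (.eq (.reg 28) (.lit 0)) (sto 15 (.reg 27) (.reg 23 + .lit 1))
      (sto 16 (.reg 23 * .reg 3 + .load 17 (.reg 23)) (.reg 27) ⨾
        sto 17 (.reg 23) (.load 17 (.reg 23) + .lit 1) ⨾
        cnd (.lt (.load 18 (.reg 23)) (.reg 28)) (sto 18 (.reg 23) (.reg 28)) .skip)

/-- Arrays `16`, `17` become the rows of the separators, array `18` their cover times. -/
def separators : Prog :=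
  forr 23 1 (asg 24 (.load 14 (.reg 23)) ⨾ asg 25 (.load 3 (.reg 24)) ⨾ forr 26 25 sepVisit)

/-- State within the hyperedge at position `i`, of which the vertices in `l` have been seen. -/
structure SepInv (P : ℕ → Finset ℕ) (N i : ℕ) (l : List ℕ) (s : State) : Prop where
  first : ∀ v, (s.arr 15 v = 0 ∧ v ∉ prefixUnion P i ∧ v ∉ l) ∨
    (∃ f < i, s.arr 15 v = f + 1 ∧ v ∈ P f ∧ v ∉ prefixUnion P f) ∨
    (s.arr 15 v = i + 1 ∧ v ∈ l ∧ v ∉ prefixUnion P i)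
  rows : ∃ sl : ℕ → List ℕ, Rows (N + 1) (s.arr 16) (s.arr 17) sl ∧
    (∀ j < i, (sl j).Nodup ∧ (sl j).toFinset = sepSet P j) ∧
    sl i = l.filter (· ∈ prefixUnion P i) ∧ ∀ j, i < j → sl j = []
  cover : ∀ j < i, CoverTime P (sepSet P j) (s.arr 18 j)
  coverHere : CoverTime P (l.filter (· ∈ prefixUnion P i)).toFinset (s.arr 18 i)
  coverRest : ∀ j, i < j → s.arr 18 j = 0

/-- Array 15 holds the first position of a vertex plus 1, so that 0 means unseen. The maximum of
these values over a separator is its cover time. A row has no repetitions, so a nonzero value stems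
from a strictly earlier hyperedge. -/
theorem tr_sepVisit {w N i j e v : ℕ} {σ : State} {P : ℕ → Finset ℕ} {l : List ℕ}
    (hW : 16 * (N + 3) ^ 2 < cap w) (h3 : σ.reg 3 = N + 1) (h23 : σ.reg 23 = i)
    (h24 : σ.reg 24 = e) (h26 : σ.reg 26 = j) (hi : i ≤ N) (he : e ≤ N) (hj : j ≤ N)
    (h2 : σ.arr 2 (e * (N + 1) + j) = v) (hvl : v ∉ l) (hl : l.length ≤ N)
    (hI : SepInv P N i l σ) :
    Tr w sepVisit σ fun t s => t ≤ 45 ∧ SepInv P N i (l ++ [v]) s := by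
  have hln : ∀ x ≤ 96 * N + 144, x < cap w := fun x hx => linear_lt hW hx
  obtain ⟨sl, hR, hsl1, hsl2, hsl3⟩ := hI.rows
  have hlenN : (l.filter (· ∈ prefixUnion P i)).length ≤ N := (List.length_filter_le _ _).trans hl
  have hlen : σ.arr 17 i ≤ N := by rwa [hR.len_eq, hsl2]
  have c0 := cap_pos w
  have c1 := hln 1 (by omega)
  have c2 := hln (i + 1) (by omega)
  have c3 := hln (σ.arr 17 i + 1) (by omega)
  have e1 := row_mul_lt hW he
  have e2 := row_index_lt hW he hj
  have e3 := row_mul_lt hW hi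
  have e4 := row_index_lt (c := σ.arr 17 i) hW hi (by omega)
  refine Tr.seq_asg (by simp [*]) (Tr.seq_asg (by simp) ?_)
  simp only [Expr.eval_load, Expr.eval_add, Expr.eval_mul, Expr.eval_reg, h24, h3, h26, h2,
    State.arr_setReg, State.reg_setReg, if_true]
  refine Tr.cnd (by simp [*]) (fun hc => ?_) (fun hc => ?_)
  · have h0 : σ.arr 15 v = 0 := by simpa using hc
    have hvn : v ∉ prefixUnion P i := by
      rcases hI.first v with h | ⟨f, _, h, _⟩ | ⟨h, _⟩
      · exact h.2.1
      · omega
      · omega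
    have hfil : (l ++ [v]).filter (· ∈ prefixUnion P i) = l.filter (· ∈ prefixUnion P i) := by
      simp [hvn]
    refine Tr.sto (by simp) (by simp [*]) ⟨by simp, ⟨fun x => ?_, ⟨sl, ?_, hsl1, ?_, hsl3⟩, ?_, ?_,
      ?_⟩⟩
    · by_cases hx : x = v
      · subst hx
        exact Or.inr (Or.inr ⟨by simp [h23], by simp, hvn⟩)
      · simpa [hx] using hI.first x
    · simpa using hR
    · rw [hsl2, hfil]
    · simpa using hI.cover
    · rw [hfil]; simpa using hI.coverHere
    · simpa using hI.coverRest
  · have h0 : σ.arr 15 v ≠ 0 := by simpa using hc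
    obtain ⟨f, hfi, hf, hvf, hvnf⟩ : ∃ f < i, σ.arr 15 v = f + 1 ∧ v ∈ P f ∧
        v ∉ prefixUnion P f := by
      rcases hI.first v with h | h | ⟨_, h, _⟩
      · exact absurd h.1 h0
      · exact h
      · exact absurd h hvl
    have hvn : v ∈ prefixUnion P i := mem_prefixUnion.2 ⟨f, hfi, hvf⟩
    have hfil : (l ++ [v]).filter (· ∈ prefixUnion P i) =
        l.filter (· ∈ prefixUnion P i) ++ [v] := by
      simp [hvn]
    have hfilF : ((l ++ [v]).filter (· ∈ prefixUnion P i)).toFinset =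
        insert v (l.filter (· ∈ prefixUnion P i)).toFinset := by
      rw [hfil, List.toFinset_append, Finset.union_comm]; simp
    have hfirst : ∀ x, (σ.arr 15 x = 0 ∧ x ∉ prefixUnion P i ∧ x ∉ l ++ [v]) ∨
        (∃ f < i, σ.arr 15 x = f + 1 ∧ x ∈ P f ∧ x ∉ prefixUnion P f) ∨
        (σ.arr 15 x = i + 1 ∧ x ∈ l ++ [v] ∧ x ∉ prefixUnion P i) := by
      intro x
      rcases hI.first x with h | h | ⟨h1, h2, h3⟩
      · refine Or.inl ⟨h.1, h.2.1, fun hx => ?_⟩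
        rcases List.mem_append.1 hx with hx | hx
        · exact h.2.2 hx
        · rw [List.mem_singleton.1 hx] at h; exact h0 h.1
      · exact Or.inr (Or.inl h)
      · exact Or.inr (Or.inr ⟨h1, by simp [h2], h3⟩)
    have hRp := hR.push (r := i) (x := v) (by rw [hsl2]; omega)
    have hrows : ∀ A B, A = Function.update (σ.arr 16) (i * (N + 1) + σ.arr 17 i) v →
        B = Function.update (σ.arr 17) i (σ.arr 17 i + 1) →
        ∃ sl : ℕ → List ℕ, Rows (N + 1) A B sl ∧
        (∀ j < i, (sl j).Nodup ∧ (sl j).toFinset = sepSet P j) ∧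
        sl i = (l ++ [v]).filter (· ∈ prefixUnion P i) ∧ ∀ j, i < j → sl j = [] := by
      rintro A B rfl rfl
      refine ⟨_, hRp, fun j hj => ?_, ?_, fun j hj => ?_⟩
      · rw [Function.update_of_ne (by omega)]; exact hsl1 j hj
      · rw [Function.update_self, hsl2, hfil]
      · rw [Function.update_of_ne (by omega)]; exact hsl3 j hj
    refine Tr.seq_sto (by simp [*]) (by simp) (Tr.seq_sto (by simp) (by simp [*])
      (Tr.cnd (by simp) (fun hc' => ?_) (fun hc' => ?_)))
    · have hlt : σ.arr 18 i < f + 1 := by simpa [h23, hf] using hc'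
      refine Tr.sto (by simp) (by simp) ⟨by simp, ⟨by simpa using hfirst, ?_, ?_, ?_, ?_⟩⟩
      · exact hrows _ _ (by simp [h23, h3]) (by simp [h23])
      · intro j' hj'
        simpa [h23, show j' ≠ i by omega] using hI.cover j' hj'
      · rw [hfilF]
        simp only [State.arr_setArr, if_true, Expr.eval_reg, State.reg_setArr, State.reg_setReg,
          h23, hf]
        simp only [show ¬ (23 = 28) by omega, show ¬ (23 = 27) by omega, if_false,
          Function.update_self]
        refine ⟨?_, Or.inr ⟨v, by simp, by simpa using hvnf⟩⟩
        intro x hx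
        rcases Finset.mem_insert.1 hx with rfl | hx
        · exact mem_prefixUnion.2 ⟨f, by omega, hvf⟩
        · exact prefixUnion_mono (by omega) (hI.coverHere.1 hx)
      · intro j' hj'
        simpa [h23, show j' ≠ i by omega] using hI.coverRest j' hj'
    · have hlt : f + 1 ≤ σ.arr 18 i := by simpa [h23, hf] using hc'
      refine Tr.skip ⟨by simp, ⟨by simpa using hfirst, ?_, ?_, ?_, ?_⟩⟩
      · exact hrows _ _ (by simp [h23, h3]) (by simp [h23])
      · simpa using hI.cover
      · rw [hfilF]
        have hco := hI.coverHere
        refine ⟨?_, ?_⟩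
        · intro x hx
          simp only [State.arr_setArr, State.arr_setReg]
          rcases Finset.mem_insert.1 hx with rfl | hx
          · exact mem_prefixUnion.2 ⟨f, by simpa using hlt, hvf⟩
          · simpa using hco.1 hx
        · simp only [State.arr_setArr, State.arr_setReg]
          rcases hco.2 with h | ⟨x, hx, hx'⟩
          · omega
          · exact Or.inr ⟨x, Finset.mem_insert_of_mem hx, by simpa using hx'⟩
      · simpa using hI.coverRest

theorem SepInv.next {P : ℕ → Finset ℕ} {N i : ℕ} {l : List ℕ} {s : State} (h : SepInv P N i l s)
    (hl : l.Nodup) (hlP : l.toFinset = P i) : SepInv P N (i + 1) [] s := by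
  obtain ⟨sl, hR, hsl1, hsl2, hsl3⟩ := h.rows
  have hmem : ∀ x, x ∈ l ↔ x ∈ P i := fun x => by rw [← hlP, List.mem_toFinset]
  have hfil : (l.filter (· ∈ prefixUnion P i)).toFinset = sepSet P i := by
    ext x; simp [hmem, sepSet]
  refine ⟨fun v => ?_, ⟨sl, hR, fun j hj => ?_, ?_, fun j hj => hsl3 j (by omega)⟩,
    fun j hj => ?_, ?_, fun j hj => h.coverRest j (by omega)⟩
  · rcases h.first v with ⟨h1, h2, h3⟩ | ⟨f, h1, h2⟩ | ⟨h1, h2, h3⟩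
    · refine Or.inl ⟨h1, ?_, by simp⟩
      rw [prefixUnion_succ, Finset.mem_union, ← hmem]
      tauto
    · exact Or.inr (Or.inl ⟨f, by omega, h2⟩)
    · exact Or.inr (Or.inl ⟨i, by omega, h1, (hmem v).1 h2, h3⟩)
  · rcases Nat.lt_succ_iff_lt_or_eq.1 hj with hj | rfl
    · exact hsl1 j hj
    · rw [hsl2]; exact ⟨hl.filter _, hfil⟩
  · simpa using hsl3 (i + 1) (by omega)
  · rcases Nat.lt_succ_iff_lt_or_eq.1 hj with hj | rfl
    · exact h.cover j hj
    · rw [← hfil]; exact h.coverHere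
  · rw [h.coverRest (i + 1) (by omega)]
    exact ⟨by simp, Or.inl rfl⟩

theorem sizeSum_take_succ {L : List (ℕ × ℕ)} {ord : List ℕ} (hord : ord.Nodup) {i : ℕ}
    (hi : i < ord.length) : sizeSum L (ord.take (i + 1)).toFinset =
      sizeSum L (ord.take i).toFinset + (edgeRow L ord[i]).length := by
  have h : (ord.take (i + 1)).toFinset = insert ord[i] (ord.take i).toFinset := by
    ext x; simp [mem_take_succ_iff hi, or_comm]
  rw [h, sizeSum, Finset.sum_insert (by simpa using getElem_notMem_take hord hi), add_comm]; rfl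

theorem tr_separators {w N m : ℕ} {σ : State} {L : List (ℕ × ℕ)} {ord : List ℕ}
    (hW : 16 * (N + 3) ^ 2 < cap w) (hm : m ≤ N) (hL : L.length = N) (hnd : L.Nodup)
    (hord : ord.Nodup) (hlt : ∀ e ∈ ord, e < m) (hlen : ord.length = m)
    (h1 : σ.reg 1 = m) (h3 : σ.reg 3 = N + 1)
    (hE : Rows (N + 1) (σ.arr 2) (σ.arr 3) (edgeRow L)) (hO : Starts (σ.arr 14) ord)
    (ha15 : σ.arr 15 = fun _ => 0) (ha17 : σ.arr 17 = fun _ => 0) (ha18 : σ.arr 18 = fun _ => 0) :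
    Tr w separators σ fun t s => t ≤ 100 * N + 5 ∧
      (∃ sl : ℕ → List ℕ, Rows (N + 1) (s.arr 16) (s.arr 17) sl ∧
        ∀ j < m, (sl j).Nodup ∧ (sl j).toFinset = sepSet (posSet L ord) j) ∧
      ∀ j < m, CoverTime (posSet L ord) (sepSet (posSet L ord) j) (s.arr 18 j) := by
  have hln : ∀ x ≤ 96 * N + 144, x < cap w := fun x hx => linear_lt hW hx
  refine Tr.forr' (cnt := m) (fun i τ s => τ ≤ 60 * sizeSum L (ord.take i).toFinset + 30 * i ∧
      SepInv (posSet L ord) N i [] s)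
    (by omega) (by omega) (by omega) rfl rfl h1 (hln _ (by omega)) ⟨by simp, ?_⟩ ?_ ?_
  · refine ⟨fun v => Or.inl ⟨by simp [ha15], by simp [prefixUnion], by simp⟩,
      ⟨fun _ => [], ?_, by simp, by simp, by simp⟩, by simp, ⟨by simp, by simp [ha18]⟩,
      by simp [ha18]⟩
    simp only [State.arr_setReg, ha17]; exact Rows.empty _ _
  · rintro i τ s hi hF h23 ⟨hτ, hI⟩
    have hi' : i < ord.length := by omega
    have h3s : s.reg 3 = N + 1 := by rw [hF.reg 3 (by omega) rfl, h3]
    obtain ⟨e, he⟩ : ∃ e, ord[i] = e := ⟨_, rfl⟩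
    have hem : e < m := hlt e (he ▸ List.getElem_mem hi')
    have hP : posSet L ord i = edgeSet L e := by simp [posSet, hi', he]
    have h14 : s.arr 14 i = e := by rw [hF.arr 14 rfl, hO i hi', he]
    have hEs : Rows (N + 1) (s.arr 2) (s.arr 3) (edgeRow L) := by
      rw [hF.arr 2 rfl, hF.arr 3 rfl]; exact hE
    have hlenE : (edgeRow L e).length ≤ N := hL ▸ length_edgeRow_le L e
    rw [sizeSum_take_succ hord hi', he]
    refine Tr.seq_asg (by simp) (Tr.seq_asg (by simp) ?_)
    refine Tr.forr (cnt := (edgeRow L e).length) 45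
      (fun j s => SepInv (posSet L ord) N i ((edgeRow L e).take j) s)
      (by omega) (by omega) (by omega) rfl rfl (by simpa [h23, h14] using hEs.len_eq e)
      (hln _ (by omega)) ?_ ?_ ?_
    · exact ⟨by simpa using hI.first, by simpa using hI.rows, by simpa using hI.cover,
        by simpa using hI.coverHere, by simpa using hI.coverRest⟩
    · intro j s' hj hF' h26 hI'
      have hrow : s'.arr 2 (e * (N + 1) + j) = (edgeRow L e)[j] := by
        rw [hF'.arr 2 rfl]; simpa using hEs.get e j hj
      refine (tr_sepVisit hW (by rw [hF'.reg 3 (by omega) rfl]; simpa using h3s)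
        (by rw [hF'.reg 23 (by omega) rfl]; simpa using h23)
        (by rw [hF'.reg 24 (by omega) rfl]; simpa [h23] using h14) h26 (by omega) (by omega)
        (by omega) hrow (getElem_notMem_take (nodup_edgeRow hnd e) hj) (by simp; omega) hI').mono ?_
      · rintro t s'' ⟨ht, hI''⟩
        rw [List.take_concat_get' _ j hj] at hI''
        exact ⟨ht, by simpa using hI''.first, by simpa using hI''.rows, by simpa using hI''.cover,
          by simpa using hI''.coverHere, by simpa using hI''.coverRest⟩
    · intro s' hF' h26 hI' t ht
      rw [List.take_length] at hI'
      have hI'' := hI'.next (nodup_edgeRow hnd e) hP.symm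
      refine ⟨?_, by simpa using hI''.first, by simpa using hI''.rows, by simpa using hI''.cover,
          by simpa using hI''.coverHere, by simpa using hI''.coverRest⟩
      simp; omega
  · rintro τ s hF h23 ⟨hτ, hI⟩
    have := sizeSum_le L (ord.take m).toFinset
    obtain ⟨sl, hR, hsl1, -⟩ := hI.rows
    exact ⟨by omega, ⟨sl, hR, hsl1⟩, hI.cover⟩

end WordRAM

namespace WordRAM

/-! ### Bit masks -/

/-- The bits of `x` are the members of block `b`, of `k` positions, that satisfy `Q`. -/
def IsMask (k b : ℕ) (Q : ℕ → Prop) (x : ℕ) : Prop :=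
  ∀ t, x.testBit t = true ↔ t < k ∧ Q (b * k + t)

theorem IsMask.lt {k b x : ℕ} {Q : ℕ → Prop} (h : IsMask k b Q x) : x < 2 ^ k := by
  refine Nat.lt_pow_two_of_testBit _ fun t ht => ?_
  rw [Bool.eq_false_iff]
  intro hx
  have := ((h t).1 hx).1
  omega

theorem IsMask.congr {k b x : ℕ} {Q Q' : ℕ → Prop} (h : IsMask k b Q x)
    (hQ : ∀ t < k, Q (b * k + t) ↔ Q' (b * k + t)) : IsMask k b Q' x := fun t =>
  (h t).trans (and_congr_right fun ht => hQ t ht)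

/-- Positions are added in increasing order, so all bits present are below the new one and addition
acts as setting a bit. -/
theorem IsMask.add {k i x : ℕ} {Q : ℕ → Prop} (hk : 1 ≤ k) (h : IsMask k (i / k) Q x)
    (hQ : ∀ j, Q j → j < i) :
    x < 2 ^ (i % k) ∧ IsMask k (i / k) (fun j => Q j ∨ j = i) (x + 2 ^ (i % k)) := by
  have hi : i / k * k + i % k = i := by rw [mul_comm]; exact Nat.div_add_mod i k
  have hlt : x < 2 ^ (i % k) := by
    refine Nat.lt_pow_two_of_testBit _ fun t ht => ?_
    rw [Bool.eq_false_iff]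
    intro hx
    have := hQ _ ((h t).1 hx).2
    omega
  refine ⟨hlt, fun t => ?_⟩
  have hr : i % k < k := Nat.mod_lt _ hk
  rw [add_comm]
  rcases lt_trichotomy t (i % k) with ht | ht | ht
  · rw [Nat.testBit_two_pow_add_gt ht, h t]
    have : i / k * k + t ≠ i := by omega
    simp [this]
  · subst ht
    rw [Nat.testBit_two_pow_add_eq, Nat.testBit_lt_two_pow hlt]
    simp [hr, hi]
  · have h1 : 2 ^ (i % k) + x < 2 ^ t := by
      have : 2 ^ (i % k + 1) ≤ 2 ^ t := Nat.pow_le_pow_right (by omega) ht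
      rw [pow_succ] at this; omega
    rw [Nat.testBit_lt_two_pow h1]
    have h2 : i / k * k + t ≠ i := by omega
    have h3 : ¬ Q (i / k * k + t) := fun hq => by have := hQ _ hq; omega
    simp [h2, h3]

/-- Row `v` of array `19` becomes the masks of the positions containing vertex `v`, and array `20`
the masks of all positions; register `36` becomes the number of blocks. -/
def masks : Prog :=
  forr 29 1 (asg 30 (.reg 29 / .reg 4) ⨾
    cnd (.eq (.reg 29 % .reg 4) (.lit 0)) (asg 31 (.lit 1)) (asg 31 (.reg 31 * .lit 2)) ⨾
    asg 32 (.load 14 (.reg 29)) ⨾ asg 33 (.load 3 (.reg 32)) ⨾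
    forr 34 33 (asg 35 (.load 2 (.reg 32 * .reg 3 + .reg 34)) ⨾
      sto 19 (.reg 35 * .reg 3 + .reg 30) (.load 19 (.reg 35 * .reg 3 + .reg 30) + .reg 31)) ⨾
    sto 20 (.reg 30) (.load 20 (.reg 30) + .reg 31)) ⨾
  asg 36 (.reg 1 / .reg 4 + .lit 1)

theorem tr_masks {w N m k : ℕ} {σ : State} {L : List (ℕ × ℕ)} {ord : List ℕ}
    (hW : 16 * (N + 3) ^ 2 < cap w) (hm : m ≤ N) (hL : L.length = N) (hnd : L.Nodup)
    (hv : ∀ p ∈ L, p.1 ≤ N ∧ p.2 < m)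
    (hord : ord.Nodup) (hlt : ∀ e ∈ ord, e < m) (hlen : ord.length = m)
    (h1 : σ.reg 1 = m) (h3 : σ.reg 3 = N + 1) (h4 : σ.reg 4 = k) (hk : 1 ≤ k)
    (hkN : 2 ^ k ≤ N + 4)
    (hE : Rows (N + 1) (σ.arr 2) (σ.arr 3) (edgeRow L)) (hO : Starts (σ.arr 14) ord)
    (ha19 : σ.arr 19 = fun _ => 0) (ha20 : σ.arr 20 = fun _ => 0) :
    Tr w masks σ fun t s => t ≤ 140 * N + 15 ∧ s.reg 36 = m / k + 1 ∧
      (∀ b ≤ N, IsMask k b (· < m) (s.arr 20 b)) ∧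
      ∀ v ≤ N, ∀ b ≤ N, IsMask k b (fun j => j < m ∧ v ∈ posSet L ord j)
        (s.arr 19 (v * (N + 1) + b)) := by
  have hln : ∀ x ≤ 96 * N + 144, x < cap w := fun x hx => linear_lt hW hx
  have hkk : k < 2 ^ k := Nat.lt_two_pow_self
  have c0 := cap_pos w
  have c1 := hln 1 (by omega)
  have c2 := hln 2 (by omega)
  refine Tr.seq_frame (R := fun t s => t ≤ 140 * N + 5 ∧
    (∀ b ≤ N, IsMask k b (· < m) (s.arr 20 b)) ∧
      ∀ v ≤ N, ∀ b ≤ N, IsMask k b (fun j => j < m ∧ v ∈ posSet L ord j)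
        (s.arr 19 (v * (N + 1) + b))) ?_ ?_
  -- Register 31 holds the weight of the bit last set. It is doubled from one position to the next
  -- and reset to 1 when a block begins, so no powers are computed.
  · refine Tr.forr' (cnt := m) (fun i τ s => τ ≤ 50 * sizeSum L (ord.take i).toFinset + 60 * i ∧
      (i ≠ 0 → s.reg 31 = 2 ^ ((i - 1) % k)) ∧
      (∀ b ≤ N, IsMask k b (· < i) (s.arr 20 b)) ∧
      ∀ v ≤ N, ∀ b ≤ N, IsMask k b (fun j => j < i ∧ v ∈ posSet L ord j)
        (s.arr 19 (v * (N + 1) + b)))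
      (by omega) (by omega) (by omega) rfl rfl h1 (hln _ (by omega)) ⟨by simp, by simp, ?_, ?_⟩ ?_ ?_
    · intro b _ t; simp [ha20]
    · intro v _ b _ t; simp [ha19]
    · rintro i τ s hi hF h29 ⟨hτ, h31, h20, h19⟩
      have hi' : i < ord.length := by omega
      have h3s : s.reg 3 = N + 1 := by rw [hF.reg 3 (by omega) rfl, h3]
      have h4s : s.reg 4 = k := by rw [hF.reg 4 (by omega) rfl, h4]
      obtain ⟨e, he⟩ : ∃ e, ord[i] = e := ⟨_, rfl⟩
      have hem : e < m := hlt e (he ▸ List.getElem_mem hi')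
      have hP : posSet L ord i = edgeSet L e := by simp [posSet, hi', he]
      have h14 : s.arr 14 i = e := by rw [hF.arr 14 rfl, hO i hi', he]
      have hEs : Rows (N + 1) (s.arr 2) (s.arr 3) (edgeRow L) := by
        rw [hF.arr 2 rfl, hF.arr 3 rfl]; exact hE
      have hlenE : (edgeRow L e).length ≤ N := hL ▸ length_edgeRow_le L e
      rw [sizeSum_take_succ hord hi', he]
      have hik : i / k ≤ i := Nat.div_le_self _ _
      have hrk : i % k < k := Nat.mod_lt _ hk
      have hpw : 2 ^ (i % k + 1) ≤ 2 ^ k := Nat.pow_le_pow_right (by omega) hrk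
      rw [pow_succ] at hpw
      have d1 := hln (i / k) (by omega)
      have d2 := hln (i % k) (by omega)
      refine Tr.seq_asg (by simp [*]) ?_
      simp only [Expr.eval_div, Expr.eval_reg, h29, h4s]
      refine Tr.seq_frame (R := fun t s' => t ≤ 10 ∧ s'.reg 31 = 2 ^ (i % k)) ?_ ?_
      · refine Tr.cnd (by simp [*]) (fun hc => ?_) (fun hc => ?_)
        · have hz : i % k = 0 := by simpa [h29, h4s] using hc
          exact Tr.asg (by simp [*]) ⟨by simp, by simp [hz]⟩
        · have hz : i % k ≠ 0 := by simpa [h29, h4s] using hc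
          have hi0 : i ≠ 0 := by rintro rfl; simp at hz
          have hmod : i % k = (i - 1) % k + 1 := by
            have h5 : (i - 1) % k + 1 < k ∨ (i - 1) % k + 1 = k := by
              have := Nat.mod_lt (i - 1) hk; omega
            have h6 : i = i - 1 + 1 := by omega
            have h7 : i % k = ((i - 1) % k + 1) % k := by
              conv_lhs => rw [h6]
              simp
            rcases h5 with h5 | h5
            · rw [h7, Nat.mod_eq_of_lt h5]
            · rw [h5, Nat.mod_self] at h7; exact absurd h7 hz
          have h31' := h31 hi0
          have hpow : 2 ^ ((i - 1) % k) * 2 = 2 ^ (i % k) := by rw [hmod, pow_succ]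
          have d3 := hln (2 ^ (i % k)) (by omega)
          refine Tr.asg ?_ ⟨by simp, by simp [h31', hpow]⟩
          simp [h31', hpow, c2, d3]
      · rintro t₁ s₁ hF₁ ⟨ht₁, h31₁⟩
        have r29 : s₁.reg 29 = i := by rw [hF₁.reg 29 (by omega) rfl]; simpa using h29
        have r30 : s₁.reg 30 = i / k := by rw [hF₁.reg 30 (by omega) rfl]; simp
        have r3 : s₁.reg 3 = N + 1 := by rw [hF₁.reg 3 (by omega) rfl]; simpa using h3s
        have a14 : s₁.arr 14 i = e := by rw [hF₁.arr 14 rfl]; simpa using h14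
        have aE : Rows (N + 1) (s₁.arr 2) (s₁.arr 3) (edgeRow L) := by
          rw [hF₁.arr 2 rfl, hF₁.arr 3 rfl]; simpa using hEs
        have a20 : s₁.arr 20 = s.arr 20 := by rw [hF₁.arr 20 rfl]; simp
        have a19 : s₁.arr 19 = s.arr 19 := by rw [hF₁.arr 19 rfl]; simp
        refine Tr.seq_asg (by simp) (Tr.seq_asg (by simp) ?_)
        refine Tr.seq_frame (R := fun t s' => t ≤ 50 * (edgeRow L e).length + 5 ∧
          ∀ v ≤ N, ∀ b ≤ N, IsMask k b (fun j => j < i + 1 ∧ v ∈ posSet L ord j)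
            (s'.arr 19 (v * (N + 1) + b))) ?_ ?_
        · refine Tr.forr (cnt := (edgeRow L e).length) 40 (fun j s' =>
            ∀ v ≤ N, ∀ b ≤ N, IsMask k b (fun x => (x < i ∧ v ∈ posSet L ord x) ∨
              (x = i ∧ v ∈ (edgeRow L e).take j)) (s'.arr 19 (v * (N + 1) + b)))
            (by omega) (by omega) (by omega) rfl rfl (by simpa [r29, a14] using aE.len_eq e)
            (hln _ (by omega)) ?_ ?_ ?_
          · simpa [a19] using h19
          · intro j s₂ hj hF₂ h34 hI
            obtain ⟨v, hvj⟩ : ∃ v, (edgeRow L e)[j] = v := ⟨_, rfl⟩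
            have hvL : (v, e) ∈ L := mem_edgeRow.1 (hvj ▸ List.getElem_mem hj)
            have hvN : v ≤ N := (hv _ hvL).1
            have q2 : s₂.arr 2 (e * (N + 1) + j) = v := by
              rw [hF₂.arr 2 rfl, ← hvj]; simpa using aE.get e j hj
            have q3 : s₂.reg 3 = N + 1 := by rw [hF₂.reg 3 (by omega) rfl]; simpa using r3
            have q32 : s₂.reg 32 = e := by
              rw [hF₂.reg 32 (by omega) rfl]; simpa [r29] using a14
            have q30 : s₂.reg 30 = i / k := by rw [hF₂.reg 30 (by omega) rfl]; simpa using r30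
            have q31 : s₂.reg 31 = 2 ^ (i % k) := by
              rw [hF₂.reg 31 (by omega) rfl]; simpa using h31₁
            have hnot := getElem_notMem_take (nodup_edgeRow hnd e) hj
            rw [hvj] at hnot
            obtain ⟨hxlt, hadd⟩ := (((hI v hvN (i / k) (by omega)).congr
              (Q' := fun x => x < i ∧ v ∈ posSet L ord x) fun t _ => by simp [hnot])).add hk
              fun j hj => hj.1
            have f1 := row_mul_lt hW (show e ≤ N by omega)
            have f2 := row_index_lt (c := j) hW (show e ≤ N by omega) (by omega)
            have f3 := row_mul_lt hW hvN
            have f4 := row_index_lt (c := i / k) hW hvN (by omega)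
            have f5 := hln (s₂.arr 19 (v * (N + 1) + i / k) + 2 ^ (i % k)) (by omega)
            refine Tr.seq_asg (by simp [*]) (Tr.sto (by simp [*]) (by simp [*]) ⟨by simp, ?_⟩)
            intro v' hv' b hb
            simp only [State.arr_setReg, State.arr_setArr, if_true, Expr.eval_add, Expr.eval_mul,
              Expr.eval_reg, Expr.eval_load, State.reg_setReg, q3, q32, h34, q2, q30, q31]
            simp only [show ¬ (3 = 35) by omega, show ¬ (30 = 35) by omega,
              show ¬ (31 = 35) by omega, if_false]
            by_cases heq : v' * (N + 1) + b = v * (N + 1) + i / k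
            · obtain ⟨rfl, rfl⟩ := row_index_inj (by omega) (by omega) heq
              rw [Function.update_self]
              refine hadd.congr fun t _ => ?_
              simp [mem_take_succ_iff hj, hvj]
            · rw [Function.update_of_ne heq]
              refine (hI v' hv' b hb).congr fun t ht => ?_
              by_cases hvv : v' = v
              · subst hvv
                have hne : b * k + t ≠ i := by
                  rintro h
                  refine heq ?_
                  rw [← h, mul_comm b k, Nat.mul_add_div hk, Nat.div_eq_of_lt ht, add_zero]
                simp [hne]
              · simp [mem_take_succ_iff hj, hvj, hvv]
          · intro s₂ hF₂ h34 hI t ht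
            refine ⟨by omega, fun v hvN b hb => (hI v hvN b hb).congr fun t _ => ?_⟩
            rw [List.take_length, ← List.mem_toFinset]
            change _ ∨ _ ∧ v ∈ edgeSet L e ↔ _
            rw [← hP]
            constructor
            · rintro (⟨ha, hb⟩ | ⟨ha, hb⟩)
              · exact ⟨by omega, hb⟩
              · exact ⟨by omega, by rw [ha]; exact hb⟩
            · rintro ⟨ha, hb⟩
              rcases Nat.lt_succ_iff_lt_or_eq.1 ha with ha | ha
              · exact Or.inl ⟨ha, hb⟩
              · exact Or.inr ⟨ha, by rw [ha] at hb; exact hb⟩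
        · rintro t₂ s₂ hF₂ ⟨ht₂, h19₂⟩
          have q30 : s₂.reg 30 = i / k := by rw [hF₂.reg 30 (by omega) rfl]; simpa using r30
          have q31 : s₂.reg 31 = 2 ^ (i % k) := by
            rw [hF₂.reg 31 (by omega) rfl]; simpa using h31₁
          have q20 : s₂.arr 20 = s.arr 20 := by rw [hF₂.arr 20 rfl]; simpa using a20
          obtain ⟨hxlt, hadd⟩ := (h20 (i / k) (by omega)).add hk fun j hj => hj
          have f5 := hln (s.arr 20 (i / k) + 2 ^ (i % k)) (by omega)
          refine Tr.sto (by simp) (by simp [*]) ⟨by simp; omega, ?_, ?_, ?_⟩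
          · intro _; simp [q31]
          · intro b hb
            simp only [State.arr_setReg, State.arr_setArr, if_true, Expr.eval_add, Expr.eval_reg,
              Expr.eval_load, q30, q31, q20]
            by_cases hbi : b = i / k
            · subst hbi
              rw [Function.update_self]
              exact hadd.congr fun t _ => by omega
            · rw [Function.update_of_ne hbi]
              refine (h20 b hb).congr fun t ht => ?_
              have hne : b * k + t ≠ i := by
                rintro h
                refine hbi ?_
                rw [← h, mul_comm b k, Nat.mul_add_div hk, Nat.div_eq_of_lt ht, add_zero]
              omega
          · intro v hvN b hb
            simpa using h19₂ v hvN b hb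
    · rintro τ s hF h29 ⟨hτ, -, h20, h19⟩
      have := sizeSum_le L (ord.take m).toFinset
      exact ⟨by omega, h20, h19⟩
  · rintro t s hF ⟨ht, h20, h19⟩
    have h1s : s.reg 1 = m := by rw [hF.reg 1 (by omega) rfl, h1]
    have h4s : s.reg 4 = k := by rw [hF.reg 4 (by omega) rfl, h4]
    have hmk : m / k ≤ m := Nat.div_le_self _ _
    have d1 := hln (m / k) (by omega)
    have d2 := hln (m / k + 1) (by omega)
    refine Tr.asg (by simp [*]) ⟨by simp; omega, by simp [h1s, h4s], by simpa using h20,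
      by simpa using h19⟩

end WordRAM

namespace WordRAM

theorem IsMask.and {k b x y : ℕ} {Q Q' : ℕ → Prop} (h : IsMask k b Q x) (h' : IsMask k b Q' y) :
    IsMask k b (fun j => Q j ∧ Q' j) (x &&& y) := by
  intro t
  have := h t
  have := h' t
  rw [Nat.testBit_and, Bool.and_eq_true]
  tauto

/-- Both descriptions of the new block are strictly increasing lists with the same members.
Extracting bits from the lowest upwards thus keeps the positions sorted. -/
theorem IsMask.filter_range {k b x : ℕ} {Q : ℕ → Prop} [DecidablePred Q] (h : IsMask k b Q x) :
    (List.range ((b + 1) * k)).filter (fun j => decide (Q j)) =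
      (List.range (b * k)).filter (fun j => decide (Q j)) ++ x.bitIndices.map (b * k + ·) := by
  rw [add_mul, one_mul, List.range_add, List.filter_append, List.filter_map]
  congr 2
  refine List.SortedLT.eq_of_mem_iff ?_ Nat.bitIndices_sorted fun a => ?_
  · exact List.Pairwise.sortedLT (List.sortedLT_range k |>.pairwise.filter _)
  · rw [Nat.mem_bitIndices, h a]
    simp

/-! ### The hyperedges containing a separator -/

/-- Array `22` becomes the list of the positions whose hyperedge contains the separator of the
position in register `37`. -/
def collect : Prog :=
  asg 38 (.load 17 (.reg 37)) ⨾ asg 39 (.lit 0) ⨾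
  forr 40 36 (asg 41 (.load 20 (.reg 40)) ⨾
    forr 42 38 (asg 41 (.load 6 (.reg 41 * .reg 5 +
      .load 19 (.load 16 (.reg 37 * .reg 3 + .reg 42) * .reg 3 + .reg 40)))) ⨾
    whl (.ne (.reg 41) (.lit 0)) (sto 22 (.reg 39) (.reg 40 * .reg 4 + .load 7 (.reg 41)) ⨾
      asg 39 (.reg 39 + .lit 1) ⨾ asg 41 (.load 8 (.reg 41))))

/-- In each block, the masks of the vertices of the separator are conjoined at one table lookup
each; this gives the term `(m / k + 1) * |S|`. Extracting the result takes one round per set bit,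
that is, per position found. -/
theorem tr_collect {w N m k i : ℕ} {σ : State} {P : ℕ → Finset ℕ} {sl : ℕ → List ℕ}
    (hW : 16 * (N + 3) ^ 2 < cap w) (hm : m ≤ N) (hi : i < m)
    (h3 : σ.reg 3 = N + 1) (h4 : σ.reg 4 = k) (h5 : σ.reg 5 = 2 ^ k) (h36 : σ.reg 36 = m / k + 1)
    (h37 : σ.reg 37 = i) (hk : 1 ≤ k) (hkN : 2 ^ k * 2 ^ k ≤ N + 4)
    (hR : Rows (N + 1) (σ.arr 16) (σ.arr 17) sl) (hsl : ∀ v ∈ sl i, v ≤ N)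
    (hlen : (sl i).length ≤ N)
    (hand : ∀ x < 2 ^ k, ∀ y < 2 ^ k, σ.arr 6 (x * 2 ^ k + y) = x &&& y)
    (hbit : ∀ x < 2 ^ k, x ≠ 0 → x.bitIndices = σ.arr 7 x :: (σ.arr 8 x).bitIndices ∧
      σ.arr 8 x < x)
    (h20 : ∀ b ≤ N, IsMask k b (· < m) (σ.arr 20 b))
    (h19 : ∀ v ≤ N, ∀ b ≤ N, IsMask k b (fun j => j < m ∧ v ∈ P j) (σ.arr 19 (v * (N + 1) + b))) :
    Tr w collect σ fun t s => t ≤ (m / k + 1) * (40 * (sl i).length + 60) +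
        40 * ((List.range m).filter fun j => (sl i).toFinset ⊆ P j).length + 20 ∧
      s.reg 38 = (sl i).length ∧
      s.reg 39 = ((List.range m).filter fun j => (sl i).toFinset ⊆ P j).length ∧
      Starts (s.arr 22) ((List.range m).filter fun j => (sl i).toFinset ⊆ P j) := by
  have hln : ∀ x ≤ 96 * N + 144, x < cap w := fun x hx => linear_lt hW hx
  have hkk : k < 2 ^ k := Nat.lt_two_pow_self
  have hKN : 2 ^ k ≤ N + 4 := le_trans (Nat.le_mul_of_pos_left _ (by positivity)) hkN
  have c0 := cap_pos w
  have c1 := hln 1 (by omega)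
  have hmk : m / k ≤ m := Nat.div_le_self _ _
  -- The blocks extend beyond m. The conjunct `j < m`, present from the start through array 20, cuts
  -- the excess off.
  obtain ⟨Q, hQ⟩ : ∃ Q : ℕ → Prop, Q = fun j => j < m ∧ ∀ v ∈ sl i, v ∈ P j := ⟨_, rfl⟩
  classical
  have hcl : ((List.range m).filter fun j => (sl i).toFinset ⊆ P j) =
      (List.range ((m / k + 1) * k)).filter fun j => Q j := by
    have hle : m ≤ (m / k + 1) * k := by
      have := Nat.lt_div_mul_add (a := m) hk
      rw [add_mul, one_mul]; omega
    obtain ⟨d, hd⟩ := Nat.exists_eq_add_of_le hle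
    rw [hd, List.range_add, List.filter_append]
    have : (List.filter (fun j => decide (Q j)) ((List.range d).map (m + ·))) = [] := by
      simp [hQ]
    rw [this, List.append_nil]
    refine List.filter_congr fun j hj => ?_
    simp [hQ, List.mem_range.1 hj, Finset.subset_iff]
  obtain ⟨cl, hcl'⟩ : ∃ cl, ((List.range m).filter fun j => (sl i).toFinset ⊆ P j) = cl := ⟨_, rfl⟩
  have hQlen : ∀ b, ((List.range (b * k)).filter fun j => Q j).length ≤ m := by
    intro b
    refine length_le_of_nodup_of_lt (List.nodup_range.filter _) fun x hx => ?_
    have : Q x := by simpa using (List.mem_filter.1 hx).2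
    rw [hQ] at this
    exact this.1
  rw [hcl'] at hcl ⊢
  refine Tr.seq_asg (by simp) (Tr.seq_asg (by simpa using c0) ?_)
  refine Tr.forr' (cnt := m / k + 1) (fun b τ s =>
    τ ≤ b * (40 * (sl i).length + 60) + 40 * ((List.range (b * k)).filter fun j => Q j).length ∧
    s.reg 39 = ((List.range (b * k)).filter fun j => Q j).length ∧
    Starts (s.arr 22) ((List.range (b * k)).filter fun j => Q j))
    (by omega) (by omega) (by omega) rfl rfl (by simpa using h36) (hln _ (by omega))
    ⟨by simp, by simp, by simpa using Starts.nil _⟩ ?_ ?_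
  · rintro b τ s hb hF h40 ⟨hτ, h39, h22⟩
    have hbN : b ≤ N := by omega
    have s37 : s.reg 37 = i := by rw [hF.reg 37 (by omega) rfl]; simpa using h37
    have s38 : s.reg 38 = (sl i).length := by
      rw [hF.reg 38 (by omega) rfl]; simpa [h37] using hR.len_eq i
    have s3 : s.reg 3 = N + 1 := by rw [hF.reg 3 (by omega) rfl]; simpa using h3
    have s4 : s.reg 4 = k := by rw [hF.reg 4 (by omega) rfl]; simpa using h4
    have s5 : s.reg 5 = 2 ^ k := by rw [hF.reg 5 (by omega) rfl]; simpa using h5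
    have a20 : s.arr 20 = σ.arr 20 := by rw [hF.arr 20 rfl]; simp
    refine Tr.seq_asg (by simp) (Tr.seq_frame (R := fun t s' =>
      t ≤ (sl i).length * (30 + 7) + 5 ∧ IsMask k b Q (s'.reg 41)) ?_ ?_)
    · refine Tr.forr (cnt := (sl i).length) 30 (fun j s' =>
        IsMask k b (fun x => x < m ∧ ∀ v ∈ (sl i).take j, v ∈ P x) (s'.reg 41))
        (by omega) (by omega) (by omega) rfl rfl (by simpa using s38) (hln _ (by omega)) ?_ ?_ ?_
      · simpa [h40, a20] using h20 b hbN
      · intro j s₂ hj hF₂ h42 hI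
        obtain ⟨v, hvj⟩ : ∃ v, (sl i)[j] = v := ⟨_, rfl⟩
        have hvN : v ≤ N := hsl v (hvj ▸ List.getElem_mem hj)
        have q3 : s₂.reg 3 = N + 1 := by rw [hF₂.reg 3 (by omega) rfl]; simpa using s3
        have q5 : s₂.reg 5 = 2 ^ k := by rw [hF₂.reg 5 (by omega) rfl]; simpa using s5
        have q37 : s₂.reg 37 = i := by rw [hF₂.reg 37 (by omega) rfl]; simpa using s37
        have q40 : s₂.reg 40 = b := by rw [hF₂.reg 40 (by omega) rfl]; simpa using h40
        have q16 : s₂.arr 16 (i * (N + 1) + j) = v := by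
          rw [hF₂.arr 16 rfl, ← hvj, State.arr_setReg, hF.arr 16 rfl]
          simpa using hR.get i j hj
        have q19 : s₂.arr 19 (v * (N + 1) + b) = σ.arr 19 (v * (N + 1) + b) := by
          rw [hF₂.arr 19 rfl, State.arr_setReg, hF.arr 19 rfl]; simp
        have q6 : s₂.arr 6 = σ.arr 6 := by
          rw [hF₂.arr 6 rfl, State.arr_setReg, hF.arr 6 rfl]; simp
        have hy := h19 v hvN b hbN
        have hxl := hI.lt
        have hyl := hy.lt
        have hprod : s₂.reg 41 * 2 ^ k + 2 ^ k ≤ N + 4 := by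
          refine le_trans ?_ hkN
          rw [← Nat.succ_mul]
          exact Nat.mul_le_mul_right _ hxl
        have hx := hand _ hxl _ hyl
        have f1 := row_mul_lt hW (show i ≤ N by omega)
        have f2 := row_index_lt (c := j) hW (show i ≤ N by omega) (by omega)
        have f3 := row_mul_lt hW hvN
        have f4 := row_index_lt hW hvN hbN
        have f5 := hln (s₂.reg 41 * 2 ^ k) (by omega)
        have f6 := hln (s₂.reg 41 * 2 ^ k + σ.arr 19 (v * (N + 1) + b)) (by omega)
        refine Tr.asg (by simp [*]) ⟨by simp, ?_⟩
        simp only [State.reg_setReg, Expr.eval_load, Expr.eval_add, Expr.eval_mul, Expr.eval_reg,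
          q3, q5, q37, q40, h42, q16, q19, q6, hx]
        simp only [show ¬ (41 = 42) by omega, if_false, if_true]
        refine (hI.and hy).congr fun t _ => ?_
        simp only [mem_take_succ_iff hj, hvj]
        constructor
        · rintro ⟨⟨ha, hb⟩, -, hc⟩
          exact ⟨ha, fun u hu => hu.elim (hb u) (fun h => h ▸ hc)⟩
        · rintro ⟨ha, hb⟩
          exact ⟨⟨ha, fun u hu => hb u (Or.inl hu)⟩, ha, hb v (Or.inr rfl)⟩
      · intro s₂ hF₂ h42 hI t ht
        refine ⟨ht, ?_⟩
        rw [List.take_length] at hI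
        rw [hQ]; exact hI
    · rintro t₁ s₁ hF₁ ⟨ht₁, hM⟩
      have hfr := hM.filter_range
      have hlb := hQlen (b + 1)
      obtain ⟨l₀, hl₀⟩ : ∃ l₀, (List.range (b * k)).filter (fun j => decide (Q j)) = l₀ := ⟨_, rfl⟩
      obtain ⟨l₁, hl₁⟩ : ∃ l₁, (List.range ((b + 1) * k)).filter (fun j => decide (Q j)) = l₁ :=
        ⟨_, rfl⟩
      have hbk : b * k ≤ m := le_trans (Nat.mul_le_mul_right k (show b ≤ m / k by omega))
        (Nat.div_mul_le_self m k)
      rw [hl₀, hl₁] at hfr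
      rw [hl₀] at hτ h39 h22
      rw [hl₁] at hlb ⊢
      have q40 : s₁.reg 40 = b := by rw [hF₁.reg 40 (by omega) rfl]; simpa using h40
      have q4 : s₁.reg 4 = k := by rw [hF₁.reg 4 (by omega) rfl]; simpa using s4
      have q39 : s₁.reg 39 = l₀.length := by rw [hF₁.reg 39 (by omega) rfl]; simpa using h39
      have q22 : Starts (s₁.arr 22) l₀ := by rw [hF₁.arr 22 rfl]; simpa using h22
      have q7 : s₁.arr 7 = σ.arr 7 := by
        rw [hF₁.arr 7 rfl, State.arr_setReg, hF.arr 7 rfl]; simp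
      have q8 : s₁.arr 8 = σ.arr 8 := by
        rw [hF₁.arr 8 rfl, State.arr_setReg, hF.arr 8 rfl]; simp
      -- What has been written, followed by the bits still in register 41, is always the full list
      -- up to this block; 40 units are reserved for each remaining bit.
      refine Tr.whl (fun bud s' => ∃ l, s'.reg 39 = l.length ∧ Starts (s'.arr 22) l ∧
        l ++ (s'.reg 41).bitIndices.map (b * k + ·) = l₁ ∧ s'.reg 41 < 2 ^ k ∧
        bud = 40 * (s'.reg 41).bitIndices.length) (40 * (s₁.reg 41).bitIndices.length)
        ⟨l₀, q39, q22, hfr.symm, hM.lt, rfl⟩ ?_ ?_ ?_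
      · rintro bud s' hF' -
        simpa using c0
      · rintro bud s' hF' ⟨l, g39, g22, hl, hlt, rfl⟩ hc
        have hne : s'.reg 41 ≠ 0 := by simpa using hc
        obtain ⟨hb1, hb2⟩ := hbit _ hlt hne
        obtain ⟨x, hx⟩ : ∃ x, s'.reg 41 = x := ⟨_, rfl⟩
        have g40 : s'.reg 40 = b := by rw [hF'.reg 40 (by omega) rfl, q40]
        have g4 : s'.reg 4 = k := by rw [hF'.reg 4 (by omega) rfl, q4]
        have g7 : s'.arr 7 = σ.arr 7 := by rw [hF'.arr 7 rfl, q7]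
        have g8 : s'.arr 8 = σ.arr 8 := by rw [hF'.arr 8 rfl, q8]
        rw [hx] at hb1 hb2 hl hlt
        have htb : σ.arr 7 x < k := by
          have : x.testBit (σ.arr 7 x) = true := by
            rw [← Nat.mem_bitIndices, hb1]; simp
          by_contra hge
          rw [Nat.testBit_lt_two_pow (lt_of_lt_of_le hlt
            (Nat.pow_le_pow_right (by omega) (not_lt.1 hge)))] at this
          simp at this
        have hll : l.length + 1 ≤ N := by
          have := congrArg List.length hl
          rw [hb1] at this
          simp at this
          omega
        have f1 := hln (b * k) (by omega)
        have f2 := hln (b * k + σ.arr 7 x) (by omega)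
        have f3 := hln (l.length + 1) (by omega)
        refine Tr.seq_sto (by simp) (by simp [*]) (Tr.seq_asg (by simp [*]) (Tr.asg (by simp [*]) ?_))
        refine ⟨_, ⟨l ++ [b * k + σ.arr 7 x], by simp [g39], ?_, ?_, ?_, rfl⟩, ?_⟩
        · simpa [g39, g40, g4, g7, hx] using g22.push (b * k + σ.arr 7 x)
        · rw [hb1] at hl
          simpa [hx, g8] using hl
        · simpa [hx, g8] using lt_trans hb2 hlt
        · simp [hx, hb1, g8]; omega
      · rintro b' s' hF' ⟨l, g39, g22, hl, hlt, -⟩ hc t ht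
        have hz : s'.reg 41 = 0 := by simpa using hc
        rw [hz] at hl
        simp at hl
        subst hl
        refine ⟨?_, by simpa using g39, by simpa using g22⟩
        have := congrArg List.length hfr
        simp at this ht ⊢
        rw [add_mul, one_mul]
        omega
  · rintro τ s hF h40 ⟨hτ, h39, h22⟩
    rw [← hcl] at hτ h39 h22
    refine ⟨by simp; omega, ?_, h39, h22⟩
    rw [hF.reg 38 (by omega) rfl]; simpa [h37] using hR.len_eq i

end WordRAM

namespace WordRAM

/-! ### Grouping the positions by their roots -/

/-- The rows `0, …, r - 1` of `gl` are the classes of `c` under equality of `root`; the class of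
`x` is row `comp x`. -/
structure Grouping (root : ℕ → ℕ) (c : List ℕ) (comp : ℕ → ℕ) (r : ℕ) (gl : ℕ → List ℕ) :
    Prop where
  lt : ∀ x ∈ c, comp x < r
  comp_eq : ∀ x ∈ c, ∀ y ∈ c, comp x = comp y ↔ root x = root y
  nodup : ∀ g < r, (gl g).Nodup
  ne_nil : ∀ g < r, gl g ≠ []
  mem : ∀ g < r, ∀ x, x ∈ gl g ↔ x ∈ c ∧ comp x = g

namespace Grouping

variable {root comp : ℕ → ℕ} {c : List ℕ} {r : ℕ} {gl : ℕ → List ℕ}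

theorem nil (root comp : ℕ → ℕ) (gl : ℕ → List ℕ) : Grouping root [] comp 0 gl :=
  ⟨by simp, by simp, by simp, by simp, by simp⟩

theorem length_le (h : Grouping root c comp r gl) {g : ℕ} (hg : g < r) :
    (gl g).length ≤ c.length := by
  rw [← List.toFinset_card_of_nodup (h.nodup g hg)]
  refine le_trans (Finset.card_le_card ?_) c.toFinset_card_le
  intro x hx
  rw [List.mem_toFinset] at hx ⊢
  exact ((h.mem g hg x).1 hx).1

theorem head (h : Grouping root c comp r gl) {j : ℕ} (hj : j ∉ c)
    (hr : ∀ x ∈ c, root x ≠ root j) :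
    Grouping root (c ++ [j]) (Function.update comp j r) (r + 1) (Function.update gl r [j]) := by
  have hne : ∀ x ∈ c, x ≠ j := fun x hx hxj => hj (hxj ▸ hx)
  refine ⟨?_, ?_, ?_, ?_, ?_⟩
  · simp only [List.mem_append, List.mem_singleton]
    rintro x (hx | rfl)
    · rw [Function.update_of_ne (hne x hx)]; exact lt_trans (h.lt x hx) (by omega)
    · simp
  · simp only [List.mem_append, List.mem_singleton]
    rintro x (hx | rfl) y (hy | rfl)
    · rw [Function.update_of_ne (hne x hx), Function.update_of_ne (hne y hy)]
      exact h.comp_eq x hx y hy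
    · rw [Function.update_of_ne (hne x hx), Function.update_self]
      simp [hr x hx, (h.lt x hx).ne]
    · rw [Function.update_of_ne (hne y hy), Function.update_self]
      simp [(hr y hy).symm, (h.lt y hy).ne']
    · simp
  · intro g hg
    by_cases hgr : g = r
    · subst hgr; simp
    · rw [Function.update_of_ne hgr]; exact h.nodup g (by omega)
  · intro g hg
    by_cases hgr : g = r
    · subst hgr; simp
    · rw [Function.update_of_ne hgr]; exact h.ne_nil g (by omega)
  · intro g hg x
    simp only [List.mem_append, List.mem_singleton]
    by_cases hgr : g = r
    · subst hgr
      rw [Function.update_self, List.mem_singleton]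
      constructor
      · rintro rfl; simp
      · rintro ⟨hx | hx, hc⟩
        · rw [Function.update_of_ne (hne x hx)] at hc
          exact absurd hc (h.lt x hx).ne
        · exact hx
    · rw [Function.update_of_ne hgr, h.mem g (by omega)]
      constructor
      · rintro ⟨hx, hc⟩
        exact ⟨Or.inl hx, by rwa [Function.update_of_ne (hne x hx)]⟩
      · rintro ⟨hx | rfl, hc⟩
        · exact ⟨hx, by rwa [Function.update_of_ne (hne x hx)] at hc⟩
        · rw [Function.update_self] at hc
          exact absurd hc.symm hgr

theorem member (h : Grouping root c comp r gl) {j y : ℕ} (hj : j ∉ c) (hy : y ∈ c)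
    (hr : root j = root y) :
    Grouping root (c ++ [j]) (Function.update comp j (comp y)) r
      (Function.update gl (comp y) (gl (comp y) ++ [j])) := by
  have hne : ∀ x ∈ c, x ≠ j := fun x hx hxj => hj (hxj ▸ hx)
  refine ⟨?_, ?_, ?_, ?_, ?_⟩
  · simp only [List.mem_append, List.mem_singleton]
    rintro x (hx | rfl)
    · rw [Function.update_of_ne (hne x hx)]; exact h.lt x hx
    · simpa using h.lt y hy
  · simp only [List.mem_append, List.mem_singleton]
    rintro x (hx | rfl) z (hz | rfl)
    · rw [Function.update_of_ne (hne x hx), Function.update_of_ne (hne z hz)]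
      exact h.comp_eq x hx z hz
    · rw [Function.update_of_ne (hne x hx), Function.update_self, hr]
      exact h.comp_eq x hx y hy
    · rw [Function.update_of_ne (hne z hz), Function.update_self, hr]
      exact h.comp_eq y hy z hz
    · simp
  · intro g hg
    by_cases hgr : g = comp y
    · subst hgr
      rw [Function.update_self, List.nodup_append']
      refine ⟨h.nodup _ hg, List.nodup_singleton _, ?_⟩
      rw [List.disjoint_singleton]
      exact fun hm => hj ((h.mem _ hg j).1 hm).1
    · rw [Function.update_of_ne hgr]; exact h.nodup g hg
  · intro g hg
    by_cases hgr : g = comp y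
    · subst hgr; simp
    · rw [Function.update_of_ne hgr]; exact h.ne_nil g hg
  · intro g hg x
    simp only [List.mem_append, List.mem_singleton]
    by_cases hgr : g = comp y
    · subst hgr
      rw [Function.update_self, List.mem_append, List.mem_singleton, h.mem _ hg]
      constructor
      · rintro (⟨hx, hc⟩ | rfl)
        · exact ⟨Or.inl hx, by rwa [Function.update_of_ne (hne x hx)]⟩
        · simp
      · rintro ⟨hx | hx, hc⟩
        · exact Or.inl ⟨hx, by rwa [Function.update_of_ne (hne x hx)] at hc⟩
        · exact Or.inr hx
    · rw [Function.update_of_ne hgr, h.mem g hg]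
      constructor
      · rintro ⟨hx, hc⟩
        exact ⟨Or.inl hx, by rwa [Function.update_of_ne (hne x hx)]⟩
      · rintro ⟨hx | rfl, hc⟩
        · exact ⟨hx, by rwa [Function.update_of_ne (hne x hx)] at hc⟩
        · rw [Function.update_self] at hc
          exact absurd hc.symm hgr

end Grouping

/-- The list is strictly increasing, so the entries before a given one are exactly the smaller ones.
-/
theorem mem_take_filter_range {m p x : ℕ} {Q : ℕ → Prop} [DecidablePred Q]
    (hp : p < ((List.range m).filter fun j => Q j).length) :
    x ∈ ((List.range m).filter fun j => Q j).take p ↔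
      x < m ∧ Q x ∧ x < ((List.range m).filter fun j => Q j)[p] := by
  have hs : ((List.range m).filter fun j => Q j).SortedLT :=
    List.Pairwise.sortedLT ((List.sortedLT_range m).pairwise.filter _)
  have hmem : ∀ x, x ∈ (List.range m).filter (fun j => Q j) ↔ x < m ∧ Q x := by simp
  obtain ⟨l, hl⟩ : ∃ l, (List.range m).filter (fun j => decide (Q j)) = l := ⟨_, rfl⟩
  simp only [hl] at hs hp hmem ⊢
  rw [← and_assoc, ← hmem, List.mem_take_iff_getElem]
  constructor
  · rintro ⟨a, ha, rfl⟩
    exact ⟨List.getElem_mem _, hs.strictMono_get (a := ⟨a, by omega⟩) (b := ⟨p, hp⟩)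
      (by simp; omega)⟩
  · rintro ⟨hx, hlt⟩
    obtain ⟨a, ha, rfl⟩ := List.getElem_of_mem hx
    have hap : a < p := (hs.strictMono_get.lt_iff_lt (a := ⟨a, ha⟩) (b := ⟨p, hp⟩)).1 hlt
    exact ⟨a, by omega, rfl⟩

end WordRAM

namespace WordRAM

/-- Register `46` becomes `1` if the position in register `45` is a root, otherwise `0`. -/
def isRoot : Prog :=
  asg 46 (.lit 0) ⨾
    cnd (.eq (.reg 44) (.lit 0)) (asg 46 (.lit 1))
      (cnd (.eq (.load 17 (.reg 45)) (.reg 38)) (asg 46 (.lit 1) ⨾ sto 21 (.reg 45) (.lit 1)) .skip)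

/-- The positions in array `22` are sorted by their roots into the rows of array `24`, whose
lengths stand in array `25`; register `43` becomes the number of rows. Array `21` marks the
positions with the current separator. -/
def group : Prog :=
  asg 43 (.lit 0) ⨾
  forr 44 39 (asg 45 (.load 22 (.reg 44)) ⨾ isRoot ⨾
    cnd (.eq (.reg 46) (.lit 0)) (sto 23 (.reg 45) (.load 23 (.load 18 (.reg 45) - .lit 1)))
      (sto 23 (.reg 45) (.reg 43) ⨾ sto 25 (.reg 43) (.lit 0) ⨾ asg 43 (.reg 43 + .lit 1)) ⨾
    asg 47 (.load 23 (.reg 45)) ⨾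
    sto 24 (.reg 47 * .reg 3 + .load 25 (.reg 47)) (.reg 45) ⨾
    sto 25 (.reg 47) (.load 25 (.reg 47) + .lit 1))

section

variable {P : ℕ → Finset ℕ} {par : ℕ → ℕ} {m p : ℕ} {S : Finset ℕ}

/-- Otherwise the parent would be an earlier position whose set contains S. The second clause shows
that nothing is missed when the program treats this position as a root without marking it. -/
theorem first_isRoot (hpar : IsParentMap P par m)
    (hp : 0 < ((List.range m).filter fun j => S ⊆ P j).length) {j : ℕ}
    (hj : ((List.range m).filter fun j => S ⊆ P j)[0] = j) :
    ¬ S ⊂ sepSet P j ∧ ¬ (1 ≤ j ∧ sepSet P j = S) := by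
  have hmem : j ∈ (List.range m).filter fun j => S ⊆ P j := hj ▸ List.getElem_mem _
  have hjm : j < m := by simpa using (List.mem_filter.1 hmem).1
  have key : ∀ h1 : 1 ≤ j, ¬ S ⊆ sepSet P j := by
    intro h1 hS
    obtain ⟨hlt, hsub⟩ := hpar j h1 hjm
    have := (mem_take_filter_range (x := par j) hp).2
      ⟨by omega, hS.trans hsub, by rw [hj]; exact hlt⟩
    simp at this
  refine ⟨fun h => key (one_le_of_ssubset_sepSet h) h.1, fun h => key h.1 h.2.ge⟩

/-- An earlier position of the list covers S. Hence, after the initial position, comparing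
cardinalities decides whether the separator equals S or properly contains it, as `isRoot` does. -/
theorem later_subset_sepSet (h0 : p ≠ 0)
    (hp : p < ((List.range m).filter fun j => S ⊆ P j).length) {j : ℕ}
    (hj : ((List.range m).filter fun j => S ⊆ P j)[p] = j) : 1 ≤ j ∧ S ⊆ sepSet P j := by
  have hmem : j ∈ (List.range m).filter fun j => S ⊆ P j := hj ▸ List.getElem_mem _
  have hjS : S ⊆ P j := by simpa using (List.mem_filter.1 hmem).2
  obtain ⟨x, hx⟩ : ∃ x, x ∈ ((List.range m).filter fun j => S ⊆ P j).take p := by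
    refine List.exists_mem_of_ne_nil _ ?_
    rw [Ne, List.take_eq_nil_iff]
    rintro (h | h)
    · exact h0 h
    · simp [h] at hp
  obtain ⟨-, hxS, hxj⟩ := (mem_take_filter_range hp).1 hx
  rw [hj] at hxj
  exact ⟨by omega, fun v hv => Finset.mem_inter.2 ⟨hjS hv, mem_prefixUnion.2 ⟨x, hxj, hxS hv⟩⟩⟩

end

theorem tr_isRoot {w m p j : ℕ} {σ : State} {P : ℕ → Finset ℕ} {par : ℕ → ℕ} {S : Finset ℕ}
    (hc : 1 < cap w) (hpar : IsParentMap P par m)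
    (hp : p < ((List.range m).filter fun j => S ⊆ P j).length)
    (hj : ((List.range m).filter fun j => S ⊆ P j)[p] = j)
    (h38 : σ.reg 38 = S.card) (h17 : σ.arr 17 j = (sepSet P j).card)
    (h44 : σ.reg 44 = p) (h45 : σ.reg 45 = j) :
    Tr w isRoot σ fun t s => t ≤ 20 ∧ (s.reg 46 = 0 ↔ S ⊂ sepSet P j) ∧
      s.arr 21 = if 1 ≤ j ∧ sepSet P j = S then Function.update (σ.arr 21) j 1 else σ.arr 21 := by
  have c0 := cap_pos w
  refine Tr.seq_asg (by simpa using c0) (Tr.cnd (by simpa using c0) (fun h => ?_) (fun h => ?_))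
  · have h0 : p = 0 := by simpa [h44] using h
    subst h0
    obtain ⟨h1, h2⟩ := first_isRoot hpar hp hj
    exact Tr.asg (by simpa using hc) ⟨by simp, by simp [h1], by simp only [h2]; simp⟩
  · have h0 : p ≠ 0 := by simpa [h44] using h
    obtain ⟨h1, h2⟩ := later_subset_sepSet h0 hp hj
    refine Tr.cnd (by simp) (fun h => ?_) (fun h => ?_)
    · have hcard : (sepSet P j).card = S.card := by simpa [h45, h17, h38] using h
      have heq : S = sepSet P j := Finset.eq_of_subset_of_card_le h2 hcard.le
      refine Tr.seq_asg (by simpa using hc) (Tr.sto (by simp) (by simpa using hc) ⟨by simp, ?_, ?_⟩)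
      · simp [← heq]
      · simp [← heq, h1, h45]
    · have hcard : (sepSet P j).card ≠ S.card := by simpa [h45, h17, h38] using h
      have hne : sepSet P j ≠ S := fun h => hcard (by rw [h])
      refine Tr.skip ⟨by simp, ?_, ?_⟩
      · simp [Finset.ssubset_iff_subset_ne, h2, hne.symm]
      · simp [hne]

/-- Positions arrive in increasing order, so the class of a parent is known before it is needed: a
root opens a new row, any other position joins the row of its parent. The length of a row is reset
when the row is opened, so remains of earlier separators need not be cleared. -/
theorem tr_group {w N m : ℕ} {σ : State} {P : ℕ → Finset ℕ} {S : Finset ℕ}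
    {gl₀ : ℕ → List ℕ} (hW : 16 * (N + 3) ^ 2 < cap w) (hm : m ≤ N)
    (hpar : IsParentMap P (fun j => σ.arr 18 j - 1) m)
    (h3 : σ.reg 3 = N + 1) (h38 : σ.reg 38 = S.card)
    (h39 : σ.reg 39 = ((List.range m).filter fun j => S ⊆ P j).length)
    (h17 : ∀ j < m, σ.arr 17 j = (sepSet P j).card)
    (h22 : Starts (σ.arr 22) ((List.range m).filter fun j => S ⊆ P j))
    (hR : Rows (N + 1) (σ.arr 24) (σ.arr 25) gl₀) :
    Tr w group σ fun t s => t ≤ 100 * ((List.range m).filter fun j => S ⊆ P j).length + 10 ∧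
      (∀ j, s.arr 21 j =
        if j ∈ ((List.range m).filter fun j => S ⊆ P j) ∧ 1 ≤ j ∧ sepSet P j = S then 1
        else σ.arr 21 j) ∧
      ∃ gl, Rows (N + 1) (s.arr 24) (s.arr 25) gl ∧ s.reg 43 ≤ m ∧
        Grouping (sepRoot P (fun j => σ.arr 18 j - 1) S)
          ((List.range m).filter fun j => S ⊆ P j) (s.arr 23) (s.reg 43) gl := by
  have hln : ∀ x ≤ 96 * N + 144, x < cap w := fun x hx => linear_lt hW hx
  have c0 := cap_pos w
  have c1 := hln 1 (by omega)
  obtain ⟨cl, hcl⟩ : ∃ cl, ((List.range m).filter fun j => S ⊆ P j) = cl := ⟨_, rfl⟩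
  have hmem : ∀ x, x ∈ cl ↔ x < m ∧ S ⊆ P x := by simp [← hcl]
  have hnd : cl.Nodup := hcl ▸ List.nodup_range.filter _
  have hlen : cl.length ≤ m := length_le_of_nodup_of_lt hnd fun x hx => ((hmem x).1 hx).1
  rw [hcl] at h39 h22 ⊢
  refine Tr.seq_asg (by simpa using c0) ?_
  refine Tr.forr (cnt := cl.length) 80 (fun p s =>
      (∀ j, s.arr 21 j = if j ∈ cl.take p ∧ 1 ≤ j ∧ sepSet P j = S then 1 else σ.arr 21 j) ∧
      ∃ gl, Rows (N + 1) (s.arr 24) (s.arr 25) gl ∧ s.reg 43 ≤ p ∧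
        Grouping (sepRoot P (fun j => σ.arr 18 j - 1) S) (cl.take p) (s.arr 23) (s.reg 43) gl)
    (by omega) (by omega) (by omega) rfl rfl (by simpa using h39) (hln _ (by omega))
    ⟨by simp, gl₀, by simpa using hR, by simp, by simpa using Grouping.nil _ _ _⟩ ?_ ?_
  · rintro p s hp hF h44 ⟨h21, gl, hRs, hrp, hG⟩
    obtain ⟨j, hj⟩ : ∃ j, cl[p] = j := ⟨_, rfl⟩
    have hjcl : j ∈ cl := hj ▸ List.getElem_mem hp
    obtain ⟨hjm, hjS⟩ := (hmem j).1 hjcl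
    have hjnot : j ∉ cl.take p := hj ▸ getElem_notMem_take hnd hp
    have htake : cl.take (p + 1) = cl.take p ++ [j] := by rw [← hj, List.take_concat_get']
    have hmt : ∀ x, x ∈ cl.take p ↔ x < m ∧ S ⊆ P x ∧ x < j := by
      intro x; subst hcl; rw [mem_take_filter_range hp, hj]
    have s22 : s.arr 22 p = j := by rw [hF.arr 22 rfl, ← hj]; simpa using h22 p hp
    have s38 : s.reg 38 = S.card := by rw [hF.reg 38 (by omega) rfl]; simpa using h38
    have s17 : s.arr 17 j = (sepSet P j).card := by rw [hF.arr 17 rfl]; simpa using h17 j hjm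
    have s3 : s.reg 3 = N + 1 := by rw [hF.reg 3 (by omega) rfl]; simpa using h3
    have s18 : s.arr 18 = σ.arr 18 := by rw [hF.arr 18 rfl]; simp
    refine Tr.seq_asg (by simp) (Tr.seq_frame (tr_isRoot (p := p) (j := j) (S := S) c1 hpar
      (by rw [hcl]; exact hp) (by simp only [hcl]; exact hj) (by simpa using s38)
      (by simpa using s17) (by simpa using h44) (by simpa [h44] using s22)) ?_)
    rintro t₁ s₁ hF₁ ⟨ht₁, h46, h21₁⟩
    simp only [State.arr_setReg] at h21₁
    have q45 : s₁.reg 45 = j := by rw [hF₁.reg 45 (by omega) rfl]; simpa [h44] using s22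
    have q43 : s₁.reg 43 = s.reg 43 := by rw [hF₁.reg 43 (by omega) rfl]; simp
    have q3 : s₁.reg 3 = N + 1 := by rw [hF₁.reg 3 (by omega) rfl]; simpa using s3
    have q18 : s₁.arr 18 = σ.arr 18 := by rw [hF₁.arr 18 rfl]; simpa using s18
    have q23 : s₁.arr 23 = s.arr 23 := by rw [hF₁.arr 23 rfl]; simp
    have q24 : s₁.arr 24 = s.arr 24 := by rw [hF₁.arr 24 rfl]; simp
    have q25 : s₁.arr 25 = s.arr 25 := by rw [hF₁.arr 25 rfl]; simp
    have h21' : ∀ x, s₁.arr 21 x =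
        if x ∈ cl.take (p + 1) ∧ 1 ≤ x ∧ sepSet P x = S then 1 else σ.arr 21 x := by
      intro x
      rw [h21₁]
      simp only [mem_take_succ_iff hp, hj]
      by_cases hxj : x = j
      · subst hxj
        split_ifs with ha hb hb
        · simp
        · simp [ha] at hb
        · simp [ha] at hb
        · rw [h21]; simp [hjnot]
      · have : (if 1 ≤ j ∧ sepSet P j = S then Function.update (s.arr 21) j 1 else s.arr 21) x =
            s.arr 21 x := by split_ifs <;> simp [hxj]
        rw [this, h21]; simp [hxj]
    obtain ⟨r, hr⟩ : ∃ r, s.reg 43 = r := ⟨_, rfl⟩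
    rw [hr] at q43 hrp hG
    have hpl : (cl.take p).length ≤ p := by simp
    -- Intermediate state: the row g of j is recorded in array 23, but j has not yet been appended
    -- to it.
    refine Tr.seq_frame (R := fun t s₂ => t ≤ 20 ∧ s₂.reg 43 ≤ p + 1 ∧ ∃ g gl',
      s₂.arr 23 j = g ∧ g < s₂.reg 43 ∧ (gl' g).length ≤ p ∧
      Rows (N + 1) (s₂.arr 24) (s₂.arr 25) gl' ∧
      Grouping (sepRoot P (fun j => σ.arr 18 j - 1) S) (cl.take (p + 1)) (s₂.arr 23) (s₂.reg 43)
        (Function.update gl' g (gl' g ++ [j]))) ?_ ?_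
    · refine Tr.cnd (by simpa using c0) (fun h => ?_) (fun h => ?_)
      · have hss : S ⊂ sepSet P j := h46.1 (by simpa using h)
        obtain ⟨hlt, hsub⟩ := hpar j (one_le_of_ssubset_sepSet hss) hjm
        obtain ⟨y, hy⟩ : ∃ y, σ.arr 18 j - 1 = y := ⟨_, rfl⟩
        simp only [hy] at hlt hsub
        have hyc : y ∈ cl.take p := (hmt y).2 ⟨by omega, hss.1.trans hsub, hlt⟩
        have hroot := sepRoot_of_ssubset hpar hjm hss
        simp only [hy] at hroot
        have hcy := hG.lt y hyc
        have hy' : s₁.arr 18 j - 1 = y := by rw [q18, hy]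
        have f1 := hln y (by omega)
        refine Tr.sto (by simp) (by simp [*]) ⟨by simp, by simp [q43]; omega,
          s.arr 23 y, gl, ?_, ?_, ?_, ?_, ?_⟩
        · simp [q45, hy', q23]
        · simpa [q43] using hcy
        · exact le_trans (hG.length_le hcy) hpl
        · simpa [q24, q25] using hRs
        · rw [htake]
          simpa [q45, hy', q23, q43] using hG.member hjnot hyc hroot
      · have hss : ¬ S ⊂ sepSet P j := fun hh => by
          have := h46.2 hh
          simp [this] at h
        have hroot := sepRoot_of_not_ssubset (par := fun j => σ.arr 18 j - 1) hss
        have f1 := hln (r + 1) (by omega)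
        refine Tr.seq_sto (by simp) (by simp [*]) (Tr.seq_sto (by simp [*]) (by simp [*])
          (Tr.asg (by simp [*]) ⟨by simp, by simp [q43]; omega, r, Function.update gl r [], ?_, ?_, ?_,
            ?_, ?_⟩))
        · simp [q45, q43]
        · simp [q43]
        · simp
        · simpa [q24, q25, q43] using hRs.set_len (r := r) (k := 0) (by simp)
        · rw [htake]
          have := hG.head hjnot fun x hx => by
            obtain ⟨hxm, hxS, hxj⟩ := (hmt x).1 hx
            have := (subset_sepRoot hpar hxm hxS).1
            rw [hroot]; omega
          simpa [q45, q43, q23] using this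
    · rintro t₂ s₂ hF₂ ⟨ht₂, hr₂, g, gl', hg, hgr, hgl, hR₂, hG₂⟩
      have g45 : s₂.reg 45 = j := by rw [hF₂.reg 45 (by omega) rfl, q45]
      have g3 : s₂.reg 3 = N + 1 := by rw [hF₂.reg 3 (by omega) rfl, q3]
      have g21 : s₂.arr 21 = s₁.arr 21 := by rw [hF₂.arr 21 rfl]
      have hle := hR₂.len_eq g
      have f1 := row_mul_lt hW (show g ≤ N by omega)
      have f2 := row_index_lt (c := s₂.arr 25 g) hW (show g ≤ N by omega) (by omega)
      have f3 := hln (s₂.arr 25 g + 1) (by omega)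
      have hpush := hR₂.push (r := g) (x := j) (by omega)
      clear hle
      refine Tr.seq_asg (by simp) (Tr.seq_sto (by simp [*]) (by simp [*]) (Tr.sto (by simp [*])
        (by simp [*]) ⟨by simp; omega, ?_, ?_⟩))
      · intro x; simpa [g21] using h21' x
      · refine ⟨Function.update gl' g (gl' g ++ [j]), ?_, ?_, ?_⟩
        · simpa [g45, g3, hg] using hpush
        · simpa using hr₂
        · simpa using hG₂
  · rintro s hF h44 ⟨h21, gl, hRs, hrp, hG⟩ t ht
    rw [List.take_length] at h21 hG
    exact ⟨by simp; omega, h21, gl, hRs, by omega, hG⟩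

end WordRAM

namespace WordRAM

/-! ### Pairs from different groups -/

/-- The first `r` lists, one after the other. -/
def flat (gl : ℕ → List ℕ) : ℕ → List ℕ
  | 0 => []
  | g + 1 => flat gl g ++ gl g

/-- The pairs whose members come from different ones of the first `r` lists. -/
def cross (gl : ℕ → List ℕ) : ℕ → List (ℕ × ℕ)
  | 0 => []
  | g + 1 => cross gl g ++ (gl g).flatMap fun x => (flat gl g).map fun y => (y, x)

section

variable {gl : ℕ → List ℕ} {r : ℕ}

theorem mem_flat {a : ℕ} : a ∈ flat gl r ↔ ∃ g < r, a ∈ gl g := by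
  induction r with
  | zero => simp [flat]
  | succ r ih =>
    rw [flat, List.mem_append, ih]
    constructor
    · rintro (⟨g, hg, ha⟩ | ha)
      · exact ⟨g, by omega, ha⟩
      · exact ⟨r, by omega, ha⟩
    · rintro ⟨g, hg, ha⟩
      rcases Nat.lt_succ_iff_lt_or_eq.1 hg with hg | rfl
      · exact Or.inl ⟨g, hg, ha⟩
      · exact Or.inr ha

theorem mem_cross {a b : ℕ} :
    (a, b) ∈ cross gl r ↔ ∃ g' g, g' < g ∧ g < r ∧ a ∈ gl g' ∧ b ∈ gl g := by
  induction r with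
  | zero => simp [cross]
  | succ r ih =>
    rw [cross, List.mem_append, ih]
    simp only [List.mem_flatMap, List.mem_map, mem_flat, Prod.mk.injEq]
    constructor
    · rintro (⟨g', g, h1, h2, h3⟩ | ⟨x, hx, y, ⟨g', hg', hy⟩, rfl, rfl⟩)
      · exact ⟨g', g, h1, by omega, h3⟩
      · exact ⟨g', r, hg', by omega, hy, hx⟩
    · rintro ⟨g', g, h1, h2, h3, h4⟩
      rcases Nat.lt_succ_iff_lt_or_eq.1 h2 with hg | rfl
      · exact Or.inl ⟨g', g, h1, hg, h3, h4⟩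
      · exact Or.inr ⟨b, h4, a, ⟨g', h1, h3⟩, rfl, rfl⟩

theorem length_cross_succ (gl : ℕ → List ℕ) (g : ℕ) :
    (cross gl (g + 1)).length = (cross gl g).length + (gl g).length * (flat gl g).length := by
  simp [cross, List.length_flatMap]

theorem length_cross_mono {g : ℕ} (h : g ≤ r) : (cross gl g).length ≤ (cross gl r).length := by
  induction r, h using Nat.le_induction with
  | base => exact le_rfl
  | succ r _ ih => rw [length_cross_succ]; omega

theorem length_flat_mono {g : ℕ} (h : g ≤ r) : (flat gl g).length ≤ (flat gl r).length := by
  induction r, h using Nat.le_induction with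
  | base => exact le_rfl
  | succ r _ ih => rw [flat, List.length_append]; omega

theorem le_length_flat (hne : ∀ g < r, gl g ≠ []) : r ≤ (flat gl r).length := by
  induction r with
  | zero => simp
  | succ r ih =>
    rw [flat, List.length_append]
    have := ih fun g hg => hne g (by omega)
    have := List.length_pos_iff.2 (hne r (by omega))
    omega

/-- The charging argument: with at least two classes, the number of hyperedges sorted is at most
twice the number of pairs written. For two classes this is a + b ≤ 2ab; each further class of size c
adds at least c pairs. -/
theorem length_flat_le (h2 : 2 ≤ r) (hne : ∀ g < r, gl g ≠ []) :
    (flat gl r).length ≤ 2 * (cross gl r).length := by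
  induction r, h2 using Nat.le_induction with
  | base =>
    have h0 := List.length_pos_iff.2 (hne 0 (by omega))
    have h1 := List.length_pos_iff.2 (hne 1 (by omega))
    rw [length_cross_succ]
    simp only [flat, List.length_append, List.length_nil]
    nlinarith
  | succ r hr ih =>
    have h0 := ih fun g hg => hne g (by omega)
    have h1 := le_length_flat fun g (hg : g < r) => hne g (by omega)
    rw [length_cross_succ]
    simp only [flat, List.length_append]
    nlinarith [Nat.mul_le_mul_left (gl r).length (show 1 ≤ (flat gl r).length by omega)]

theorem nodup_flat (hnd : ∀ g < r, (gl g).Nodup)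
    (hdis : ∀ g < r, ∀ g' < r, ∀ x, x ∈ gl g → x ∈ gl g' → g = g') : (flat gl r).Nodup := by
  induction r with
  | zero => simp [flat]
  | succ r ih =>
    rw [flat, List.nodup_append']
    refine ⟨ih (fun g hg => hnd g (by omega))
      (fun g hg g' hg' => hdis g (by omega) g' (by omega)), hnd r (by omega), fun x hx hx' => ?_⟩
    obtain ⟨g, hg, hxg⟩ := mem_flat.1 hx
    have := hdis g (by omega) r (by omega) x hxg hx'
    omega

/-- The second member of a pair comes from the later row, which is disjoint from all rows before it.
So a pair occurs neither twice nor in both orientations. -/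
theorem nodup_cross (hnd : ∀ g < r, (gl g).Nodup)
    (hdis : ∀ g < r, ∀ g' < r, ∀ x, x ∈ gl g → x ∈ gl g' → g = g') :
    ((cross gl r).map fun p => s(p.1, p.2)).Nodup := by
  induction r with
  | zero => simp [cross]
  | succ r ih =>
    have hfl : ∀ x ∈ gl r, x ∉ flat gl r := by
      intro x hx hx'
      obtain ⟨g, hg, hxg⟩ := mem_flat.1 hx'
      have := hdis g (by omega) r (by omega) x hxg hx
      omega
    rw [cross, List.map_append, List.nodup_append']
    refine ⟨ih (fun g hg => hnd g (by omega))
      (fun g hg g' hg' => hdis g (by omega) g' (by omega)), ?_, ?_⟩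
    · refine List.Nodup.map_on ?_ ?_
      · rintro ⟨a, b⟩ hab ⟨c, d⟩ hcd h
        simp only [List.mem_flatMap, List.mem_map, Prod.mk.injEq] at hab hcd
        obtain ⟨x, hx, y, hy, rfl, rfl⟩ := hab
        obtain ⟨x', hx', y', hy', rfl, rfl⟩ := hcd
        simp only [Sym2.eq_iff] at h
        rcases h with ⟨rfl, rfl⟩ | ⟨h, -⟩
        · rfl
        · exact absurd (h ▸ hy) (hfl _ hx')
      · rw [List.nodup_flatMap]
        refine ⟨fun x _ => ?_, ?_⟩
        · exact (nodup_flat (fun g hg => hnd g (by omega))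
            (fun g hg g' hg' => hdis g (by omega) g' (by omega))).map
            fun a b h => (Prod.mk.inj h).1
        · refine (hnd r (by omega)).imp fun {x x'} hne => ?_
          intro p hp hp'
          simp only [List.mem_map] at hp hp'
          obtain ⟨y, -, rfl⟩ := hp
          obtain ⟨y', -, h⟩ := hp'
          exact hne (Prod.mk.inj h).2.symm
    · intro z hz hz'
      simp only [List.mem_map, List.mem_flatMap] at hz hz'
      obtain ⟨⟨a, b⟩, hab, rfl⟩ := hz
      obtain ⟨p, ⟨x, hx, y, hy, rfl⟩, h⟩ := hz'
      obtain ⟨g', g, h1, h2, ha, hb⟩ := mem_cross.1 hab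
      simp only [Sym2.eq_iff] at h
      rcases h with ⟨-, h⟩ | ⟨-, h⟩
      · exact hfl x hx (mem_flat.2 ⟨g, h2, h ▸ hb⟩)
      · exact hfl x hx (mem_flat.2 ⟨g', by omega, h ▸ ha⟩)

end

/-- From cell `2` on, `A` holds the images under `f` of the pairs in `out`. -/
def PairsAt (A f : ℕ → ℕ) (out : List (ℕ × ℕ)) : Prop :=
  ∀ q (h : q < out.length), A (2 + 2 * q) = f out[q].1 ∧ A (3 + 2 * q) = f out[q].2

theorem PairsAt.push {A f : ℕ → ℕ} {out : List (ℕ × ℕ)} (h : PairsAt A f out) (a b : ℕ) :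
    PairsAt (Function.update (Function.update A (2 + 2 * out.length) (f a))
      (3 + 2 * out.length) (f b)) f (out ++ [(a, b)]) := by
  intro q hq
  by_cases hql : q = out.length
  · subst hql
    rw [Function.update_of_ne (by omega), Function.update_self, Function.update_self]
    simp
  · have hq' : q < out.length := by simp at hq; omega
    rw [Function.update_of_ne (by omega), Function.update_of_ne (by omega),
      Function.update_of_ne (by omega), Function.update_of_ne (by omega),
      List.getElem_append_left hq']
    exact h q hq'

/-- Output the pairs of positions from different rows of array `24`. -/
def emit : Prog :=
  asg 48 (.lit 0) ⨾
  forr 49 43 (asg 50 (.reg 48) ⨾ asg 51 (.load 25 (.reg 49)) ⨾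
    forr 52 51 (asg 53 (.load 24 (.reg 49 * .reg 3 + .reg 52)) ⨾
      forr 54 50 (sto 1 (.lit 2 + .lit 2 * .reg 55) (.load 14 (.load 26 (.reg 54))) ⨾
        sto 1 (.lit 3 + .lit 2 * .reg 55) (.load 14 (.reg 53)) ⨾ asg 55 (.reg 55 + .lit 1)) ⨾
      sto 26 (.reg 48) (.reg 53) ⨾ asg 48 (.reg 48 + .lit 1)))

/-- Array 26 accumulates the rows already passed. Its length is frozen in register 50 when a row
begins, so members of the same row are not paired although they are appended meanwhile. -/
theorem tr_emit {w N r : ℕ} {σ : State} {gl : ℕ → List ℕ} {out : List (ℕ × ℕ)}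
    (hW : 16 * (N + 3) ^ 2 < cap w) (hr : r ≤ N) (h3 : σ.reg 3 = N + 1) (h43 : σ.reg 43 = r)
    (hR : Rows (N + 1) (σ.arr 24) (σ.arr 25) gl) (hfl : (flat gl r).length ≤ N)
    (h55 : σ.reg 55 = out.length) (hout : PairsAt (σ.arr 1) (σ.arr 14) out)
    (hlen : out.length + (cross gl r).length ≤ N * N) :
    Tr w emit σ fun t s => t ≤ 60 * (r + (flat gl r).length + (cross gl r).length) + 10 ∧
      s.reg 55 = (out ++ cross gl r).length ∧
      PairsAt (s.arr 1) (σ.arr 14) (out ++ cross gl r) := by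
  have hln : ∀ x ≤ 96 * N + 144, x < cap w := fun x hx => linear_lt hW hx
  have hln2 : ∀ x ≤ N * N, 3 + 2 * x < cap w ∧ 2 + 2 * x < cap w ∧ 2 * x < cap w ∧ x < cap w := by
    intro x hx
    have : 3 + 2 * x < cap w := by nlinarith
    omega
  have c0 := cap_pos w
  have c1 := hln 1 (by omega)
  have c2 := hln 2 (by omega)
  have c3 := hln 3 (by omega)
  refine Tr.seq_asg (by simpa using c0) ?_
  refine Tr.forr' (cnt := r) (fun g τ s =>
    τ ≤ 60 * (g + (flat gl g).length + (cross gl g).length) ∧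
    s.reg 48 = (flat gl g).length ∧ Starts (s.arr 26) (flat gl g) ∧
    s.reg 55 = (out ++ cross gl g).length ∧ PairsAt (s.arr 1) (σ.arr 14) (out ++ cross gl g))
    (by omega) (by omega) (by omega) rfl rfl (by simpa using h43) (hln _ (by omega))
    ⟨by simp, by simp [flat], by simpa [flat] using Starts.nil _, by simp [cross, h55],
      by simpa [cross] using hout⟩ ?_ ?_
  · rintro g τ s hg hF h49 ⟨hτ, h48, h26, h55s, h1⟩
    have s3 : s.reg 3 = N + 1 := by rw [hF.reg 3 (by omega) rfl]; simpa using h3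
    have sR : Rows (N + 1) (s.arr 24) (s.arr 25) gl := by
      rw [hF.arr 24 rfl, hF.arr 25 rfl]; simpa using hR
    have s14 : s.arr 14 = σ.arr 14 := by rw [hF.arr 14 rfl]; simp
    have hF1 := length_flat_mono (gl := gl) (show g + 1 ≤ r from hg)
    have hC1 := length_cross_mono (gl := gl) (show g + 1 ≤ r from hg)
    rw [length_cross_succ] at hC1
    rw [flat, List.length_append] at hF1
    obtain ⟨F, hFe⟩ : ∃ F, flat gl g = F := ⟨_, rfl⟩
    obtain ⟨O, hOe⟩ : ∃ O, out ++ cross gl g = O := ⟨_, rfl⟩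
    have hOl : O.length = out.length + (cross gl g).length := by rw [← hOe]; simp
    rw [length_cross_succ, flat, cross, ← List.append_assoc, hFe, hOe]
    rw [hFe] at h48 h26 hF1 hC1 hτ
    rw [hOe] at h55s h1
    refine Tr.seq_asg (by simp) (Tr.seq_asg (by simp) ?_)
    refine Tr.forr (cnt := (gl g).length) (F.length * (25 + 7) + 40) (fun y s' =>
      s'.reg 48 = (F ++ (gl g).take y).length ∧ Starts (s'.arr 26) (F ++ (gl g).take y) ∧
      s'.reg 55 = (O ++ ((gl g).take y).flatMap fun x => F.map fun z => (z, x)).length ∧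
      PairsAt (s'.arr 1) (σ.arr 14) (O ++ ((gl g).take y).flatMap fun x => F.map fun z => (z, x)))
      (by omega) (by omega) (by omega) rfl rfl (by simpa [h49] using sR.len_eq g)
      (hln _ (by omega)) ⟨by simpa using h48, by simpa using h26, by simpa using h55s,
        by simpa using h1⟩ ?_ ?_
    · rintro y s₁ hy hF₁ h52 ⟨g48, g26, g55, g1⟩
      obtain ⟨x, hx⟩ : ∃ x, (gl g)[y] = x := ⟨_, rfl⟩
      have htake : (gl g).take (y + 1) = (gl g).take y ++ [x] := by rw [← hx, List.take_concat_get']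
      obtain ⟨O₁, hO₁⟩ : ∃ O₁, (O ++ ((gl g).take y).flatMap fun x => F.map fun z => (z, x)) = O₁ :=
        ⟨_, rfl⟩
      have hO₁l : O₁.length = O.length + y * F.length := by
        rw [← hO₁, List.length_append]
        simp [List.length_flatMap, hy.le]
      obtain ⟨F₁, hF₁e⟩ : ∃ F₁, F ++ (gl g).take y = F₁ := ⟨_, rfl⟩
      have hF₁l : F₁.length = F.length + y := by rw [← hF₁e]; simp [hy.le]
      have hyF : (y + 1) * F.length ≤ (gl g).length * F.length := Nat.mul_le_mul_right _ hy
      rw [add_mul, one_mul] at hyF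
      rw [hO₁] at g55 g1
      rw [hF₁e] at g48 g26
      rw [htake, List.flatMap_append, ← List.append_assoc, ← List.append_assoc, hO₁, hF₁e]
      simp only [List.flatMap_cons, List.flatMap_nil, List.append_nil]
      have q3 : s₁.reg 3 = N + 1 := by rw [hF₁.reg 3 (by omega) rfl]; simpa using s3
      have q49 : s₁.reg 49 = g := by rw [hF₁.reg 49 (by omega) rfl]; simpa using h49
      have q50 : s₁.reg 50 = F.length := by rw [hF₁.reg 50 (by omega) rfl]; simpa using h48
      have q24 : s₁.arr 24 (g * (N + 1) + y) = x := by
        rw [hF₁.arr 24 rfl, ← hx]; simpa using sR.get g y hy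
      have q14 : s₁.arr 14 = σ.arr 14 := by rw [hF₁.arr 14 rfl]; simpa using s14
      have f1 := row_mul_lt hW (show g ≤ N by omega)
      have f2 := row_index_lt (c := y) hW (show g ≤ N by omega) (by omega)
      refine Tr.seq_asg (by simp [*]) (Tr.seq_frame (R := fun t s₂ =>
        t ≤ F.length * (25 + 7) + 5 ∧ s₂.reg 55 = (O₁ ++ F.map fun z => (z, x)).length ∧
        PairsAt (s₂.arr 1) (σ.arr 14) (O₁ ++ F.map fun z => (z, x))) ?_ ?_)
      · refine Tr.forr (cnt := F.length) 25 (fun h s' =>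
          s'.reg 55 = (O₁ ++ (F.take h).map fun z => (z, x)).length ∧
          PairsAt (s'.arr 1) (σ.arr 14) (O₁ ++ (F.take h).map fun z => (z, x)))
          (by omega) (by omega) (by omega) rfl rfl (by simpa using q50) (hln _ (by omega))
          ⟨by simpa using g55, by simpa using g1⟩ ?_ ?_
        · rintro h s₂ hh hF₂ h54 ⟨u55, u1⟩
          obtain ⟨z, hz⟩ : ∃ z, F[h] = z := ⟨_, rfl⟩
          have htk : F.take (h + 1) = F.take h ++ [z] := by rw [← hz, List.take_concat_get']
          obtain ⟨O₂, hO₂⟩ : ∃ O₂, (O₁ ++ (F.take h).map fun z => (z, x)) = O₂ := ⟨_, rfl⟩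
          have hO₂l : O₂.length = O₁.length + h := by rw [← hO₂]; simp [hh.le]
          rw [hO₂] at u55 u1
          rw [htk, List.map_append, ← List.append_assoc, hO₂]
          have v53 : s₂.reg 53 = x := by
            rw [hF₂.reg 53 (by omega) rfl]; simpa [q49, q3, h52] using q24
          have v14 : s₂.arr 14 = σ.arr 14 := by rw [hF₂.arr 14 rfl]; simpa using q14
          have v26 : s₂.arr 26 h = z := by
            have := g26 h (by omega)
            rw [hF₂.arr 26 rfl]
            simp only [State.arr_setReg, this, ← hF₁e, ← hz]
            rw [List.getElem_append_left]
          obtain ⟨d1, d2, d3, d4⟩ := hln2 O₂.length (by omega)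
          have d5 := (hln2 (O₂.length + 1) (by omega)).2.2.2
          clear hO₂l
          refine Tr.seq_sto (by simp [*]) (by simp [*]) (Tr.seq_sto (by simp [*]) (by simp [*])
            (Tr.asg (by simp [*]) ⟨by simp, by simp [u55], ?_⟩))
          simpa [u55, v53, v14, v26, h54] using u1.push z x
        · rintro s₂ hF₂ h54 ⟨u55, u1⟩ t ht
          rw [List.take_length] at u55 u1
          exact ⟨by omega, u55, u1⟩
      · rintro t₂ s₂ hF₂ ⟨ht₂, u55, u1⟩
        have v53 : s₂.reg 53 = x := by
          rw [hF₂.reg 53 (by omega) rfl]; simpa [q49, q3, h52] using q24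
        have v48 : s₂.reg 48 = F₁.length := by rw [hF₂.reg 48 (by omega) rfl]; simpa using g48
        have v26 : Starts (s₂.arr 26) F₁ := by rw [hF₂.arr 26 rfl]; simpa using g26
        have d1 := hln (F₁.length + 1) (by omega)
        clear hF₁l
        refine Tr.seq_sto (by simp) (by simp) (Tr.asg (by simp [*]) ⟨?_, ?_, ?_, ?_, ?_⟩)
        · simp; omega
        · simp [v48]
        · simpa [v48, v53] using v26.push x
        · simpa using u55
        · simpa using u1
    · rintro s₁ hF₁ h52 ⟨g48, g26, g55, g1⟩ t ht
      rw [List.take_length] at g48 g26 g55 g1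
      refine ⟨?_, by simpa using g48, by simpa using g26, by simpa using g55, by simpa using g1⟩
      have e1 : (gl g).length * (F.length * (25 + 7) + 40 + 7) =
        32 * ((gl g).length * F.length) + 47 * (gl g).length := by ring
      simp only [List.length_append, Expr.cost_reg, Expr.cost_load]
      omega
  · rintro τ s hF h49 ⟨hτ, h48, h26, h55s, h1⟩
    exact ⟨by simp; omega, h55s, h1⟩

end WordRAM

namespace WordRAM

/-! ### Enumerating the edges -/

/-- The list contains, in one orientation, each unordered pair satisfying `R` exactly once. -/
def Lists (R : ℕ → ℕ → Prop) (l : List (ℕ × ℕ)) : Prop :=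
  (l.map fun p => s(p.1, p.2)).Nodup ∧ ∀ a b, s(a, b) ∈ l.map (fun p => s(p.1, p.2)) ↔ R a b

theorem Lists.congr {R R' : ℕ → ℕ → Prop} {l : List (ℕ × ℕ)} (h : Lists R l)
    (hR : ∀ a b, R a b ↔ R' a b) : Lists R' l :=
  ⟨h.1, fun a b => (h.2 a b).trans (hR a b)⟩

theorem Lists.append {R R' : ℕ → ℕ → Prop} {l l' : List (ℕ × ℕ)} (h : Lists R l)
    (h' : Lists R' l') (hd : ∀ a b, R a b → ¬ R' a b) :
    Lists (fun a b => R a b ∨ R' a b) (l ++ l') := by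
  refine ⟨?_, fun a b => ?_⟩
  · rw [List.map_append, List.nodup_append']
    refine ⟨h.1, h'.1, fun z => ?_⟩
    induction z with
    | _ a b => exact fun hz hz' => hd a b ((h.2 a b).1 hz) ((h'.2 a b).1 hz')
  · rw [List.map_append, List.mem_append, h.2, h'.2]

theorem Lists.length_le {R : ℕ → ℕ → Prop} {l : List (ℕ × ℕ)} {m : ℕ} (h : Lists R l)
    (hR : ∀ a b, R a b → a < m ∧ b < m) : l.length ≤ m * m := by
  have hnd : l.Nodup := h.1.of_map _
  rw [← List.toFinset_card_of_nodup hnd]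
  refine le_trans (Finset.card_le_card (t := Finset.range m ×ˢ Finset.range m) ?_) (by simp)
  rintro ⟨a, b⟩ hp
  have := hR a b ((h.2 a b).1 (List.mem_map_of_mem (f := fun p : ℕ × ℕ => s(p.1, p.2))
    (List.mem_toFinset.1 hp)))
  simpa using this

section

variable {P : ℕ → Finset ℕ} {par comp : ℕ → ℕ} {S : Finset ℕ} {m r : ℕ} {gl : ℕ → List ℕ}

/-- Rows are the classes of equal roots, so lying in different rows means being split; the row
numbers fix the orientation. -/
theorem Grouping.lists_cross (h : Grouping (sepRoot P par S)
    ((List.range m).filter fun j => S ⊆ P j) comp r gl) :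
    Lists (fun a b => a < m ∧ b < m ∧ Splits P par S a b) (cross gl r) := by
  have hmem : ∀ x, x ∈ (List.range m).filter (fun j => S ⊆ P j) ↔ x < m ∧ S ⊆ P x := by simp
  refine ⟨nodup_cross h.nodup fun g hg g' hg' x hx hx' => ?_, fun a b => ?_⟩
  · rw [← ((h.mem g hg x).1 hx).2, ← ((h.mem g' hg' x).1 hx').2]
  · have h1 : s(a, b) ∈ (cross gl r).map (fun p => s(p.1, p.2)) ↔
        (a, b) ∈ cross gl r ∨ (b, a) ∈ cross gl r := by
      rw [List.mem_map]
      constructor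
      · rintro ⟨⟨c, d⟩, hcd, heq⟩
        simp only [Sym2.eq_iff] at heq
        rcases heq with ⟨rfl, rfl⟩ | ⟨rfl, rfl⟩
        · exact Or.inl hcd
        · exact Or.inr hcd
      · rintro (h | h)
        · exact ⟨_, h, rfl⟩
        · exact ⟨_, h, Sym2.eq_swap⟩
    rw [h1, mem_cross, mem_cross]
    have key : ∀ a b g' g, g' < g → g < r → a ∈ gl g' → b ∈ gl g →
        a < m ∧ b < m ∧ Splits P par S a b := by
      intro a b g' g hlt hg ha hb
      obtain ⟨ha1, ha2⟩ := (h.mem g' (by omega) a).1 ha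
      obtain ⟨hb1, hb2⟩ := (h.mem g hg b).1 hb
      refine ⟨((hmem a).1 ha1).1, ((hmem b).1 hb1).1, ((hmem a).1 ha1).2, ((hmem b).1 hb1).2, ?_⟩
      rw [Ne, ← h.comp_eq a ha1 b hb1]
      omega
    constructor
    · rintro (⟨g', g, hlt, hg, ha, hb⟩ | ⟨g', g, hlt, hg, hb, ha⟩)
      · exact key a b g' g hlt hg ha hb
      · obtain ⟨h1, h2, h3⟩ := key b a g' g hlt hg hb ha
        exact ⟨h2, h1, h3.symm⟩
    · rintro ⟨ha, hb, hSa, hSb, hne⟩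
      have ha1 := (hmem a).2 ⟨ha, hSa⟩
      have hb1 := (hmem b).2 ⟨hb, hSb⟩
      rw [Ne, ← h.comp_eq a ha1 b hb1] at hne
      have hal := h.lt a ha1
      have hbl := h.lt b hb1
      have hga := (h.mem _ hal a).2 ⟨ha1, rfl⟩
      have hgb := (h.mem _ hbl b).2 ⟨hb1, rfl⟩
      rcases Nat.lt_or_gt_of_ne hne with hlt | hlt
      · exact Or.inl ⟨_, _, hlt, hbl, hga, hgb⟩
      · exact Or.inr ⟨_, _, hlt, hal, hgb, hga⟩

theorem Grouping.length_flat {root : ℕ → ℕ} {c : List ℕ} (h : Grouping root c comp r gl)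
    (hc : c.Nodup) : (flat gl r).length = c.length := by
  have hfl : (flat gl r).Nodup := nodup_flat h.nodup fun g hg g' hg' x hx hx' => by
    rw [← ((h.mem g hg x).1 hx).2, ← ((h.mem g' hg' x).1 hx').2]
  refine ((List.perm_ext_iff_of_nodup hfl hc).2 fun x => ?_).length_eq
  rw [mem_flat]
  constructor
  · rintro ⟨g, hg, hx⟩
    exact ((h.mem g hg x).1 hx).1
  · exact fun hx => ⟨comp x, h.lt x hx, (h.mem _ (h.lt x hx) x).2 ⟨hx, rfl⟩⟩

/-- Position i is its own root, whereas its parent also contains S and has an earlier root. Thus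
`length_flat_le` applies to every separator that is processed. -/
theorem Grouping.two_le {i : ℕ} (hpar : IsParentMap P par m) (h1 : 1 ≤ i) (hi : i < m)
    (h : Grouping (sepRoot P par (sepSet P i))
      ((List.range m).filter fun j => sepSet P i ⊆ P j) comp r gl) : 2 ≤ r := by
  have hmem : ∀ x, x ∈ (List.range m).filter (fun j => sepSet P i ⊆ P j) ↔
    x < m ∧ sepSet P i ⊆ P x := by simp
  obtain ⟨hlt, hsub⟩ := hpar i h1 hi
  have hi' := (hmem i).2 ⟨hi, sepSet_subset i⟩
  have hp' := (hmem (par i)).2 ⟨by omega, hsub⟩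
  have hroot : sepRoot P par (sepSet P i) i = i := sepRoot_of_not_ssubset (ssubset_irrefl _)
  have hle := (subset_sepRoot hpar (by omega : par i < m) hsub).1
  have hne : comp i ≠ comp (par i) := by
    rw [Ne, h.comp_eq i hi' _ hp', hroot]
    omega
  have := h.lt i hi'
  have := h.lt _ hp'
  omega

end

/-- The tables that the enumeration uses. -/
structure Prepared (N m k : ℕ) (P : ℕ → Finset ℕ) (sl : ℕ → List ℕ) (f pa : ℕ → ℕ) (s : State) :
    Prop where
  reg_one : s.reg 1 = m
  reg_width : s.reg 3 = N + 1
  reg_block : s.reg 4 = k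
  reg_pow : s.reg 5 = 2 ^ k
  reg_blocks : s.reg 36 = m / k + 1
  order : s.arr 14 = f
  parent : s.arr 18 = pa
  rows : Rows (N + 1) (s.arr 16) (s.arr 17) sl
  and_table : ∀ x < 2 ^ k, ∀ y < 2 ^ k, s.arr 6 (x * 2 ^ k + y) = x &&& y
  bit_table : ∀ x < 2 ^ k, x ≠ 0 → x.bitIndices = s.arr 7 x :: (s.arr 8 x).bitIndices ∧
    s.arr 8 x < x
  all_mask : ∀ b ≤ N, IsMask k b (· < m) (s.arr 20 b)
  vertex_mask : ∀ v ≤ N, ∀ b ≤ N, IsMask k b (fun j => j < m ∧ v ∈ P j)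
    (s.arr 19 (v * (N + 1) + b))

theorem Prepared.of_eq {N m k : ℕ} {P : ℕ → Finset ℕ} {sl : ℕ → List ℕ} {f pa : ℕ → ℕ}
    {σ s : State} (h : Prepared N m k P sl f pa σ) (hr : ∀ r ∈ [1, 3, 4, 5, 36], s.reg r = σ.reg r)
    (ha : ∀ a ∈ [6, 7, 8, 14, 16, 17, 18, 19, 20], s.arr a = σ.arr a) :
    Prepared N m k P sl f pa s := by
  refine ⟨?_, ?_, ?_, ?_, ?_, ?_, ?_, ?_, ?_, ?_, ?_, ?_⟩
  · rw [hr 1 (by simp), h.reg_one]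
  · rw [hr 3 (by simp), h.reg_width]
  · rw [hr 4 (by simp), h.reg_block]
  · rw [hr 5 (by simp), h.reg_pow]
  · rw [hr 36 (by simp), h.reg_blocks]
  · rw [ha 14 (by simp), h.order]
  · rw [ha 18 (by simp), h.parent]
  · rw [ha 16 (by simp), ha 17 (by simp)]; exact h.rows
  · rw [ha 6 (by simp)]; exact h.and_table
  · rw [ha 7 (by simp), ha 8 (by simp)]; exact h.bit_table
  · rw [ha 20 (by simp)]; exact h.all_mask
  · rw [ha 19 (by simp)]; exact h.vertex_mask

theorem Prepared.of_frame {N m k : ℕ} {P : ℕ → Finset ℕ} {sl : ℕ → List ℕ} {f pa : ℕ → ℕ}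
    {σ s : State} {p : Prog} (h : Prepared N m k P sl f pa σ) (hF : Frame p σ s)
    (hr : ([1, 3, 4, 5, 36].all fun r => !p.writesReg r) = true)
    (ha : ([6, 7, 8, 14, 16, 17, 18, 19, 20].all fun a => !p.writesArr a) = true) :
    Prepared N m k P sl f pa s := by
  rw [List.all_eq_true] at hr ha
  refine h.of_eq (fun r hm => hF.reg r ?_ (by simpa using hr r hm))
    (fun a hm => hF.arr a (by simpa using ha a hm))
  simp only [List.mem_cons, List.not_mem_nil, or_false] at hm
  omega

/-- Output the pairs split by the separator of the position in register `37`. -/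
def splitPairs : Prog := collect ⨾ group ⨾ emit

/-- Only the collection of masks has a cost depending on |S|. The rest is linear in the positions
found, hence in the number of new pairs. -/
theorem tr_splitPairs {w N m k i : ℕ} {σ : State} {P : ℕ → Finset ℕ} {sl gl₀ : ℕ → List ℕ}
    {f pa : ℕ → ℕ} {out : List (ℕ × ℕ)} {R : ℕ → ℕ → Prop}
    (hW : 16 * (N + 3) ^ 2 < cap w) (hm : m ≤ N) (h1 : 1 ≤ i) (hi : i < m)
    (hk : 1 ≤ k) (hkN : 2 ^ k * 2 ^ k ≤ N + 4)
    (hsl : ∀ j < m, (sl j).Nodup ∧ (sl j).toFinset = sepSet P j) (hPN : ∀ j, ∀ v ∈ P j, v ≤ N)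
    (hlen : (sepSet P i).card ≤ N) (hpar : IsParentMap P (fun j => pa j - 1) m)
    (hp : Prepared N m k P sl f pa σ) (h37 : σ.reg 37 = i)
    (hR : Rows (N + 1) (σ.arr 24) (σ.arr 25) gl₀)
    (h55 : σ.reg 55 = out.length) (hpairs : PairsAt (σ.arr 1) f out) (hout : Lists R out)
    (hRlt : ∀ a b, R a b → a < m ∧ b < m)
    (hRS : ∀ a b, R a b → ¬ Splits P (fun j => pa j - 1) (sepSet P i) a b) :
    Tr w splitPairs σ fun t s => ∃ new gl,
      t ≤ (m / k + 1) * (40 * (sepSet P i).card + 60) + 600 * new.length + 60 ∧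
      Rows (N + 1) (s.arr 24) (s.arr 25) gl ∧
      (∀ j < m, s.arr 21 j = if 1 ≤ j ∧ sepSet P j = sepSet P i then 1 else σ.arr 21 j) ∧
      s.reg 55 = (out ++ new).length ∧ PairsAt (s.arr 1) f (out ++ new) ∧
      Lists (fun a b => R a b ∨ a < m ∧ b < m ∧ Splits P (fun j => pa j - 1) (sepSet P i) a b)
        (out ++ new) := by
  obtain ⟨hsi, hsf⟩ := hsl i hi
  have hslen : (sl i).length = (sepSet P i).card := by
    rw [← hsf, List.toFinset_card_of_nodup hsi]
  obtain ⟨cl, hcl⟩ : ∃ cl, ((List.range m).filter fun j => sepSet P i ⊆ P j) = cl := ⟨_, rfl⟩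
  have hmem : ∀ x, x ∈ cl ↔ x < m ∧ sepSet P i ⊆ P x := by simp [← hcl]
  have hnd : cl.Nodup := hcl ▸ List.nodup_range.filter _
  have hclm : cl.length ≤ m := length_le_of_nodup_of_lt hnd fun x hx => ((hmem x).1 hx).1
  refine Tr.seq_frame (tr_collect (sl := sl) (P := P) hW hm hi hp.reg_width hp.reg_block hp.reg_pow
    hp.reg_blocks h37 hk hkN hp.rows ?_ (by omega) hp.and_table hp.bit_table hp.all_mask
    hp.vertex_mask) ?_
  · intro v hv
    rw [← List.mem_toFinset, hsf] at hv
    exact hPN i v (sepSet_subset i hv)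
  rintro t₁ s₁ hF₁ ⟨ht₁, h38₁, h39₁, h22₁⟩
  rw [hsf, hcl] at ht₁ h39₁ h22₁
  rw [hslen] at ht₁
  have hp₁ := hp.of_frame hF₁ rfl rfl
  have q18 : s₁.arr 18 = pa := hp₁.parent
  refine Tr.seq_frame (tr_group (P := P) (S := sepSet P i) (gl₀ := gl₀) hW hm
    (by simpa only [q18] using hpar) hp₁.reg_width (by rw [h38₁, hslen])
    (by rw [h39₁, hcl]) (fun j hj => ?_) (by rw [hcl]; exact h22₁) ?_) ?_
  · rw [hp₁.rows.len_eq, ← (hsl j hj).2, List.toFinset_card_of_nodup (hsl j hj).1]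
  · rw [hF₁.arr 24 rfl, hF₁.arr 25 rfl]; exact hR
  rintro t₂ s₂ hF₂ ⟨ht₂, h21₂, gl, hR₂, hrm, hG⟩
  have hp₂ := hp₁.of_frame hF₂ rfl rfl
  simp only [q18] at hG
  have hr2 := hG.two_le hpar h1 hi
  have hcross := hG.lists_cross
  rw [hcl] at hG ht₂
  have hflat := hG.length_flat hnd
  have hfl2 := length_flat_le hr2 hG.ne_nil
  have hrf := le_length_flat hG.ne_nil
  have happ := hout.append hcross fun a b hab hab' => hRS a b hab hab'.2.2
  -- All pairs listed are distinct, so there are at most N² of them and the output addresses fit in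
  -- a word.
  have hmm : (out ++ cross gl (s₂.reg 43)).length ≤ N * N :=
    le_trans (happ.length_le fun a b hab => hab.elim (hRlt a b) fun h => ⟨h.1, h.2.1⟩)
      (Nat.mul_le_mul hm hm)
  rw [List.length_append] at hmm
  have q55 : s₂.reg 55 = out.length := by
    rw [hF₂.reg 55 (by omega) rfl, hF₁.reg 55 (by omega) rfl, h55]
  have q1 : PairsAt (s₂.arr 1) (s₂.arr 14) out := by
    rw [hp₂.order, hF₂.arr 1 rfl, hF₁.arr 1 rfl]; exact hpairs
  refine (tr_emit hW (by omega) hp₂.reg_width rfl hR₂ (by omega) q55 q1 hmm).frame ?_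
  rintro t₃ s₃ hF₃ ⟨ht₃, h55₃, h1₃⟩
  rw [hp₂.order] at h1₃
  refine ⟨cross gl (s₂.reg 43), gl, by omega, ?_, fun j hj => ?_, h55₃, h1₃, happ⟩
  · rw [hF₃.arr 24 rfl, hF₃.arr 25 rfl]; exact hR₂
  · rw [hF₃.arr 21 rfl, h21₂, hF₁.arr 21 rfl]
    refine if_congr ⟨fun h => h.2, fun h => ⟨?_, h⟩⟩ rfl rfl
    rw [hcl, hmem]
    exact ⟨hj, h.2 ▸ sepSet_subset j⟩

/-- Output the pairs split by some separator. -/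
def enumerate : Prog :=
  sto 21 (.lit 0) (.lit 1) ⨾ asg 55 (.lit 0) ⨾
  forr 37 1 (cnd (.eq (.load 21 (.reg 37)) (.lit 0)) splitPairs .skip) ⨾
  sto 1 (.lit 0) (.reg 1) ⨾ sto 1 (.lit 1) (.reg 55)

/-- A separator is processed at its earliest position and suppressed at later ones by the marks in
array 21. Position 0 is marked at the outset because it has no parent. Hence the sizes of the
processed separators add up to at most N, which gives the factor 100 N from 40 N + 60 m. -/
theorem tr_enumerate {w N m k : ℕ} {σ : State} {P : ℕ → Finset ℕ} {sl : ℕ → List ℕ}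
    {f pa : ℕ → ℕ} (hW : 16 * (N + 3) ^ 2 < cap w) (hm : m ≤ N)
    (hk : 1 ≤ k) (hkN : 2 ^ k * 2 ^ k ≤ N + 4)
    (hsl : ∀ j < m, (sl j).Nodup ∧ (sl j).toFinset = sepSet P j) (hPN : ∀ j, ∀ v ∈ P j, v ≤ N)
    (hsum : ∑ j ∈ Finset.range m, (sepSet P j).card ≤ N)
    (hpar : IsParentMap P (fun j => pa j - 1) m)
    (huniq : ∀ S a b, a < m → b < m → Splits P (fun j => pa j - 1) S a b → P a ∩ P b = S)
    (hp : Prepared N m k P sl f pa σ)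
    (ha21 : σ.arr 21 = fun _ => 0) (ha25 : σ.arr 25 = fun _ => 0) :
    Tr w enumerate σ fun t s => ∃ out,
      t ≤ (m / k + 1) * (100 * N) + 100 * N + 600 * out.length + 30 ∧
      s.arr 1 0 = m ∧ s.arr 1 1 = out.length ∧ PairsAt (s.arr 1) f out ∧
      Lists (fun a b => a < m ∧ b < m ∧ ∃ i, 1 ≤ i ∧ i < m ∧
        Splits P (fun j => pa j - 1) (sepSet P i) a b) out := by
  have hln : ∀ x ≤ 96 * N + 144, x < cap w := fun x hx => linear_lt hW hx
  have c0 := cap_pos w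
  have c1 := hln 1 (by omega)
  refine Tr.seq_sto (by simpa using c0) (by simpa using c1) (Tr.seq_asg (by simpa using c0) ?_)
  refine Tr.seq_frame (R := fun t s => Prepared N m k P sl f pa s ∧ ∃ out,
      t ≤ (m / k + 1) * (100 * N) + 100 * N + 600 * out.length + 5 ∧
      s.reg 55 = out.length ∧ PairsAt (s.arr 1) f out ∧
      Lists (fun a b => a < m ∧ b < m ∧ ∃ i, 1 ≤ i ∧ i < m ∧
        Splits P (fun j => pa j - 1) (sepSet P i) a b) out) ?_ ?_
  · refine Tr.forr' (cnt := m) (fun i τ s => ∃ out gl,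
      τ ≤ (m / k + 1) * (40 * ∑ j ∈ Finset.range i, (sepSet P j).card + 60 * i) + 80 * i +
        600 * out.length ∧
      Prepared N m k P sl f pa s ∧ Rows (N + 1) (s.arr 24) (s.arr 25) gl ∧
      (∀ j < m, s.arr 21 j = 0 ↔ 1 ≤ j ∧ ∀ i', 1 ≤ i' → i' < i → sepSet P j ≠ sepSet P i') ∧
      s.reg 55 = out.length ∧ PairsAt (s.arr 1) f out ∧
      Lists (fun a b => a < m ∧ b < m ∧ ∃ i', 1 ≤ i' ∧ i' < i ∧
        Splits P (fun j => pa j - 1) (sepSet P i') a b) out)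
      (by omega) (by omega) (by omega) rfl rfl (by simpa using hp.reg_one) (hln _ (by omega))
      ⟨[], fun _ => [], by simp, ?_, ?_, ?_, by simp, fun q h => absurd h (by simp), ?_⟩ ?_ ?_
    · refine hp.of_eq (fun r hr => ?_) (fun a ha => ?_)
      · simp only [List.mem_cons, List.not_mem_nil, or_false] at hr
        rcases hr with rfl | rfl | rfl | rfl | rfl <;> simp
      · simp only [List.mem_cons, List.not_mem_nil, or_false] at ha
        rcases ha with rfl | rfl | rfl | rfl | rfl | rfl | rfl | rfl | rfl <;> simp
    · simpa [ha25] using Rows.empty (N + 1) (σ.arr 24)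
    · intro j hj
      by_cases h0 : j = 0
      · subst h0; simp
      · simp [ha21, h0]; omega
    · exact ⟨by simp, by simp⟩
    · rintro i τ s hi hF h37 ⟨out, gl, hτ, hps, hRs, h21, h55, hpairs, hout⟩
      rw [Finset.sum_range_succ]
      obtain ⟨B, hB⟩ : ∃ B, m / k + 1 = B := ⟨_, rfl⟩
      rw [hB] at hτ ⊢
      obtain ⟨T, hT⟩ : ∃ x, ∑ j ∈ Finset.range i, (sepSet P j).card = x := ⟨_, rfl⟩
      rw [hT] at hτ ⊢
      have e1 : B * (40 * (T + (sepSet P i).card) + 60 * (i + 1)) =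
        B * (40 * T + 60 * i) + B * (40 * (sepSet P i).card + 60) := by ring
      refine Tr.cnd (by simpa using c0) (fun hc => ?_) (fun hc => ?_)
      · have h0 : s.arr 21 i = 0 := by simpa [h37] using hc
        obtain ⟨h1, hnew⟩ := (h21 i hi).1 h0
        have hcard : (sepSet P i).card ≤ N := le_trans
          (Finset.single_le_sum (f := fun j => (sepSet P j).card) (fun _ _ => Nat.zero_le _)
            (Finset.mem_range.2 hi)) hsum
        refine (tr_splitPairs hW hm h1 hi hk hkN hsl hPN hcard hpar hps h37 hRs h55 hpairs hout
          (fun a b h => ⟨h.1, h.2.1⟩) ?_).frame ?_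
        -- A pair split by an earlier separator and by this one would identify both with the
        -- intersection of its two sets, but this separator is new.
        · rintro a b ⟨ha, hb, i', hi1, hi2, hsp⟩ hsp'
          exact hnew i' hi1 hi2 ((huniq _ a b ha hb hsp').symm.trans (huniq _ a b ha hb hsp))
        · rintro t s' hF' ⟨new, gl', ht, hR', h21', h55', hpairs', hout'⟩
          rw [hB] at ht
          refine ⟨out ++ new, gl', ?_, ?_, by simpa using hR', ?_, by simpa using h55',
            by simpa using hpairs', hout'.congr fun a b => ?_⟩
          · rw [e1, List.length_append]; simp; omega
          · refine (hps.of_frame hF' rfl rfl).of_eq (fun r hr => ?_) (fun a _ => rfl)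
            simp only [List.mem_cons, List.not_mem_nil, or_false] at hr
            rw [State.reg_setReg, if_neg (by omega)]
          · intro j hj
            rw [State.arr_setReg, h21' j hj]
            by_cases hji : 1 ≤ j ∧ sepSet P j = sepSet P i
            · rw [if_pos hji]
              simp only [one_ne_zero, false_iff, not_and, not_forall]
              exact fun _ => ⟨i, h1, by omega, by simpa using hji.2⟩
            · rw [if_neg hji, h21 j hj]
              refine and_congr_right fun hj1 => ⟨fun h i' hi1 hi2 => ?_, fun h i' hi1 hi2 =>
                h i' hi1 (by omega)⟩
              rcases Nat.lt_succ_iff_lt_or_eq.1 hi2 with h' | rfl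
              · exact h i' hi1 h'
              · exact fun h' => hji ⟨hj1, h'⟩
          · constructor
            · rintro (⟨ha, hb, i', hi1, hi2, hsp⟩ | ⟨ha, hb, hsp⟩)
              · exact ⟨ha, hb, i', hi1, by omega, hsp⟩
              · exact ⟨ha, hb, i, h1, by omega, hsp⟩
            · rintro ⟨ha, hb, i', hi1, hi2, hsp⟩
              rcases Nat.lt_succ_iff_lt_or_eq.1 hi2 with h' | rfl
              · exact Or.inl ⟨ha, hb, i', hi1, h', hsp⟩
              · exact Or.inr ⟨ha, hb, hsp⟩
      · have h0 : s.arr 21 i ≠ 0 := by simpa [h37] using hc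
        rw [Ne, h21 i hi] at h0
        have hold : 1 ≤ i → ∃ i', 1 ≤ i' ∧ i' < i ∧ sepSet P i = sepSet P i' := by
          intro h1
          by_contra hcon
          push Not at hcon
          exact h0 ⟨h1, hcon⟩
        refine Tr.skip ⟨out, gl, ?_, ?_, by simpa using hRs, fun j hj => ?_, by simpa using h55,
          by simpa using hpairs, hout.congr fun a b => ?_⟩
        · rw [e1]; simp; omega
        · refine hps.of_eq (fun r hr => ?_) (fun a _ => rfl)
          simp only [List.mem_cons, List.not_mem_nil, or_false] at hr
          rw [State.reg_setReg, if_neg (by omega)]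
        · rw [State.arr_setReg, h21 j hj]
          refine and_congr_right fun hj1 => ⟨fun h i' hi1 hi2 => ?_, fun h i' hi1 hi2 =>
            h i' hi1 (by omega)⟩
          rcases Nat.lt_succ_iff_lt_or_eq.1 hi2 with h' | rfl
          · exact h i' hi1 h'
          · obtain ⟨i'', ha, hb, hc⟩ := hold hi1
            rw [hc]; exact h i'' ha hb
        · constructor
          · rintro ⟨ha, hb, i', hi1, hi2, hsp⟩
            exact ⟨ha, hb, i', hi1, by omega, hsp⟩
          · rintro ⟨ha, hb, i', hi1, hi2, hsp⟩
            rcases Nat.lt_succ_iff_lt_or_eq.1 hi2 with h' | rfl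
            · exact ⟨ha, hb, i', hi1, h', hsp⟩
            · obtain ⟨i'', hc, hd, he⟩ := hold hi1
              exact ⟨ha, hb, i'', hc, hd, he ▸ hsp⟩
    · rintro τ s hF h37 ⟨out, gl, hτ, hps, hRs, h21, h55, hpairs, hout⟩
      refine ⟨hps, out, ?_, h55, hpairs, hout⟩
      have : (m / k + 1) * (40 * ∑ j ∈ Finset.range m, (sepSet P j).card + 60 * m) ≤
        (m / k + 1) * (100 * N) := Nat.mul_le_mul_left _ (by omega)
      omega
  · rintro t s hF ⟨hps, out, ht, h55, hpairs, hout⟩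
    refine Tr.seq_sto (by simpa using c0) (by simp) (Tr.sto (by simpa using c1) (by simp)
      ⟨out, by simp; omega, by simp [hps.reg_one], by simp [h55], fun q hq => ?_, hout⟩)
    have h2 : 2 + 2 * q ≠ 1 := by omega
    have h3 : 3 + 2 * q ≠ 1 := by omega
    simpa [h2, h3] using hpairs q hq

end WordRAM

namespace WordRAM

/-! ### The whole program -/

theorem Frame.seq {p q : Prog} {σ s s' : State} (h : Frame p σ s) (h' : Frame q s s') :
    Frame (p ⨾ q) σ s' := by
  refine ⟨fun r hr hw => ?_, fun a hw => ?_⟩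
  · simp only [Prog.writesReg, Bool.or_eq_false_iff] at hw
    rw [h'.reg r hr hw.2, h.reg r hr hw.1]
  · simp only [Prog.writesArr, Bool.or_eq_false_iff] at hw
    rw [h'.arr a hw.2, h.arr a hw.1]

/-- Input: an incidence graph. Output: the union join graph. -/
def unionJoin : Prog :=
  readInput ⨾ blockSize ⨾ andTable ⨾ bitTable ⨾ adjacency ⨾ search ⨾ separators ⨾ masks ⨾ enumerate

section

variable {L : List (ℕ × ℕ)} {ord : List ℕ} {m : ℕ}

theorem prefixUnion_posSet {i : ℕ} (hi : i ≤ ord.length) :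
    prefixUnion (posSet L ord) i = covered L (ord.take i) := by
  ext v
  simp only [mem_prefixUnion, covered, Finset.mem_biUnion, List.mem_toFinset,
    List.mem_take_iff_getElem, posSet]
  constructor
  · rintro ⟨j, hj, hv⟩
    have hj' : j < ord.length := by omega
    rw [List.getD_eq_getElem _ _ hj'] at hv
    exact ⟨_, ⟨j, by omega, rfl⟩, hv⟩
  · rintro ⟨_, ⟨j, hj, rfl⟩, hv⟩
    exact ⟨j, by omega, by rwa [List.getD_eq_getElem]⟩

theorem IsSearchOrder.isMaxCardinality (hnd : ord.Nodup) (hmem : ∀ e, e ∈ ord ↔ e < m)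
    (hlen : ord.length = m) (h : IsSearchOrder L m ord) :
    FamHypergraph.IsMaxCardinality (posSet L ord) m := by
  intro i hi j hj hij
  have hi' : i < ord.length := by omega
  have hj' : j < ord.length := by omega
  rw [prefixUnion_posSet hi'.le]
  simp only [posSet, List.getD_eq_getElem _ _ hi', List.getD_eq_getElem _ _ hj']
  refine h i hi' _ ((hmem _).1 (List.getElem_mem hj')) fun hmt => ?_
  obtain ⟨a, ha, haj⟩ := List.mem_take_iff_getElem.1 hmt
  have := (hnd.getElem_inj_iff).1 haj
  omega

/-- Each separator is part of its own hyperedge; this makes the total size of the separators linear.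
-/
theorem sum_card_sepSet_le (hnd : ord.Nodup) :
    ∑ j ∈ Finset.range ord.length, (sepSet (posSet L ord) j).card ≤ L.length := by
  have key : ∀ i ≤ ord.length, ∑ j ∈ Finset.range i, (sepSet (posSet L ord) j).card ≤
      sizeSum L (ord.take i).toFinset := by
    intro i
    induction i with
    | zero => simp
    | succ i ih =>
      intro hi
      rw [Finset.sum_range_succ, sizeSum_take_succ hnd (by omega)]
      refine Nat.add_le_add (ih (by omega)) ?_
      refine le_trans (Finset.card_le_card (sepSet_subset i)) ?_
      rw [posSet, List.getD_eq_getElem _ _ (by omega)]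
      exact List.toFinset_card_le _
  exact le_trans (key _ le_rfl) (sizeSum_le L _)

/-- The hyperedge at a position of the order. -/
def listing (ord : List ℕ) (h : ∀ i, ord.getD i 0 < m) (i : ℕ) : Fin m := ⟨ord.getD i 0, h i⟩

theorem isListing_listing (hnd : ord.Nodup) (hmem : ∀ e, e ∈ ord ↔ e < m)
    (hlen : ord.length = m) (h : ∀ i, ord.getD i 0 < m) :
    FamHypergraph.IsListing (listing ord h) m := by
  refine ⟨fun i hi j hj hij => ?_, fun e => ?_⟩
  · have hij' := congrArg Fin.val hij
    simp only [listing] at hij'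
    rw [List.getD_eq_getElem _ _ (by omega), List.getD_eq_getElem _ _ (by omega)] at hij'
    exact (hnd.getElem_inj_iff).1 hij'
  · obtain ⟨i, hi, hie⟩ := List.getElem_of_mem ((hmem e).2 e.2)
    refine ⟨i, by omega, Fin.ext ?_⟩
    simp only [listing]
    rw [List.getD_eq_getElem _ _ hi, hie]

/-- Beyond the end of the list, the default 0 is still a hyperedge because 1 ≤ m. This makes
`listing` total. -/
theorem getD_lt (hm : 1 ≤ m) (hlt : ∀ e ∈ ord, e < m) (i : ℕ) : ord.getD i 0 < m := by
  by_cases hi : i < ord.length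
  · rw [List.getD_eq_getElem _ _ hi]; exact hlt _ (List.getElem_mem hi)
  · rw [List.getD_eq_default _ _ (not_lt.1 hi)]; omega

end

theorem Lists.isEdgeList {ι : Type*} {G : SimpleGraph ι} {o : ℕ → ι} {m : ℕ} {R : ℕ → ℕ → Prop}
    {out : List (ℕ × ℕ)} (ho : FamHypergraph.IsListing o m) (h : Lists R out)
    (hR : ∀ a b, R a b ↔ a < m ∧ b < m ∧ G.Adj (o a) (o b)) :
    G.IsEdgeList (out.map fun p => (o p.1, o p.2)) := by
  have hout : ∀ p ∈ out, p.1 < m ∧ p.2 < m := fun p hp => by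
    have := (hR _ _).1 ((h.2 p.1 p.2).1 (List.mem_map_of_mem (f := fun p : ℕ × ℕ => s(p.1, p.2)) hp))
    exact ⟨this.1, this.2.1⟩
  have hinj : ∀ a b c d, a < m → b < m → c < m → d < m → s(o a, o b) = s(o c, o d) →
      s(a, b) = s(c, d) := by
    intro a b c d ha hb hc hd heq
    rw [Sym2.eq_iff] at heq ⊢
    rcases heq with ⟨h1, h2⟩ | ⟨h1, h2⟩
    · exact Or.inl ⟨ho.inj _ ha _ hc h1, ho.inj _ hb _ hd h2⟩
    · exact Or.inr ⟨ho.inj _ ha _ hd h1, ho.inj _ hb _ hc h2⟩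
  refine ⟨?_, fun z => ?_⟩
  · rw [List.map_map]
    refine List.Nodup.map_on (fun p hp q hq heq => ?_) (h.1.of_map _)
    obtain ⟨hp1, hp2⟩ := hout p hp
    obtain ⟨hq1, hq2⟩ := hout q hq
    exact List.inj_on_of_nodup_map h.1 hp hq (hinj _ _ _ _ hp1 hp2 hq1 hq2 heq)
  · induction z with
    | _ x y =>
      obtain ⟨a, ha, rfl⟩ := ho.surj x
      obtain ⟨b, hb, rfl⟩ := ho.surj y
      rw [SimpleGraph.mem_edgeSet]
      have h1 := (h.2 a b).trans (hR a b)
      rw [and_iff_right ha, and_iff_right hb] at h1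
      rw [← h1, List.map_map]
      simp only [List.mem_map, Function.comp]
      constructor
      · rintro ⟨p, hp, heq⟩
        exact ⟨p, hp, hinj _ _ _ _ (hout p hp).1 (hout p hp).2 ha hb heq⟩
      · rintro ⟨p, hp, heq⟩
        exact ⟨p, hp, congrArg (Sym2.map o) heq⟩

theorem length_pairWords {a b : ℕ} (L : List (Fin a × Fin b)) :
    (pairWords L).length = 2 * L.length := by
  induction L with
  | nil => rfl
  | cons p L ih =>
    rw [pairWords] at ih ⊢
    simp [ih]; omega

theorem getElem_pairWords {a b : ℕ} (L : List (Fin a × Fin b)) (q : ℕ) (hq : q < L.length) :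
    (pairWords L).getD (2 * q) 0 = L[q].1 ∧ (pairWords L).getD (2 * q + 1) 0 = L[q].2 := by
  induction L generalizing q with
  | nil => simp at hq
  | cons p L ih =>
    have hc : pairWords (p :: L) = (p.1 : ℕ) :: (p.2 : ℕ) :: pairWords L := rfl
    rw [hc]
    cases q with
    | zero => simp
    | succ q =>
      have := ih q (by simpa using hq)
      simpa [Nat.mul_succ] using this

theorem hasOutput_encodeGraph {m : ℕ} {s : State} {f : ℕ → ℕ} {o : ℕ → Fin m}
    {out : List (ℕ × ℕ)} (h0 : s.arr 1 0 = m) (h1 : s.arr 1 1 = out.length)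
    (h : PairsAt (s.arr 1) f out) (hf : ∀ p ∈ out, f p.1 = o p.1 ∧ f p.2 = o p.2) :
    HasOutput s (encodeGraph (out.map fun p => (o p.1, o p.2))) := by
  intro i hi
  rw [← List.getD_eq_getElem _ 0 hi]
  match i with
  | 0 => simpa [encodeGraph] using h0
  | 1 => simpa [encodeGraph] using h1
  | i + 2 =>
    simp only [encodeGraph, List.length_cons, length_pairWords, List.length_map] at hi
    have hq : i / 2 < out.length := by omega
    obtain ⟨h2, h3⟩ := getElem_pairWords (out.map fun p => (o p.1, o p.2)) (i / 2)
      (by simpa using hq)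
    obtain ⟨h4, h5⟩ := h (i / 2) hq
    obtain ⟨h6, h7⟩ := hf _ (List.getElem_mem hq)
    simp only [encodeGraph, List.getD_cons_succ]
    rcases Nat.mod_two_eq_zero_or_one i with hmod | hmod
    · have e1 : 2 * (i / 2) = i := by omega
      have e2 : 2 + 2 * (i / 2) = i + 2 := by omega
      rw [e1] at h2
      rw [e2] at h4
      rw [h2, h4, h6]; simp
    · have e1 : 2 * (i / 2) + 1 = i := by omega
      have e2 : 3 + 2 * (i / 2) = i + 2 := by omega
      rw [e1] at h3
      rw [e2] at h5
      rw [h3, h5, h7]; simp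

/-- The only terms not linear in N come from `tr_enumerate`. The two bounds on k supplied by
`blockSize` act at opposite ends: one limits the tables here, the other is handed on to `time_le`.
-/
theorem tr_unionJoin {w N n m : ℕ} {σ : State} {L : List (ℕ × ℕ)} {H : FamHypergraph ℕ (Fin m)}
    (hW : 16 * (N + 3) ^ 2 < cap w) (hm1 : 1 ≤ m) (hm : m ≤ N) (hL : L.length = N) (hnd : L.Nodup)
    (hv : ∀ p ∈ L, p.1 ≤ N ∧ p.2 < m) (hedge : ∀ e : Fin m, H.edge e = edgeSet L e)
    (hH : H.IsAcyclic) (hreg : σ.reg 13 = 0) (hz : ∀ a, a ≠ 0 → σ.arr a = fun _ => 0)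
    (h0 : σ.arr 0 0 = n) (h1 : σ.arr 0 1 = m) (h2 : σ.arr 0 2 = N)
    (hin : ∀ j (h : j < L.length), σ.arr 0 (3 + 2 * j) = L[j].1 ∧ σ.arr 0 (4 + 2 * j) = L[j].2) :
    Tr w unionJoin σ fun t s => ∃ (out : List (Fin m × Fin m)) (k : ℕ),
      H.unionJoinGraph.IsEdgeList out ∧ HasOutput s (encodeGraph out) ∧ 1 ≤ k ∧
      N < 4 * (2 ^ k * 2 ^ k) ∧
      t ≤ (m / k + 1) * (100 * N) + 2000 * N + 600 * out.length + 1000 := by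
  have hln : ∀ x ≤ 96 * N + 144, x < cap w := fun x hx => linear_lt hW hx
  refine Tr.seq_frame (tr_readInput hW h0 h1 h2) ?_
  rintro t₁ s₁ F₁ ⟨ht₁, -, r1, r2, r3⟩
  refine Tr.seq_frame (tr_blockSize hW r2) ?_
  rintro t₂ s₂ G₂ ⟨ht₂, k, hk, k4, k5, hkN, hNk⟩
  -- The composed frames are named by their starting points: F from the initial state, E from after
  -- the reading of the input, D from after the block size, C from after the conjunction table, B
  -- from after the bit table.
  have F₂ := F₁.seq G₂
  have hK1 : 1 ≤ 2 ^ k := Nat.one_le_two_pow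
  have hKN : 2 ^ k ≤ N + 4 := le_trans (Nat.le_mul_of_pos_left _ (by positivity)) hkN
  refine Tr.seq_frame (tr_andTable (hln _ (by omega)) k5 hK1
    (by rw [F₂.arr 6 rfl, hz 6 (by omega)])) ?_
  rintro t₃ s₃ G₃ ⟨ht₃, hand⟩
  have F₃ := F₂.seq G₃
  refine Tr.seq_frame (tr_bitTable (hln _ (by omega)) (by rw [G₃.reg 5 (by omega) rfl, k5]) hK1
    (by rw [F₃.arr 7 rfl, hz 7 (by omega)]) (by rw [F₃.arr 8 rfl, hz 8 (by omega)])) ?_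
  rintro t₄ s₄ G₄ ⟨ht₄, hbit⟩
  have F₄ := F₃.seq G₄
  have E₄ := (G₂.seq G₃).seq G₄
  refine Tr.seq_frame (tr_adjacency (L := L) hW hL (by rw [E₄.reg 2 (by omega) rfl, r2])
    (by rw [E₄.reg 3 (by omega) rfl, r3]) (fun p hp => ⟨(hv p hp).1, by have := (hv p hp).2; omega⟩)
    (fun j hj => by rw [F₄.arr 0 rfl]; exact hin j hj)
    (by rw [F₄.arr 3 rfl, hz 3 (by omega)]) (by rw [F₄.arr 5 rfl, hz 5 (by omega)])) ?_
  rintro t₅ s₅ G₅ ⟨ht₅, hE, hV⟩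
  have F₅ := F₄.seq G₅
  have E₅ := E₄.seq G₅
  refine Tr.seq_frame (tr_search hW hm hL hnd hv (by rw [E₅.reg 1 (by omega) rfl, r1])
    (by rw [E₅.reg 3 (by omega) rfl, r3]) hE hV (by rw [F₅.reg 13 (by omega) rfl, hreg])
    (by rw [F₅.arr 10 rfl, hz 10 (by omega)]) (by rw [F₅.arr 11 rfl, hz 11 (by omega)])
    (by rw [F₅.arr 12 rfl, hz 12 (by omega)]) (by rw [F₅.arr 13 rfl, hz 13 (by omega)])) ?_
  rintro t₆ s₆ G₆ ⟨ht₆, ord, hord, hmem, hso, hO⟩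
  have F₆ := F₅.seq G₆
  have E₆ := E₅.seq G₆
  have hlt : ∀ e ∈ ord, e < m := fun e he => (hmem e).1 he
  have hlen : ord.length = m := by
    have h3 : ord.toFinset = Finset.range m := by ext e; simp [hmem]
    rw [← List.toFinset_card_of_nodup hord, h3, Finset.card_range]
  refine Tr.seq_frame (tr_separators hW hm hL hnd hord hlt hlen
    (by rw [E₆.reg 1 (by omega) rfl, r1]) (by rw [E₆.reg 3 (by omega) rfl, r3])
    (by rw [G₆.arr 2 rfl, G₆.arr 3 rfl]; exact hE) hO
    (by rw [F₆.arr 15 rfl, hz 15 (by omega)]) (by rw [F₆.arr 17 rfl, hz 17 (by omega)])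
    (by rw [F₆.arr 18 rfl, hz 18 (by omega)])) ?_
  rintro t₇ s₇ G₇ ⟨ht₇, ⟨sl, hsl, hsl'⟩, hcov⟩
  have F₇ := F₆.seq G₇
  have E₇ := E₆.seq G₇
  have D₇ := ((G₃.seq G₄).seq G₅).seq (G₆.seq G₇)
  refine Tr.seq_frame (tr_masks hW hm hL hnd hv hord hlt hlen
    (by rw [E₇.reg 1 (by omega) rfl, r1]) (by rw [E₇.reg 3 (by omega) rfl, r3])
    (by rw [D₇.reg 4 (by omega) rfl, k4]) hk hKN
    (by rw [(G₆.seq G₇).arr 2 rfl, (G₆.seq G₇).arr 3 rfl]; exact hE)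
    (by rw [G₇.arr 14 rfl]; exact hO)
    (by rw [F₇.arr 19 rfl, hz 19 (by omega)]) (by rw [F₇.arr 20 rfl, hz 20 (by omega)])) ?_
  rintro t₈ s₈ G₈ ⟨ht₈, h36, h20, h19⟩
  have F₈ := F₇.seq G₈
  have E₈ := E₇.seq G₈
  have D₈ := D₇.seq G₈
  have C₈ := ((G₄.seq G₅).seq (G₆.seq G₇)).seq G₈
  have B₈ := (G₅.seq (G₆.seq G₇)).seq G₈
  have ho := isListing_listing hord hmem hlen (getD_lt hm1 hlt)
  obtain ⟨o, hoe⟩ : ∃ o, listing ord (getD_lt hm1 hlt) = o := ⟨_, rfl⟩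
  have hov : ∀ i, (o i : ℕ) = ord.getD i 0 := fun i => by rw [← hoe]; rfl
  rw [hoe] at ho
  have hP : (fun i => H.edge (o i)) = posSet L ord := by
    funext i
    rw [hedge, hov]; rfl
  have hmax := hso.isMaxCardinality hord hmem hlen
  have hrip : ∀ i, 1 ≤ i → i < m → ∃ j < i, sepSet (posSet L ord) i ⊆ posSet L ord j := by
    have := hH.exists_parent ho (by rw [hP]; exact hmax)
    intro i hi him
    obtain ⟨j, hj, hsub⟩ := this i hi him
    rw [hP] at hsub
    exact ⟨j, hj, by rw [← hP] at hsub ⊢; exact hsub⟩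
  have hpar := isParentMap_of_coverTime hrip hcov
  have hprep : Prepared N m k (posSet L ord) sl (s₈.arr 14) (s₇.arr 18) s₈ := by
    refine ⟨by rw [E₈.reg 1 (by omega) rfl, r1], by rw [E₈.reg 3 (by omega) rfl, r3],
      by rw [D₈.reg 4 (by omega) rfl, k4], by rw [D₈.reg 5 (by omega) rfl, k5], h36, rfl,
      G₈.arr 18 rfl, ?_, ?_, ?_, h20, h19⟩
    · rw [G₈.arr 16 rfl, G₈.arr 17 rfl]; exact hsl
    · rw [C₈.arr 6 rfl]; exact hand
    · rw [B₈.arr 7 rfl, B₈.arr 8 rfl]; exact hbit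
  refine (tr_enumerate hW hm hk hkN hsl' ?_ ?_ hpar ?_ hprep
    (by rw [F₈.arr 21 rfl, hz 21 (by omega)]) (by rw [F₈.arr 25 rfl, hz 25 (by omega)])).mono ?_
  · intro j v hvj
    exact (hv _ (mem_edgeSet.1 hvj)).1
  · rw [← hlen, ← hL]; exact sum_card_sepSet_le hord
  · intro S a b ha hb hS
    rw [← hP] at hS hpar ⊢
    exact FamHypergraph.Splits.inter_subset ho hpar ha hb hS
  · rintro t₉ s₉ ⟨out, ht₉, u0, u1, hpairs, hlists⟩
    have hR : ∀ a b, (a < m ∧ b < m ∧ ∃ i, 1 ≤ i ∧ i < m ∧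
        Splits (posSet L ord) (fun j => s₇.arr 18 j - 1) (sepSet (posSet L ord) i) a b) ↔
        a < m ∧ b < m ∧ H.unionJoinGraph.Adj (o a) (o b) := by
      intro a b
      refine and_congr_right fun ha => and_congr_right fun hb => ?_
      rw [← hP] at hpar ⊢
      exact (FamHypergraph.unionJoinGraph_adj_iff_splits ho hpar ha hb).symm
    refine ⟨out.map fun p => (o p.1, o p.2), k, hlists.isEdgeList ho hR,
      hasOutput_encodeGraph u0 u1 hpairs fun p hp => ?_, hk, hNk, ?_⟩
    · have := (hlists.2 p.1 p.2).1
        (List.mem_map_of_mem (f := fun p : ℕ × ℕ => s(p.1, p.2)) hp)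
      have key : ∀ a < m, s₈.arr 14 a = (o a : ℕ) := fun a ha => by
        rw [(G₇.seq G₈).arr 14 rfl, hov, List.getD_eq_getElem _ _ (by omega)]
        exact hO a (by omega)
      exact ⟨key _ this.1, key _ this.2.1⟩
    · rw [List.length_map]
      omega

end WordRAM

/-! ### Renaming vertices, and sizes of the input and of the output. -/

namespace FamHypergraph

variable {V W ι : Type*}

/-- Rename the vertices. -/
def mapVertices (f : V ↪ W) (H : FamHypergraph V ι) : FamHypergraph W ι where
  edge e := (H.edge e).map f
  edge_nonempty e := (H.edge_nonempty e).map

/-- A new name that is not an image lies in no hyperedge, so its subtree condition is vacuous. -/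
theorem isJoinTree_mapVertices {f : V ↪ W} {H : FamHypergraph V ι} {T : SimpleGraph ι} :
    (H.mapVertices f).IsJoinTree T ↔ H.IsJoinTree T := by
  have hset : ∀ v, {e | f v ∈ (H.mapVertices f).edge e} = {e | v ∈ H.edge e} := fun v =>
    Set.ext fun e => Finset.mem_map' f
  refine and_congr_right fun _ => ⟨fun h v => ?_, fun h x => ?_⟩
  · have := h (f v)
    rwa [hset v] at this
  · by_cases hx : ∃ v, f v = x
    · obtain ⟨v, rfl⟩ := hx
      rw [hset v]; exact h v
    · rintro ⟨e, he⟩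
      obtain ⟨v, -, hv⟩ := Finset.mem_map.1 he
      exact absurd ⟨v, hv⟩ hx

theorem unionJoinGraph_mapVertices (f : V ↪ W) (H : FamHypergraph V ι) :
    (H.mapVertices f).unionJoinGraph = H.unionJoinGraph := by
  simp only [unionJoinGraph, isJoinTree_mapVertices]

theorem IsAcyclic.mapVertices {H : FamHypergraph V ι} (hH : H.IsAcyclic) (f : V ↪ W) :
    (H.mapVertices f).IsAcyclic :=
  hH.imp fun _ => isJoinTree_mapVertices.2

theorem IsAcyclic.nonempty {H : FamHypergraph V ι} (hH : H.IsAcyclic) : Nonempty ι := by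
  obtain ⟨T, hT, -⟩ := hH
  exact hT.1.nonempty

/-- Connectedness excludes isolated vertices; this bounds the number of vertices by N, and so their
names fit the row width. -/
theorem exists_mem_edge [Nonempty ι] {H : FamHypergraph V ι} (hc : H.incidenceGraph.Connected)
    (v : V) : ∃ e, v ∈ H.edge e := by
  obtain ⟨e₀⟩ := ‹Nonempty ι›
  obtain ⟨p⟩ := hc.preconnected (Sum.inl v) (Sum.inr e₀)
  cases p with
  | cons h _ =>
    rcases h with ⟨u, e, hu, h1, -⟩ | ⟨u, e, -, h1, -⟩
    · cases h1; exact ⟨e, hu⟩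
    · simp at h1

theorem IsIncidenceList.length_eq [Fintype ι] {H : FamHypergraph V ι} {L : List (V × ι)}
    (hL : H.IsIncidenceList L) : L.length = H.totalSize := by
  classical
  rw [← List.toFinset_card_of_nodup hL.1, totalSize,
    Finset.card_eq_sum_card_fiberwise (f := Prod.snd) (t := Finset.univ) (fun _ _ => by simp)]
  refine Finset.sum_congr rfl fun e _ => ?_
  rw [← Finset.card_map (s := H.edge e) ⟨fun v => (v, e), fun _ _ h => (Prod.mk.inj h).1⟩]
  congr 1
  ext ⟨v, e'⟩
  simp only [Finset.mem_filter, List.mem_toFinset, hL.2, Finset.mem_map]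
  constructor
  · rintro ⟨h, rfl⟩; exact ⟨v, h, rfl⟩
  · rintro ⟨u, h, huv⟩
    obtain ⟨rfl, rfl⟩ := Prod.mk.inj huv
    exact ⟨h, rfl⟩

end FamHypergraph

theorem SimpleGraph.IsEdgeList.length_eq {ι : Type*} {G : SimpleGraph ι} {L : List (ι × ι)}
    (h : G.IsEdgeList L) : L.length = G.edgeSet.ncard := by
  classical
  have : G.edgeSet = ((L.map fun p => s(p.1, p.2)).toFinset : Set (Sym2 ι)) := by
    ext z
    rw [Finset.mem_coe, List.mem_toFinset, h.2]
  rw [this, Set.ncard_coe_finset, List.toFinset_card_of_nodup h.1, List.length_map]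

/-! ### From the block length to the logarithm. -/

namespace WordRAM

/-- The running time in terms of the block length, simplified. -/
theorem time_le {N m k e t : ℕ} (hm1 : 1 ≤ m) (hm : m ≤ N) (hk : 1 ≤ k)
    (hN : N < 4 * (2 ^ k * 2 ^ k))
    (ht : t ≤ (m / k + 1) * (100 * N) + 2000 * N + 600 * e + 1000) :
    (t : ℝ) ≤ 4000 * ((N : ℝ) ^ 2 / Real.log N + ((m + e : ℕ) : ℝ)) := by
  have hk' : (1 : ℝ) ≤ k := by exact_mod_cast hk
  have hm' : (1 : ℝ) ≤ m := by exact_mod_cast hm1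
  have hmN : (m : ℝ) ≤ N := by exact_mod_cast hm
  have he : (0 : ℝ) ≤ e := Nat.cast_nonneg e
  have ht' : (t : ℝ) ≤ ((m / k : ℕ) + 1) * (100 * N) + 2000 * N + 600 * e + 1000 := by
    exact_mod_cast ht
  have hdiv : ((m / k : ℕ) : ℝ) ≤ m / k := Nat.cast_div_le
  push_cast
  rcases Nat.lt_or_ge N 2 with h2 | h2
  -- Here the logarithm vanishes and the quotient is 0 by convention; the vertex count m = 1 in the
  -- size of the graph carries the constant.
  · obtain rfl : N = 1 := by omega
    have hm1' : (m : ℝ) = 1 := by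
      have : m = 1 := by omega
      exact_mod_cast this
    have : (m : ℝ) / k ≤ 1 := by rw [hm1']; exact div_le_one_of_le₀ hk' (by linarith)
    simp only [Nat.cast_one, Real.log_one, div_zero, mul_one] at ht' ⊢
    nlinarith
  · have hN2 : (2 : ℝ) ≤ N := by exact_mod_cast h2
    have hlog : 0 < Real.log N := Real.log_pos (by linarith)
    have hlogN : Real.log N ≤ N := (Real.log_le_self (by linarith))
    -- N ≤ 2^(2k+2) gives log N ≤ (2k+2) log 2, and 2k + 2 ≤ 4k since 1 ≤ k.
    have hlogk : Real.log N ≤ 4 * k := by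
      have h1 : (N : ℝ) ≤ 4 * (2 ^ k * 2 ^ k) := by exact_mod_cast hN.le
      have h3 : (4 : ℝ) * (2 ^ k * 2 ^ k) = 2 ^ (2 * k + 2) := by ring
      rw [h3] at h1
      have h4 := Real.log_le_log (by linarith) h1
      rw [Real.log_pow] at h4
      have h5 := Real.log_two_lt_d9
      push_cast at h4
      nlinarith
    set X := (N : ℝ) ^ 2 / Real.log N with hX
    have hNX : (N : ℝ) ≤ X := by
      rw [hX, le_div_iff₀ hlog]; nlinarith
    have hmk : (m : ℝ) / k * N ≤ 4 * X := by
      have h1 : (m : ℝ) / k ≤ 4 * N / Real.log N := by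
        rw [div_le_div_iff₀ (by linarith) hlog]
        nlinarith
      calc (m : ℝ) / k * N ≤ 4 * N / Real.log N * N := by gcongr
        _ = 4 * X := by rw [hX]; ring
    have h6 : ((m / k : ℕ) : ℝ) * N ≤ 4 * X := le_trans (by gcongr) hmk
    nlinarith

end WordRAM

/-! ### The theorem, for hypergraphs on `Fin n` and `Fin m`. -/

theorem mainTheorem4 :
    ∃ (P : WordRAM.Prog) (c : ℕ) (C : ℝ),
      ∀ (n m : ℕ) (H : FamHypergraph (Fin n) (Fin m)),
        H.incidenceGraph.Connected → H.IsAcyclic →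
        ∀ L : List (Fin n × Fin m), H.IsIncidenceList L →
        ∀ w : ℕ, (H.totalSize + 2) ^ c ≤ 2 ^ w →
          ∃ (t : ℕ) (s : WordRAM.State) (out : List (Fin m × Fin m)),
            WordRAM.Exec w P (WordRAM.initState (WordRAM.encodeIncidence L)) t s ∧
            H.unionJoinGraph.IsEdgeList out ∧
            WordRAM.HasOutput s (WordRAM.encodeGraph out) ∧
            (t : ℝ) ≤ C * ((H.totalSize : ℝ) ^ 2 / Real.log (H.totalSize : ℝ) +
              (H.unionJoinGraph.graphSize : ℝ)) := by
  refine ⟨WordRAM.unionJoin, 6, 4000, fun n m H hconn hacyc L hL w hw => ?_⟩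
  have : Nonempty (Fin m) := hacyc.nonempty
  have hm1 : 1 ≤ m := Fin.pos_iff_nonempty.2 this
  have hlen := hL.length_eq
  obtain ⟨N, hN⟩ : ∃ N, H.totalSize = N := ⟨_, rfl⟩
  rw [hN] at hw hlen ⊢
  have hcard : L.toFinset.card = N := by rw [List.toFinset_card_of_nodup hL.1, hlen]
  have hm : m ≤ N := by
    have h1 : L.toFinset.image Prod.snd = Finset.univ := by
      ext e
      obtain ⟨v, hv⟩ := H.edge_nonempty e
      simpa using ⟨v, (hL.2 v e).2 hv⟩
    have h2 := Finset.card_image_le (s := L.toFinset) (f := Prod.snd)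
    rw [h1, hcard, Finset.card_univ, Fintype.card_fin] at h2
    exact h2
  have hn : n ≤ N := by
    have h1 : L.toFinset.image Prod.fst = Finset.univ := by
      ext v
      obtain ⟨e, he⟩ := FamHypergraph.exists_mem_edge hconn v
      simpa using ⟨e, (hL.2 v e).2 he⟩
    have h2 := Finset.card_image_le (s := L.toFinset) (f := Prod.fst)
    rw [h1, hcard, Finset.card_univ, Fintype.card_fin] at h2
    exact h2
  have hW : 16 * (N + 3) ^ 2 < WordRAM.cap w := by
    refine lt_of_lt_of_le ?_ hw
    -- The exponent 6 is generous: since 1 ≤ N, the factor (N + 2)^4 is at least 81, and 81 (N + 2)²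
    -- exceeds 16 (N + 3)².
    have h1 : (N + 2) ^ 6 = (N + 2) ^ 4 * (N + 2) ^ 2 := by ring
    have h2 : 3 ^ 4 ≤ (N + 2) ^ 4 := Nat.pow_le_pow_left (by omega) 4
    rw [h1]
    nlinarith [Nat.mul_le_mul_right ((N + 2) ^ 2) h2]
  obtain ⟨L', hL'⟩ : ∃ L' : List (ℕ × ℕ), L.map (fun p => ((p.1 : ℕ), (p.2 : ℕ))) = L' := ⟨_, rfl⟩
  have hL'len : L'.length = N := by rw [← hL', List.length_map, hlen]
  have hinput : ∀ i, (WordRAM.initState (WordRAM.encodeIncidence L)).arr 0 i =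
      (WordRAM.encodeIncidence L).getD i 0 :=
    fun i => by simp [WordRAM.initState]
  obtain ⟨t, s, σ, hex, hsim, out, k, hedges, hout, hk, hNk, ht⟩ :=
    WordRAM.tr_unionJoin (w := w) (N := N) (n := n) (m := m) (L := L')
      (H := H.mapVertices Fin.valEmbedding)
      (σ := WordRAM.initState (WordRAM.encodeIncidence L)) hW hm1 hm hL'len
      (by
        rw [← hL']
        refine hL.1.map fun p q h => ?_
        exact Prod.ext (Fin.ext (Prod.mk.inj h).1) (Fin.ext (Prod.mk.inj h).2))
      (by
        rw [← hL']
        intro p hp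
        obtain ⟨q, -, rfl⟩ := List.mem_map.1 hp
        exact ⟨by have := q.1.2; simp only; omega, q.2.2⟩)
      (by
        intro e
        ext v
        simp only [FamHypergraph.mapVertices, Finset.mem_map, WordRAM.mem_edgeSet, ← hL', List.mem_map,
          Prod.mk.injEq, Fin.valEmbedding_apply]
        constructor
        · rintro ⟨u, hu, rfl⟩
          exact ⟨(u, e), (hL.2 u e).2 hu, rfl, rfl⟩
        · rintro ⟨⟨u, e'⟩, hu, rfl, he⟩
          obtain rfl : e' = e := Fin.ext he
          exact ⟨u, (hL.2 u e').1 hu, rfl⟩)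
      (hacyc.mapVertices _) rfl (fun a ha => by funext i; simp [WordRAM.initState, ha])
      (by rw [hinput]; rfl) (by rw [hinput]; rfl) (by rw [hinput]; exact hlen)
      (by
        intro j hj
        have hj' : j < L.length := by omega
        obtain ⟨h1, h2⟩ := WordRAM.getElem_pairWords L j hj'
        rw [hinput, hinput, show 3 + 2 * j = 2 * j + 1 + 1 + 1 by omega,
          show 4 + 2 * j = 2 * j + 1 + 1 + 1 + 1 by omega]
        simp only [WordRAM.encodeIncidence, List.getD_cons_succ, h1, h2]
        subst hL'
        simp)
      _ ⟨fun _ _ => rfl, rfl⟩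
  rw [FamHypergraph.unionJoinGraph_mapVertices] at hedges
  refine ⟨t, s, out, hex, hedges, fun i hi => ?_, ?_⟩
  · rw [hsim.2]; exact hout i hi
  · rw [SimpleGraph.graphSize, ← hedges.length_eq, Fintype.card_fin]
    exact WordRAM.time_le hm1 hm hk hNk ht
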